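/- **Setting.** Let $d,N\ge 1$ and let $\Omega\subset\mathbb R^d$ be a bounded, open, connected set with smooth boundary and outward unit normal $n$. Fix constants $D,\beta>0$, a differentiable pair potential $U$ with $U(z)=U(-z)$ $(z\in\Omega-\Omega)$, a force $Q:\Omega^2\to\mathbb R^d$ that is differentiable and divergence-free in its first argument, and put $K_2(x,y)=-\nabla_xU(x-y)+Q(x,y)$; assume that $K_2\in C^1(\Omega^2)$ is bounded. Let $R:\Omega\times[0,\infty)\to\mathbb R^d$ be divergence-free and $C^1$ in space and $C^\infty$ in time. An external potential is a function $V:\Omega\times[0,\infty)\to\mathbb R$ such that for each $t\ge0$, $V(\cdot,t)\in C^2(\Omega)$ and $\nabla_xV(\cdot,t)$ extends continuously to $\partial\Omega$. Put $F_{n,i}(x_1,\dots,x_n,t)=-\nabla V(x_i,t)+R(x_i,t)+\sum_{1\le j\le n,\,j\ne i}K_2(x_i,x_j)$. Time derivatives at $t=0$ are derivatives from the right. A *solution* for $V$ is a function $P\ge0$ on $\Omega^N\times[0,\infty)$, symmetric under permutations of the particles, with $\int_{\Omega^N}P(x,t)\,dx=1$ for all $t\ge0$ and $$\partial_tP=D\sum_{i=1}^N\nabla_{x_i}\cdot\big[\nabla_{x_i}P-\beta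 PF_{N,i}\big]\qquad\text{on }\Omega^N\times[0,\infty).$$ Its reduced densities are $\rho_n(x^n,t)=\frac{N!}{(N-n)!}\int_{\Omega^{N-n}}P(x^n,y,t)\,dy$ for $1\le n\le N$, and $\rho=\rho_1$, $\rho_{N+1}=0$. Its currents are $J_{N,i}=-D\nabla_{x_i}P+D\beta PF_{N,i}$. The *boundary condition* is $\int_\Omega\nabla_{x_i}\cdot J_{N,i}\,dx_i=0$ for all $i$, all $t\ge 0$, and all positions in $\Omega$ of the other particles: each particle has zero net flux through $\partial\Omega$, as is the case for no-flux and for periodic boundary conditions. The solution is *well behaved* if: $P\in C^2(\Omega^N\times[0,\infty))$; for each $t$, $P$ and $\nabla_{x^N}P$ extend continuously to $\overline{\Omega}^N$; the functions $\partial_tP$, $\nabla_{x^N}P$, $D\sum_{i\le n}\nabla_{x_i}\cdot[\nabla_{x_i}P-\beta PF_{n,i}]$, $D\sum_{i\le n}\nabla_{x_i}\cdot[\nabla_{x_i}P-\beta PF_{N,i}]$ and $D\sum_{n<i\le N}\nabla_{x_i}\cdot[\nabla_{x_i}P-\beta PF_{N,i}]$ $(1\le n\le N)$ are bounded on $\Omega^N\times[0,\infty)$,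 and $\nabla_xK_2$ is bounded on $\Omega^2$; and for $1\le i\le n\le N$ the integrals $E_{n,i}(x^n,t)=\int_\Omega\rho_{n+1}(x^n,y,t)K_2(x_i,y)\,dy$ exist and are $C^1$ on $\Omega^n\times[0,\infty)$. The system $(V,P)$ is *analytically accessible* if $P$ is a well-behaved solution for the external potential $V$ that satisfies the boundary condition, and for all $k\ge0$ and $1\le n\le N$: * (A1) $t\mapsto V(x,t)$ is real analytic on $[0,\infty)$ for each $x\in\Omega$, $\partial_t^kV\in C^2(\Omega\times[0,\infty))$, and $\partial_t^kV(\cdot,0)$ extends continuously to $\partial\Omega$; * (A2) $\partial_t^k\rho_n$ exists, is bounded and belongs to $C^2(\Omega^n\times[0,\infty))$, and $\partial_t^kR\in C^1(\Omega\times[0,\infty))$. Two external potentials $V,V'$ are *diffusion equivalent* for $\rho$ if $V-V'$ is a function of time only on $\{(x,t)\in\Omega\times[0,\infty):\rho(x,t)>0\}$. Write $d_V^{(k)}(x)=\partial_t^k(V-V')(x,t)|_{t=0}$. **Theorem 4.3.** Let $(V,P)$ and $(V',P')$ be two analytically accessible systems with the same $\Omega,N,D,\beta,U,Q,R$ and the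 same initial condition $P(\cdot,0)=P'(\cdot,0)>0$ on $\Omega^N$. Let $V$ and $V'$ be not diffusion equivalent for $\rho$. Then there is a smallest integer $l\ge0$ with $\nabla d_V^{(l)}\not\equiv0$ on $\Omega$. If the vector field $\rho(\cdot,0)\,d_V^{(l)}\,\nabla d_V^{(l)}$ extends continuously to $\partial\Omega$ and $$\oint_{\partial\Omega}\rho(x,0)\,d_V^{(l)}(x)\,\nabla d_V^{(l)}(x)\cdot n(x)\,dS(x)=0,$$ then the two one-body densities differ: $\rho(x,t)\ne\rho'(x,t)$ for some $x\in\Omega$ and $t\ge0$. -/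

import Mathlib

open scoped ContDiff

namespace Smoluchowski

open MeasureTheory Set Filter Topology

/-! ### Vector calculus and domains -/

/-- Physical space `ℝ^d` with the Euclidean norm. -/
abbrev Space (d : ℕ) : Type := EuclideanSpace ℝ (Fin d)

/-- Positions `x^n = (x_1, …, x_n)` of `n` particles. -/
abbrev Config (n d : ℕ) : Type := Fin n → Space d

/-- The divergence of a vector field on `ℝ^d`. -/
noncomputable def divergence {d : ℕ} (F : Space d → Space d) (x : Space d) : ℝ :=
  ∑ j : Fin d, (fderiv ℝ F x (EuclideanSpace.single j 1)) j

/-- The gradient with respect to the position of particle `i`. -/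
noncomputable def gradAt {n d : ℕ} (i : Fin n) (f : Config n d → ℝ) (x : Config n d) : Space d :=
  gradient (fun z => f (Function.update x i z)) (x i)

/-- The divergence with respect to the position of particle `i`. -/
noncomputable def divAt {n d : ℕ} (i : Fin n) (F : Config n d → Space d) (x : Config n d) : ℝ :=
  divergence (fun z => F (Function.update x i z)) (x i)

/-- The `k`-th derivative on the time half line `[0, ∞)`, one-sided (from the right) at `0`. -/
noncomputable def timeDeriv {F : Type*} [NormedAddCommGroup F] [NormedSpace ℝ F]
    (k : ℕ) (f : ℝ → F) (t : ℝ) : F :=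
  iteratedDerivWithin k f (Ici 0) t

/-- The configuration space `Ω^n`. -/
def configSpace {d : ℕ} (Ω : Set (Space d)) (n : ℕ) : Set (Config n d) :=
  Set.univ.pi fun _ => Ω

/-- `f ∈ C^k(S × [0, ∞))`, with one-sided time derivatives at `t = 0`. -/
def ContDiffSpaceTime {X F : Type*} [NormedAddCommGroup X] [NormedSpace ℝ X]
    [NormedAddCommGroup F] [NormedSpace ℝ F] (k : ℕ) (S : Set X) (f : X → ℝ → F) : Prop :=
  ContDiffOn ℝ k (fun p : X × ℝ => f p.1 p.2) (S ×ˢ Ici (0 : ℝ))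

/-- `f` is bounded on `S × [0, ∞)`. -/
def BoundedSpaceTime {X F : Type*} [NormedAddCommGroup F] (S : Set X) (f : X → ℝ → F) : Prop :=
  ∃ C : ℝ, ∀ x ∈ S, ∀ t : ℝ, 0 ≤ t → ‖f x t‖ ≤ C

/-- `f : S → F` has a continuous extension to the closure of `S`. -/
def ContinuouslyExtensible {X F : Type*} [TopologicalSpace X] [TopologicalSpace F]
    (S : Set X) (f : X → F) : Prop :=
  ∃ g : X → F, ContinuousOn g (closure S) ∧ EqOn g f S

/-- `φ` is a smooth local defining function of `Ω` near the point `p`: it is smooth on a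
neighbourhood `U` of `p`, vanishes at `p` with non-zero gradient, and `Ω ∩ U = {φ < 0} ∩ U`. -/
def IsLocalDefiningFunction {d : ℕ} (Ω : Set (Space d)) (p : Space d) (φ : Space d → ℝ) : Prop :=
  φ p = 0 ∧ gradient φ p ≠ 0 ∧
    ∃ U : Set (Space d), IsOpen U ∧ p ∈ U ∧ ContDiffOn ℝ ∞ φ U ∧ ∀ x ∈ U, x ∈ Ω ↔ φ x < 0

/-- A bounded domain (open connected set) with smooth boundary. -/
structure IsSmoothBoundedDomain {d : ℕ} (Ω : Set (Space d)) : Prop where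
  isOpen : IsOpen Ω
  isConnected : IsConnected Ω
  isBounded : Bornology.IsBounded Ω
  smoothBoundary : ∀ p ∈ frontier Ω, ∃ φ : Space d → ℝ, IsLocalDefiningFunction Ω p φ

/-- `ν` is the outward unit normal of `Ω` at the boundary point `p`, that is, the normalized
gradient of a local defining function. -/
def IsOutwardUnitNormal {d : ℕ} (Ω : Set (Space d)) (p ν : Space d) : Prop :=
  ∃ φ : Space d → ℝ, IsLocalDefiningFunction Ω p φ ∧ ν = ‖gradient φ p‖⁻¹ • gradient φ p

/-- The outward unit normal is unique. -/
theorem IsOutwardUnitNormal.unique {d : ℕ} {Ω : Set (Space d)} {p ν ν' : Space d}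
    (h : IsOutwardUnitNormal Ω p ν) (h' : IsOutwardUnitNormal Ω p ν') : ν = ν' := by
  obtain ⟨φ, ⟨h0, hg, U, hU, hpU, hs, hi⟩, rfl⟩ := h
  obtain ⟨ψ, ⟨h0', hg', U', hU', hpU', hs', hi'⟩, rfl⟩ := h'
  set a := gradient φ p
  set b := gradient ψ p
  by_contra hne
  have key : ∀ (χ : Space d → ℝ) (W : Set (Space d)), IsOpen W → p ∈ W → ContDiffOn ℝ ∞ χ W →
      ∀ u : Space d, HasDerivAt (fun s : ℝ => χ (p + s • u)) (inner ℝ (gradient χ p) u) 0 := by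
    intro χ W hW hp hχ u
    have hd : DifferentiableAt ℝ χ p :=
      (hχ.contDiffAt (hW.mem_nhds hp)).differentiableAt (by simp)
    have h1 : HasFDerivAt χ (InnerProductSpace.toDual ℝ _ (gradient χ p)) (p + (0:ℝ) • u) := by
      simpa using hd.hasGradientAt.hasFDerivAt
    have h2 : HasDerivAt (fun s : ℝ => p + s • u) u 0 := by
      simpa using ((hasDerivAt_id (0:ℝ)).smul_const u).const_add p
    have h3 := h1.comp_hasDerivAt (0:ℝ) h2
    exact h3
  have ha : 0 < ‖a‖ := norm_pos_iff.2 hg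
  have hb : 0 < ‖b‖ := norm_pos_iff.2 hg'
  set u := ‖b‖⁻¹ • b - ‖a‖⁻¹ • a with hu
  have na : ‖‖a‖⁻¹ • a‖ = 1 := by rw [norm_smul]; simp [ha.ne']
  have nb : ‖‖b‖⁻¹ • b‖ = 1 := by rw [norm_smul]; simp [hb.ne']
  have hlt : inner ℝ (‖a‖⁻¹ • a) (‖b‖⁻¹ • b) < 1 := (inner_lt_one_iff_real_of_norm_eq_one na nb).2 hne
  have h1 : inner ℝ a u < 0 := by
    have : inner ℝ (‖a‖⁻¹ • a) u < 0 := by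
      rw [hu, inner_sub_right, real_inner_self_eq_norm_sq, na]; linarith
    rw [real_inner_smul_left] at this
    exact (pos_iff_neg_of_mul_neg this).1 (inv_pos.2 ha)
  have h2 : 0 < inner ℝ b u := by
    have : 0 < inner ℝ (‖b‖⁻¹ • b) u := by
      rw [hu, inner_sub_right, real_inner_self_eq_norm_sq, nb, real_inner_comm]; linarith
    rw [real_inner_smul_left] at this
    exact (pos_iff_pos_of_mul_pos this).1 (inv_pos.2 hb)
  have e1 := (key φ U hU hpU hs u).neg.tendsto_slope
  have e2 := (key ψ U' hU' hpU' hs' u).tendsto_slope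
  have c : Tendsto (fun s : ℝ => p + s • u) (𝓝 0) (𝓝 p) := by
    have : Continuous (fun s : ℝ => p + s • u) := by fun_prop
    simpa using this.tendsto 0
  have m1 := (c.eventually (hU.mem_nhds hpU)).filter_mono (nhdsWithin_le_nhds (s := Ioi 0))
  have m2 := (c.eventually (hU'.mem_nhds hpU')).filter_mono (nhdsWithin_le_nhds (s := Ioi 0))
  have le : 𝓝[>] (0:ℝ) ≤ 𝓝[≠] 0 := nhdsWithin_mono _ (fun x hx => ne_of_gt hx)
  have p1 := (e1.mono_left le).eventually (lt_mem_nhds (neg_pos.2 h1))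
  have p2 := (e2.mono_left le).eventually (lt_mem_nhds h2)
  obtain ⟨s, k1, k2, k3, k4, k5⟩ := (m1.and (m2.and (p1.and (p2.and self_mem_nhdsWithin)))).exists
  have k5 : 0 < s := k5
  simp only [slope_def_field, sub_zero, zero_smul, add_zero, Pi.neg_apply, h0, h0', neg_zero] at k3 k4
  have q1 : φ (p + s • u) < 0 := by
    have := (div_pos_iff_of_pos_right k5).1 k3; linarith
  have q2 : 0 < ψ (p + s • u) := (div_pos_iff_of_pos_right k5).1 k4
  have := (hi' _ k2).1 ((hi _ k1).2 q1)
  linarith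

/-- The outward unit normal field on the boundary. -/
noncomputable def outwardNormal {d : ℕ} (Ω : Set (Space d)) (p : Space d) : Space d :=
  Classical.epsilon (IsOutwardUnitNormal Ω p)

/-- The surface integral `∮_{∂Ω} G · dS` with respect to the outward normal, the surface measure
being the `(d-1)`-dimensional Hausdorff measure in its Euclidean normalization. -/
noncomputable def surfaceFlux {d : ℕ} (Ω : Set (Space d)) (G : Space d → Space d) : ℝ :=
  ∫ p in frontier Ω, inner ℝ (G p) (outwardNormal Ω p) ∂(Measure.euclideanHausdorffMeasure (d - 1))

/-! ### The many-body system -/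

/-- What two systems have in common: inverse temperature, diffusion constant, pair potential
(as a function of the relative position), and the non-conservative pair and one-body forces. -/
structure Environment (d : ℕ) where
  /-- inverse temperature -/
  β : ℝ
  /-- diffusion constant -/
  D : ℝ
  /-- pair potential -/
  U : Space d → ℝ
  /-- non-conservative force of a particle at the second position on one at the first -/
  Q : Space d → Space d → Space d
  /-- non-conservative time-dependent external force -/
  R : Space d → ℝ → Space d

/-- The two-body force `K_2(x, y) = -∇_x U(x - y) + Q(x, y)`. -/
noncomputable def Environment.pairForce {d : ℕ} (m : Environment d) (x y : Space d) : Space d :=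
  -gradient m.U (x - y) + m.Q x y

/-- The standing assumptions on the constants and the interparticle and non-conservative forces. -/
structure Environment.IsAdmissible {d : ℕ} (m : Environment d) (Ω : Set (Space d)) : Prop where
  β_pos : 0 < m.β
  D_pos : 0 < m.D
  U_symm : ∀ x ∈ Ω, ∀ y ∈ Ω, m.U (x - y) = m.U (y - x)
  U_differentiable : ∀ x ∈ Ω, ∀ y ∈ Ω, DifferentiableAt ℝ m.U (x - y)
  Q_differentiable : ∀ x ∈ Ω, ∀ y ∈ Ω, DifferentiableAt ℝ (fun z => m.Q z y) x
  Q_divergenceFree : ∀ x ∈ Ω, ∀ y ∈ Ω, divergence (fun z => m.Q z y) x = 0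
  pairForce_contDiff : ContDiffOn ℝ 1 (fun p : Space d × Space d => m.pairForce p.1 p.2) (Ω ×ˢ Ω)
  pairForce_bounded : ∃ C : ℝ, ∀ x ∈ Ω, ∀ y ∈ Ω, ‖m.pairForce x y‖ ≤ C
  R_space : ∀ t : ℝ, 0 ≤ t → ContDiffOn ℝ 1 (fun x => m.R x t) Ω
  R_time : ∀ x ∈ Ω, ContDiffOn ℝ ∞ (fun t => m.R x t) (Ici 0)
  R_divergenceFree : ∀ x ∈ Ω, ∀ t : ℝ, 0 ≤ t → divergence (fun z => m.R z t) x = 0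

/-- The standing assumptions on an external potential. -/
structure IsAdmissiblePotential {d : ℕ} (Ω : Set (Space d)) (V : Space d → ℝ → ℝ) : Prop where
  contDiff : ∀ t : ℝ, 0 ≤ t → ContDiffOn ℝ 2 (fun x => V x t) Ω
  gradient_extensible : ∀ t : ℝ, 0 ≤ t →
    ContinuouslyExtensible Ω (fun x => gradient (fun z => V z t) x)

section System

variable {d N : ℕ}

/-- The one-body force `K_1(x, t) = -∇_x V(x, t) + R(x, t)`. -/
noncomputable def externalForce (m : Environment d) (V : Space d → ℝ → ℝ)
    (x : Space d) (t : ℝ) : Space d :=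
  -gradient (fun z => V z t) x + m.R x t

/-- The force `F_{n,i}` on particle `i` when only the first `n ≤ N` particles are present (as a
function of `x^N`). For `n = N` this is the full force `F_{N,i}`. -/
noncomputable def force (m : Environment d) (V : Space d → ℝ → ℝ) (n : ℕ) (i : Fin N)
    (x : Config N d) (t : ℝ) : Space d :=
  externalForce m V (x i) t +
    ∑ j ∈ Finset.univ.filter (fun j : Fin N => (j : ℕ) < n ∧ j ≠ i), m.pairForce (x i) (x j)

/-- The bracket `[∇_{x_i} - β F_{n,i}] P`. -/
noncomputable def bracket (m : Environment d) (V : Space d → ℝ → ℝ) (P : Config N d → ℝ → ℝ)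
    (n : ℕ) (i : Fin N) (x : Config N d) (t : ℝ) : Space d :=
  gradAt i (fun y => P y t) x - (m.β * P x t) • force m V n i x t

/-- `Ô_n P = D ∑_{i ≤ n} ∇_{x_i} · [∇_{x_i} - β F_{n,i}] P`. -/
noncomputable def smolOp (m : Environment d) (V : Space d → ℝ → ℝ) (P : Config N d → ℝ → ℝ)
    (n : ℕ) (x : Config N d) (t : ℝ) : ℝ :=
  m.D * ∑ i ∈ Finset.univ.filter (fun i : Fin N => (i : ℕ) < n),
    divAt i (fun y => bracket m V P n i y t) x

/-- `Ô⁻_{n,N} P = D ∑_{i ≤ n} ∇_{x_i} · [∇_{x_i} - β F_{N,i}] P`. -/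
noncomputable def smolOpMinus (m : Environment d) (V : Space d → ℝ → ℝ) (P : Config N d → ℝ → ℝ)
    (n : ℕ) (x : Config N d) (t : ℝ) : ℝ :=
  m.D * ∑ i ∈ Finset.univ.filter (fun i : Fin N => (i : ℕ) < n),
    divAt i (fun y => bracket m V P N i y t) x

/-- `Ô⁺_{n,N} P = D ∑_{n < i ≤ N} ∇_{x_i} · [∇_{x_i} - β F_{N,i}] P`. -/
noncomputable def smolOpPlus (m : Environment d) (V : Space d → ℝ → ℝ) (P : Config N d → ℝ → ℝ)
    (n : ℕ) (x : Config N d) (t : ℝ) : ℝ :=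
  m.D * ∑ i ∈ Finset.univ.filter (fun i : Fin N => n ≤ (i : ℕ)),
    divAt i (fun y => bracket m V P N i y t) x

/-- The component `J_{N,i} = -D ∇_{x_i} P + D β P F_{N,i}` of the `N`-body current. -/
noncomputable def current (m : Environment d) (V : Space d → ℝ → ℝ) (P : Config N d → ℝ → ℝ)
    (i : Fin N) (x : Config N d) (t : ℝ) : Space d :=
  -(m.D • gradAt i (fun y => P y t) x) + (m.D * m.β * P x t) • force m V N i x t

/-- The configuration `(x_1, …, x_n, y_1, …, y_{N-n})` of `N` particles. -/
def glue (N : ℕ) {n : ℕ} (x : Config n d) (y : Config (N - n) d) : Config N d :=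
  fun i => if h : (i : ℕ) < n then x ⟨i, h⟩ else y ⟨i - n, by omega⟩

/-- The reduced `n`-body density
`ρ_n(x^n, t) = N!/(N-n)! ∫_{Ω^{N-n}} P(x^n, y^{N-n}, t) dy^{N-n}` (and `0` if `n > N`). -/
noncomputable def reducedDensity (Ω : Set (Space d)) (P : Config N d → ℝ → ℝ) (n : ℕ)
    (x : Config n d) (t : ℝ) : ℝ :=
  (N.descFactorial n : ℝ) * ∫ y in configSpace Ω (N - n), P (glue N x y) t

/-- The one-body (number) density `ρ = ρ_1`. -/
noncomputable def density (Ω : Set (Space d)) (P : Config N d → ℝ → ℝ) (x : Space d) (t : ℝ) : ℝ :=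
  reducedDensity Ω P 1 (fun _ => x) t

/-- The average interaction force
`E_{n,i}(x^n, t) = ∫_Ω ρ_{n+1}(x^n, y, t) K_2(x_i, y) dy`. It is `0` for `n ≥ N`. -/
noncomputable def averageForce (m : Environment d) (Ω : Set (Space d)) (P : Config N d → ℝ → ℝ)
    (n : ℕ) (i : Fin n) (x : Config n d) (t : ℝ) : Space d :=
  ∫ y in Ω, reducedDensity Ω P (n + 1) (Fin.snoc x y : Config (n + 1) d) t • m.pairForce (x i) y

/-- `P` is a symmetric probability density on `Ω^N` at all times `t ≥ 0` that solves the `N`-body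
Smoluchowski equation with external potential `V`. -/
structure IsSolution (m : Environment d) (Ω : Set (Space d)) (V : Space d → ℝ → ℝ)
    (P : Config N d → ℝ → ℝ) : Prop where
  nonneg : ∀ x ∈ configSpace Ω N, ∀ t : ℝ, 0 ≤ t → 0 ≤ P x t
  symm : ∀ σ : Equiv.Perm (Fin N), ∀ x ∈ configSpace Ω N, ∀ t : ℝ, 0 ≤ t → P (x ∘ σ) t = P x t
  normalized : ∀ t : ℝ, 0 ≤ t → ∫ x in configSpace Ω N, P x t = 1
  smoluchowski : ∀ x ∈ configSpace Ω N, ∀ t : ℝ, 0 ≤ t →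
    timeDeriv 1 (P x) t = smolOp m V P N x t

/-- The boundary condition: the net flux of each single particle through the boundary vanishes,
`∫_Ω ∇_{x_i} · J_{N,i}(x^N, t) dx_i = 0` (the integral is `∮_{∂Ω} J_{N,i} · dS(x_i)`). -/
def NoNetBoundaryFlux (m : Environment d) (Ω : Set (Space d)) (V : Space d → ℝ → ℝ)
    (P : Config N d → ℝ → ℝ) : Prop :=
  ∀ i : Fin N, ∀ x ∈ configSpace Ω N, ∀ t : ℝ, 0 ≤ t →
    ∫ z in Ω, divAt i (fun y => current m V P i y t) (Function.update x i z) = 0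

/-- The solution is well behaved. -/
structure IsWellBehaved (m : Environment d) (Ω : Set (Space d)) (V : Space d → ℝ → ℝ)
    (P : Config N d → ℝ → ℝ) : Prop where
  contDiff : ContDiffSpaceTime 2 (configSpace Ω N) P
  extensible : ∀ t : ℝ, 0 ≤ t → ContinuouslyExtensible (configSpace Ω N) (fun x => P x t)
  gradient_extensible : ∀ i : Fin N, ∀ t : ℝ, 0 ≤ t →
    ContinuouslyExtensible (configSpace Ω N) (gradAt i fun x => P x t)
  timeDeriv_bounded : BoundedSpaceTime (configSpace Ω N) (fun x t => timeDeriv 1 (P x) t)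
  smolOp_bounded : ∀ n : ℕ, 1 ≤ n → n ≤ N →
    BoundedSpaceTime (configSpace Ω N) (smolOp m V P n)
  smolOpMinus_bounded : ∀ n : ℕ, 1 ≤ n → n ≤ N →
    BoundedSpaceTime (configSpace Ω N) (smolOpMinus m V P n)
  smolOpPlus_bounded : ∀ n : ℕ, 1 ≤ n → n ≤ N →
    BoundedSpaceTime (configSpace Ω N) (smolOpPlus m V P n)
  pairForce_deriv_bounded : ∃ C : ℝ, ∀ x ∈ Ω, ∀ y ∈ Ω,
    ‖fderiv ℝ (fun z => m.pairForce z y) x‖ ≤ C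
  gradient_bounded : ∀ i : Fin N,
    BoundedSpaceTime (configSpace Ω N) (fun x t => gradAt i (fun y => P y t) x)
  averageForce_exists : ∀ n : ℕ, 1 ≤ n → n ≤ N → ∀ i : Fin n, ∀ x ∈ configSpace Ω n,
    ∀ t : ℝ, 0 ≤ t → IntegrableOn (fun y =>
      reducedDensity Ω P (n + 1) (Fin.snoc x y : Config (n + 1) d) t • m.pairForce (x i) y) Ω
  averageForce_contDiff : ∀ n : ℕ, 1 ≤ n → n ≤ N → ∀ i : Fin n,
    ContDiffSpaceTime 1 (configSpace Ω n) (averageForce m Ω P n i)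

/-- The conditions (A1) and (A2) of analytic accessibility. Since the time derivatives of every
order `k` are required to be `C²` (`C¹`) on space-time, infinite differentiability in time is
part of `densities_contDiff` (of `R_contDiff`). -/
structure IsAnalyticallyAccessible (m : Environment d) (Ω : Set (Space d)) (V : Space d → ℝ → ℝ)
    (P : Config N d → ℝ → ℝ) : Prop where
  potential_analytic : ∀ x ∈ Ω, AnalyticOn ℝ (V x) (Ici 0)
  potential_contDiff : ∀ k : ℕ, ContDiffSpaceTime 2 Ω (fun x t => timeDeriv k (V x) t)
  potential_extensible : ∀ k : ℕ, ContinuouslyExtensible Ω (fun x => timeDeriv k (V x) 0)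
  densities_contDiff : ∀ n : ℕ, 1 ≤ n → n ≤ N → ∀ k : ℕ,
    ContDiffSpaceTime 2 (configSpace Ω n) (fun x t => timeDeriv k (reducedDensity Ω P n x) t)
  densities_bounded : ∀ n : ℕ, 1 ≤ n → n ≤ N → ∀ k : ℕ,
    BoundedSpaceTime (configSpace Ω n) (fun x t => timeDeriv k (reducedDensity Ω P n x) t)
  R_contDiff : ∀ k : ℕ, ContDiffSpaceTime 1 Ω (fun x t => timeDeriv k (m.R x) t)

/-- An analytically accessible many-body system: `P` is a well-behaved solution of the `N`-body
Smoluchowski equation with an admissible external potential `V`, it satisfies the boundary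
condition, and analytic accessibility holds. -/
structure IsAnalyticallyAccessibleSystem (m : Environment d) (Ω : Set (Space d))
    (V : Space d → ℝ → ℝ) (P : Config N d → ℝ → ℝ) : Prop where
  potential : IsAdmissiblePotential Ω V
  solution : IsSolution m Ω V P
  boundary : NoNetBoundaryFlux m Ω V P
  wellBehaved : IsWellBehaved m Ω V P
  accessible : IsAnalyticallyAccessible m Ω V P

end System

/-- Two potentials are diffusion equivalent for the density `ρ` if their difference is only a
function of time on `{(x, t) ∈ Ω × [0, ∞) : ρ(x, t) > 0}`. -/
def DiffusionEquivalent {d : ℕ} (Ω : Set (Space d)) (ρ V V' : Space d → ℝ → ℝ) : Prop :=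
  ∃ c : ℝ → ℝ, ∀ x ∈ Ω, ∀ t : ℝ, 0 ≤ t → 0 < ρ x t → V x t - V' x t = c t

/-- `d_V^{(k)}(x) = ∂_t^k (V - V')(x, t)` at `t = 0`. -/
noncomputable def potentialDiff {d : ℕ} (V V' : Space d → ℝ → ℝ) (k : ℕ) (x : Space d) : ℝ :=
  timeDeriv k (fun t => V x t - V' x t) 0

end Smoluchowski

namespace Smoluchowski

open MeasureTheory Set Filter Topology
open scoped NNReal ENNReal RealInnerProductSpace Manifold

/-! Assume that the one-body densities agree at all times. Let `f` be the first initial time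
derivative of `V - V'` that is not spatially constant, let `l` be its order, and let `ρ₀` be the
common initial density. The contradiction comes from two facts: `ρ₀ ∇f` is divergence-free, and then
the field `f ρ₀ ∇f` has divergence `ρ₀ |∇f|² ≥ 0` but zero flux through the boundary. Hence `∇f =
0`, because `ρ₀ > 0`.

Such an `l` exists by analyticity in time: if all initial time derivatives of `V - V'` were constant
on the connected set `Ω`, then `V - V'` would depend on time only
(`diffusionEquivalent_of_gradient_eq_zero`).

For the first fact, the difference of the two Smoluchowski equations is tested against a smooth `χ`
on configuration space (`setIntegral_testFunction_mul_timeDeriv`). Integration by parts in the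
position of each particle moves all derivatives onto `χ`, up to a source term linear in `V - V'`.
The weak equation is then divided by `t ^ k` and `t` tends to `0`
(`setIntegral_testFunction_mul_timeDeriv_succ`): if the derivatives of `P - P'` vanish through order
`k`, its derivative of order `k + 1` is driven by the `k`-th derivative of `V - V'` alone. By
induction the derivatives of `P - P'` vanish through order `l` (`timeDeriv_difference_eq_zero`). At
order `l + 1`, a `χ` depending on one particle only sees just the one-body density, so the left side
is zero, and the right side is the weak form of `∇ · (ρ₀ ∇f) = 0`
(`divergence_density_smul_gradient_potentialDiff_eq_zero`).

The second fact needs a divergence theorem for fields that are `C¹` inside `Ω` and merely continuous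
up to the boundary, with surface integrals taken in Hausdorff measure. A one-sided version for
nonnegative divergence is enough
(`IsSmoothBoundedDomain.divergence_eq_zero_of_surfaceFlux_eq_zero`). The boundary is flattened by
charts that are bi-Lipschitz with constant close to `1`, so they distort surface and volume
integrals by factors close to `1`. The flux is the limit of integrals over layers of width `δ` just
inside the boundary, and a partition of unity glues the local estimates. The errors are proportional
to the finite boundary measure and arbitrarily small. -/

/-! ### Hausdorff integrals under charts with Lipschitz inverse -/

theorem euclideanHausdorffMeasure_image_le {X Y : Type*} [MetricSpace X] [MeasurableSpace X]
    [BorelSpace X] [MetricSpace Y] [MeasurableSpace Y] [BorelSpace Y] {f : X → Y} {K : ℝ≥0}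
    {s : Set X} (h : LipschitzOnWith K f s) (k : ℕ) :
    μHE[k] (f '' s) ≤ (K : ℝ≥0∞) ^ k * μHE[k] s := by
  have := h.hausdorffMeasure_image_le (d := k) (by positivity)
  simp only [Measure.euclideanHausdorffMeasure_def, Measure.smul_apply, ENNReal.smul_def,
    smul_eq_mul]
  rw [ENNReal.rpow_natCast] at this
  calc _ ≤ _ := mul_le_mul_right this _
    _ = _ := by ring

/-- The preimage of a set under `e` lies in its image under the `K`-Lipschitz inverse. Hence the
push-forward of `μHE[k]` by `e` is at most `K ^ k` times `μHE[k]`, and it remains to integrate `g`.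
-/
theorem lintegral_comp_le_of_lipschitzOn {X : Type*} [MetricSpace X]
    [MeasurableSpace X] [BorelSpace X] (e : OpenPartialHomeomorph X X) {K : ℝ≥0}
    (hK : LipschitzOnWith K e.symm e.target) (k : ℕ) {g : X → ℝ≥0∞}
    (hg : AEMeasurable g ((μHE[k]).restrict e.target)) :
    ∫⁻ x in e.source, g (e x) ∂μHE[k] ≤ (K : ℝ≥0∞) ^ k * ∫⁻ y in e.target, g y ∂μHE[k] := by
  have hm : AEMeasurable e ((μHE[k]).restrict e.source) :=
    e.continuousOn.aemeasurable e.open_source.measurableSet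
  have hle : Measure.map e ((μHE[k]).restrict e.source) ≤
      (K : ℝ≥0∞) ^ k • (μHE[k]).restrict e.target := by
    refine Measure.le_iff.2 fun B hB => ?_
    rw [Measure.map_apply_of_aemeasurable hm hB, Measure.smul_apply, Measure.restrict_apply hB,
      Measure.restrict_apply₀' e.open_source.measurableSet.nullMeasurableSet]
    have h1 : e ⁻¹' B ∩ e.source ⊆ e.symm '' (B ∩ e.target) := by
      rintro x ⟨hx, hxs⟩
      exact ⟨e x, ⟨hx, e.map_source hxs⟩, e.left_inv hxs⟩
    refine (measure_mono h1).trans ?_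
    exact euclideanHausdorffMeasure_image_le (hK.mono inter_subset_right) k
  have hac : Measure.map e ((μHE[k]).restrict e.source) ≪ (μHE[k]).restrict e.target :=
    (Measure.absolutelyContinuous_of_le hle).trans (Measure.smul_absolutelyContinuous)
  rw [← lintegral_map' (hg.mono_ac hac) hm]
  refine (lintegral_mono' hle le_rfl).trans ?_
  rw [lintegral_smul_measure, smul_eq_mul]

theorem measurableSet_source_inter_preimage {X : Type*} [TopologicalSpace X] [MeasurableSpace X]
    [BorelSpace X] (e : OpenPartialHomeomorph X X) {B : Set X} (hB : IsClosed B) :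
    MeasurableSet (e.source ∩ e ⁻¹' B) := by
  have : e.source ∩ e ⁻¹' B = e.source \ (e.source ∩ e ⁻¹' Bᶜ) := by
    ext x; simp
  rw [this]
  exact e.open_source.measurableSet.diff
    (e.isOpen_inter_preimage hB.isOpen_compl).measurableSet

theorem setLIntegral_comp_le_of_lipschitzOn {X : Type*} [MetricSpace X]
    [MeasurableSpace X] [BorelSpace X] (e : OpenPartialHomeomorph X X) {K : ℝ≥0}
    (hK : LipschitzOnWith K e.symm e.target) (k : ℕ) {g : X → ℝ≥0∞}
    (hg : AEMeasurable g ((μHE[k]).restrict e.target)) {B : Set X} (hB : IsClosed B) :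
    ∫⁻ x in e.source ∩ e ⁻¹' B, g (e x) ∂μHE[k] ≤
      (K : ℝ≥0∞) ^ k * ∫⁻ y in e.target ∩ B, g y ∂μHE[k] := by
  have h := lintegral_comp_le_of_lipschitzOn e hK k (g := B.indicator g)
    (hg.indicator hB.measurableSet)
  rw [setLIntegral_indicator hB.measurableSet, inter_comm B] at h
  refine le_trans (le_of_eq ?_) h
  rw [show e.source ∩ e ⁻¹' B = (e.source ∩ e ⁻¹' B) ∩ e.source by
      ext x; simp only [mem_inter_iff]; tauto,
    ← setLIntegral_indicator (measurableSet_source_inter_preimage e hB)]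
  refine setLIntegral_congr_fun e.open_source.measurableSet fun x hx => ?_
  by_cases hxB : e x ∈ B <;> simp [indicator, hx, hxB]

/-! ### Cutoffs and thin layers along a hyperplane -/

/-- Cartesian coordinates adapted to a hyperplane preserve volume. -/
theorem measurePreserving_hyperplane {n : ℕ} (p : Space (n + 1)) {ν : Space (n + 1)}
    (hν : ‖ν‖ = 1) :
    MeasurePreserving (fun q : ℝ × (ℝ ∙ ν)ᗮ => p + q.2 + q.1 • ν) (volume.prod volume) volume := by
  have hν0 : ν ≠ 0 := by rintro rfl; simp at hν
  have hfr : Module.finrank ℝ (ℝ ∙ ν)ᗮ = n := by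
    have := (ℝ ∙ ν).finrank_add_finrank_orthogonal
    rw [finrank_span_singleton hν0, finrank_euclideanSpace_fin] at this
    omega
  have hmeas : Measurable (fun q : ℝ × (ℝ ∙ ν)ᗮ => p + q.2 + q.1 • ν) := by
    have : Continuous (fun q : ℝ × (ℝ ∙ ν)ᗮ => p + q.2 + q.1 • ν) := by fun_prop
    exact this.measurable
  refine ⟨hmeas, Measure.ext fun t ht => ?_⟩
  -- Both sides are integrals over `s` of the area of the slice of `t` at height `s`. Each slice is
  -- measured either in the affine hyperplane or, through an isometry, in `(ℝ ∙ ν)ᗮ`.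
  rw [Measure.map_apply hmeas ht, Measure.prod_apply (hmeas ht),
    ← InnerProductSpace.euclideanHausdorffMeasure_eq_volume (V := Space (n + 1)),
    EuclideanGeometry.euclideanHausdorffMeasure_eq_lintegral p hν0 ht]
  have : ‖ν‖ₑ = 1 := by rw [← ofReal_norm, hν]; simp
  rw [this, one_mul]
  refine lintegral_congr fun s => ?_
  have hiso : Isometry (fun y : (ℝ ∙ ν)ᗮ => p + (y : Space (n + 1)) + s • ν) := by
    refine Isometry.of_dist_eq fun y z => ?_
    rw [dist_add_right, dist_add_left, Subtype.dist_eq]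
  rw [← InnerProductSpace.euclideanHausdorffMeasure_eq_volume (V := (ℝ ∙ ν)ᗮ), hfr,
    finrank_euclideanSpace_fin, Nat.add_sub_cancel]
  have := hiso.euclideanHausdorffMeasure_preimage (d := n) t
  rw [show Prod.mk s ⁻¹' ((fun q : ℝ × (ℝ ∙ ν)ᗮ => p + q.2 + q.1 • ν) ⁻¹' t) =
    (fun y : (ℝ ∙ ν)ᗮ => p + (y : Space (n + 1)) + s • ν) ⁻¹' t from rfl, this]
  congr 2
  ext x
  simp only [mem_range, SetLike.mem_coe, AffineSubspace.mem_mk', vsub_eq_sub, vadd_eq_add]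
  constructor
  · rintro ⟨y, rfl⟩
    convert y.2 using 1
    abel
  · intro hx
    exact ⟨⟨_, hx⟩, by simp only; abel⟩

/-- A smooth cutoff on the line, equal to `0` on `(-∞, 1]` and to `1` on `[2, ∞)`. -/
noncomputable def layerCutoff (s : ℝ) : ℝ := Real.smoothTransition (s - 1)

theorem layerCutoff_contDiff : ContDiff ℝ ∞ layerCutoff :=
  Real.smoothTransition.contDiff.comp (contDiff_id.sub contDiff_const)

theorem layerCutoff_of_le {s : ℝ} (h : s ≤ 1) : layerCutoff s = 0 :=
  Real.smoothTransition.zero_of_nonpos (by linarith)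

theorem layerCutoff_of_ge {s : ℝ} (h : 2 ≤ s) : layerCutoff s = 1 :=
  Real.smoothTransition.one_of_one_le (by linarith)

theorem layerCutoff_nonneg (s : ℝ) : 0 ≤ layerCutoff s := Real.smoothTransition.nonneg _

theorem layerCutoff_le_one (s : ℝ) : layerCutoff s ≤ 1 := Real.smoothTransition.le_one _

theorem layerCutoff_monotone : Monotone layerCutoff := by
  intro a b hab
  exact Real.smoothTransition.monotone (by linarith)

theorem layerCutoff_differentiable : Differentiable ℝ layerCutoff :=
  layerCutoff_contDiff.differentiable (by simp)

theorem continuous_deriv_layerCutoff : Continuous (deriv layerCutoff) :=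
  layerCutoff_contDiff.continuous_deriv (by simp)

theorem deriv_layerCutoff_nonneg (s : ℝ) : 0 ≤ deriv layerCutoff s :=
  layerCutoff_monotone.deriv_nonneg

theorem deriv_layerCutoff_of_lt {s : ℝ} (h : s < 1) : deriv layerCutoff s = 0 := by
  have : layerCutoff =ᶠ[𝓝 s] fun _ => 0 := by
    filter_upwards [Iio_mem_nhds h] with x hx using layerCutoff_of_le (le_of_lt hx)
  simp [this.deriv_eq]

theorem deriv_layerCutoff_of_gt {s : ℝ} (h : 2 < s) : deriv layerCutoff s = 0 := by
  have : layerCutoff =ᶠ[𝓝 s] fun _ => 1 := by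
    filter_upwards [Ioi_mem_nhds h] with x hx using layerCutoff_of_ge (le_of_lt hx)
  simp [this.deriv_eq]

theorem hasCompactSupport_deriv_layerCutoff : HasCompactSupport (deriv layerCutoff) := by
  refine HasCompactSupport.intro (isCompact_Icc (a := (1 : ℝ)) (b := 2)) fun x hx => ?_
  simp only [mem_Icc, not_and_or, not_le] at hx
  exact hx.elim deriv_layerCutoff_of_lt deriv_layerCutoff_of_gt

theorem integral_deriv_layerCutoff : ∫ s, deriv layerCutoff s = 1 := by
  have h := intervalIntegral.integral_deriv_eq_sub (f := layerCutoff) (a := 0) (b := 3)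
    (fun x _ => layerCutoff_differentiable x)
    (continuous_deriv_layerCutoff.intervalIntegrable _ _)
  rw [layerCutoff_of_ge (by norm_num), layerCutoff_of_le (by norm_num),
    intervalIntegral.integral_of_le (by norm_num)] at h
  rw [← setIntegral_eq_integral_of_forall_compl_eq_zero (s := Ioc 0 3), h, sub_zero]
  intro x hx
  simp only [mem_Ioc, not_and_or, not_le, not_lt] at hx
  rcases hx with hx | hx
  · exact deriv_layerCutoff_of_lt (by linarith)
  · exact deriv_layerCutoff_of_gt (by linarith)

/-- The affine hyperplane through `p` orthogonal to `ν`. -/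
def hyperplane {d : ℕ} (p ν : Space d) : Set (Space d) := {y | ⟪y - p, ν⟫ = 0}

theorem isClosed_hyperplane {d : ℕ} (p ν : Space d) : IsClosed (hyperplane p ν) :=
  isClosed_eq (by fun_prop) continuous_const

section Hyperplane

variable {n : ℕ} (p : Space (n + 1)) {ν : Space (n + 1)}

theorem isometry_hyperplane (v : Space (n + 1)) :
    Isometry (fun y : (ℝ ∙ ν)ᗮ => v + (y : Space (n + 1))) :=
  Isometry.of_dist_eq fun y z => by rw [dist_add_left, Subtype.dist_eq]

theorem measurePreserving_hyperplane_inclusion (hν : ‖ν‖ = 1) :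
    MeasurePreserving (fun y : (ℝ ∙ ν)ᗮ => p + (y : Space (n + 1))) volume
      ((μHE[n]).restrict (hyperplane p ν)) := by
  have hν0 : ν ≠ 0 := by rintro rfl; simp at hν
  have hfr : Module.finrank ℝ (ℝ ∙ ν)ᗮ = n := by
    have := (ℝ ∙ ν).finrank_add_finrank_orthogonal
    rw [finrank_span_singleton hν0, finrank_euclideanSpace_fin] at this
    omega
  refine ⟨(isometry_hyperplane p).continuous.measurable, ?_⟩
  rw [← InnerProductSpace.euclideanHausdorffMeasure_eq_volume (V := (ℝ ∙ ν)ᗮ), hfr,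
    (isometry_hyperplane p).map_euclideanHausdorffMeasure]
  congr 1
  ext x
  simp only [mem_range, hyperplane, mem_ofPred_eq]
  constructor
  · rintro ⟨y, rfl⟩
    simpa using Submodule.mem_orthogonal_singleton_iff_inner_left.1 y.2
  · intro hx
    exact ⟨⟨x - p, Submodule.mem_orthogonal_singleton_iff_inner_left.2 hx⟩, by simp⟩

/-- Pythagoras. It confines the slices of a compactly supported function at all heights `s` to a
single ball of the hyperplane. -/
theorem norm_le_norm_add_of_mem_orthogonal (y : (ℝ ∙ ν)ᗮ) (s : ℝ) :
    ‖(y : Space (n + 1))‖ ≤ ‖(y : Space (n + 1)) + s • ν‖ := by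
  have h := Submodule.mem_orthogonal_singleton_iff_inner_left.1 y.2
  have : ‖(y : Space (n + 1)) + s • ν‖ * ‖(y : Space (n + 1)) + s • ν‖ =
      ‖(y : Space (n + 1))‖ * ‖(y : Space (n + 1))‖ + ‖s • ν‖ * ‖s • ν‖ :=
    norm_add_sq_eq_norm_sq_add_norm_sq_real (by rw [inner_smul_right, h, mul_zero])
  nlinarith [norm_nonneg (y : Space (n + 1)), norm_nonneg ((y : Space (n + 1)) + s • ν),
    norm_nonneg (s • ν)]

theorem integrableOn_hyperplane {ψ : Space (n + 1) → ℝ} (hψ : Continuous ψ)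
    (hc : HasCompactSupport ψ) (hν : ‖ν‖ = 1) :
    IntegrableOn ψ (hyperplane p ν) μHE[n] := by
  have hmp := measurePreserving_hyperplane_inclusion p hν
  have he : MeasurableEmbedding (fun y : (ℝ ∙ ν)ᗮ => p + (y : Space (n + 1))) :=
    (isometry_hyperplane p).isClosedEmbedding.measurableEmbedding
  rw [IntegrableOn, ← hmp.integrable_comp_emb he]
  exact (hψ.comp (isometry_hyperplane p).continuous).integrable_of_hasCompactSupport
    (hc.comp_isClosedEmbedding (isometry_hyperplane p).isClosedEmbedding)

/-- Integrals over a thin layer along a hyperplane tend to the integral over the hyperplane. -/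
theorem tendsto_integral_layer {ψ : Space (n + 1) → ℝ} (hψ : Continuous ψ)
    (hc : HasCompactSupport ψ) (hν : ‖ν‖ = 1) :
    Tendsto (fun δ : ℝ => ∫ y, ψ y * (δ⁻¹ * deriv layerCutoff (-⟪y - p, ν⟫ / δ))) (𝓝[>] 0)
      (𝓝 (∫ y in hyperplane p ν, ψ y ∂μHE[n])) := by
  have hmp := measurePreserving_hyperplane_inclusion p hν
  have he : MeasurableEmbedding (fun y : (ℝ ∙ ν)ᗮ => p + (y : Space (n + 1))) :=
    (isometry_hyperplane p).isClosedEmbedding.measurableEmbedding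
  obtain ⟨C, hC⟩ := hc.exists_bound_of_continuous hψ
  obtain ⟨R, hR⟩ := hc.isCompact.isBounded.exists_norm_le
  -- `a s` is the integral of `ψ` over the parallel hyperplane at signed height `s`. The limit over
  -- thin layers rests on its continuity at `0`.
  set a : ℝ → ℝ := fun s => ∫ y : (ℝ ∙ ν)ᗮ, ψ (p + y + s • ν) with ha
  have hzero : ∀ (y : (ℝ ∙ ν)ᗮ) (s : ℝ), y ∉ Metric.closedBall (0 : (ℝ ∙ ν)ᗮ) (R + ‖p‖) →
      ψ (p + y + s • ν) = 0 := by
    intro y s hy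
    refine image_eq_zero_of_notMem_tsupport fun hmem => hy ?_
    have h1 := hR _ hmem
    have h2 := norm_le_norm_add_of_mem_orthogonal y s
    have h3 : ‖(y : Space (n + 1)) + s • ν‖ ≤ ‖p + y + s • ν‖ + ‖p‖ := by
      have := norm_sub_le (p + (y : Space (n + 1)) + s • ν) p
      rwa [show p + (y : Space (n + 1)) + s • ν - p = y + s • ν by abel] at this
    rw [mem_closedBall_zero_iff]
    change ‖(y : Space (n + 1))‖ ≤ _
    linarith
  have hacont : Continuous a := by
    refine continuous_of_dominated
      (bound := (Metric.closedBall (0 : (ℝ ∙ ν)ᗮ) (R + ‖p‖)).indicator fun _ => C) ?_ ?_ ?_ ?_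
    · intro s
      have : Continuous fun y : (ℝ ∙ ν)ᗮ => ψ (p + y + s • ν) := by fun_prop
      exact this.aestronglyMeasurable
    · refine fun s => Eventually.of_forall fun y => ?_
      by_cases hy : y ∈ Metric.closedBall (0 : (ℝ ∙ ν)ᗮ) (R + ‖p‖)
      · simpa [indicator_of_mem hy] using hC _
      · simp [indicator_of_notMem hy, hzero y s hy]
    · exact (integrable_indicator_iff Metric.isClosed_closedBall.measurableSet).2
        (integrableOn_const measure_closedBall_lt_top.ne)
    · refine Eventually.of_forall fun y => ?_
      fun_prop
  -- Fubini in the coordinates (height, position in the hyperplane), followed by the substitution `s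
  -- = -δ r`: the layer sits at depth between `δ` and `2 δ` on the side opposite to `ν`.
  have hlayer : ∀ δ : ℝ, 0 < δ → ∫ y, ψ y * (δ⁻¹ * deriv layerCutoff (-⟪y - p, ν⟫ / δ)) =
      ∫ r, deriv layerCutoff r * a (-δ * r) := by
    intro δ hδ
    have hin : ∀ (s : ℝ) (y : (ℝ ∙ ν)ᗮ), ⟪p + y + s • ν - p, ν⟫ = s := by
      intro s y
      rw [show p + (y : Space (n + 1)) + s • ν - p = y + s • ν by abel, inner_add_left,
        Submodule.mem_orthogonal_singleton_iff_inner_left.1 y.2, real_inner_smul_left,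
        real_inner_self_eq_norm_sq, hν]
      simp
    have hg : Continuous fun y => ψ y * (δ⁻¹ * deriv layerCutoff (-⟪y - p, ν⟫ / δ)) := by
      have := continuous_deriv_layerCutoff
      fun_prop
    have hgi : Integrable fun y => ψ y * (δ⁻¹ * deriv layerCutoff (-⟪y - p, ν⟫ / δ)) :=
      hg.integrable_of_hasCompactSupport hc.mul_right
    have hmp2 := measurePreserving_hyperplane p hν
    rw [← hmp2.map_eq, integral_map hmp2.measurable.aemeasurable hg.aestronglyMeasurable,
      integral_prod]
    · simp_rw [hin, integral_mul_const]
      have h2 := Measure.integral_comp_mul_left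
        (fun s => a s * (δ⁻¹ * deriv layerCutoff (-s / δ))) (-δ)
      have h3 : |(-δ)⁻¹| = δ⁻¹ := by rw [inv_neg, abs_neg, abs_of_pos (inv_pos.2 hδ)]
      rw [h3, smul_eq_mul] at h2
      have h4 : ∀ r : ℝ, - (-δ * r) / δ = r := fun r => by field_simp
      simp_rw [h4] at h2
      have h5 : ∫ s, a s * (δ⁻¹ * deriv layerCutoff (-s / δ)) =
          δ * ∫ r, a (-δ * r) * (δ⁻¹ * deriv layerCutoff r) := by
        rw [h2]; field_simp
      refine h5.trans ?_
      rw [← integral_const_mul]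
      refine integral_congr_ae (Eventually.of_forall fun r => ?_)
      simp only
      field_simp
    · exact hmp2.integrable_comp_of_integrable hgi
  have hlim : ∫ y in hyperplane p ν, ψ y ∂μHE[n] = ∫ r, deriv layerCutoff r * a 0 := by
    rw [integral_mul_const, integral_deriv_layerCutoff, one_mul, ← hmp.integral_comp he]
    simp [ha]
  rw [hlim]
  refine Tendsto.congr' (f₁ := fun δ : ℝ => ∫ r, deriv layerCutoff r * a (-δ * r)) ?_ ?_
  · filter_upwards [self_mem_nhdsWithin] with δ hδ using (hlayer δ hδ).symm
  -- The weight in `r` lives on `[1, 2]`, so for `δ < 1` only heights in `[-2, 2]` matter for the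
  -- dominating function.
  obtain ⟨A, hA⟩ := (isCompact_Icc (a := (-2 : ℝ)) (b := 2)).exists_bound_of_continuousOn
    hacont.continuousOn
  refine tendsto_integral_filter_of_dominated_convergence (fun r => deriv layerCutoff r * A)
    ?_ ?_ ?_ ?_
  · refine Eventually.of_forall fun δ => Continuous.aestronglyMeasurable ?_
    have := continuous_deriv_layerCutoff
    fun_prop
  · filter_upwards [Ioo_mem_nhdsGT (show (0 : ℝ) < 1 by norm_num)] with δ hδ
    refine Eventually.of_forall fun r => ?_
    rw [norm_mul, Real.norm_of_nonneg (deriv_layerCutoff_nonneg r)]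
    by_cases hr : r ∈ Icc (1 : ℝ) 2
    · refine mul_le_mul_of_nonneg_left (hA _ ?_) (deriv_layerCutoff_nonneg r)
      constructor <;> nlinarith [hr.1, hr.2, hδ.1, hδ.2]
    · simp only [mem_Icc, not_and_or, not_le] at hr
      rw [hr.elim deriv_layerCutoff_of_lt deriv_layerCutoff_of_gt]
      simp
  · exact (continuous_deriv_layerCutoff.integrable_of_hasCompactSupport
      hasCompactSupport_deriv_layerCutoff).mul_const _
  · refine Eventually.of_forall fun r => ?_
    have : Continuous fun δ : ℝ => deriv layerCutoff r * a (-δ * r) := by fun_prop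
    simpa using (this.tendsto 0).mono_left nhdsWithin_le_nhds

end Hyperplane

/-! ### Defining functions and flattening charts of the boundary -/

theorem fderiv_eq_inner_gradient {d : ℕ} (f : Space d → ℝ) (x v : Space d) :
    fderiv ℝ f x v = ⟪gradient f x, v⟫ := by
  simp [gradient]

theorem gradient_const_mul {d : ℕ} {f : Space d → ℝ} {x : Space d} (c : ℝ) :
    gradient (fun y => c * f y) x = c • gradient f x := by
  have : (fun y => c * f y) = c • f := rfl
  rw [gradient, this, fderiv_const_smul_field]
  simp [gradient]

theorem IsOutwardUnitNormal.outwardNormal_eq {d : ℕ} {Ω : Set (Space d)} {p ν : Space d}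
    (h : IsOutwardUnitNormal Ω p ν) : outwardNormal Ω p = ν :=
  (Classical.epsilon_spec ⟨ν, h⟩ : IsOutwardUnitNormal Ω p (outwardNormal Ω p)).unique h

/-- Rescaling serves to normalize a defining function so that its gradient at `p` is the outward
unit normal itself. -/
theorem IsLocalDefiningFunction.const_mul {d : ℕ} {Ω : Set (Space d)} {p : Space d}
    {φ : Space d → ℝ} (h : IsLocalDefiningFunction Ω p φ) {c : ℝ} (hc : 0 < c) :
    IsLocalDefiningFunction Ω p (fun x => c * φ x) := by
  obtain ⟨h0, hg, U, hU, hpU, hs, hi⟩ := h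
  refine ⟨by simp [h0], ?_, U, hU, hpU, contDiffOn_const.mul hs, fun x hx => ?_⟩
  · rw [gradient_const_mul]
    exact smul_ne_zero hc.ne' hg
  · rw [hi x hx, mul_neg_iff]
    constructor
    · exact fun h => Or.inl ⟨hc, h⟩
    · rintro (h | h)
      · exact h.2
      · exact absurd hc h.1.not_gt

theorem continuousOn_gradient {d : ℕ} {f : Space d → ℝ} {U : Set (Space d)} (hU : IsOpen U)
    (hf : ContDiffOn ℝ 1 f U) : ContinuousOn (gradient f) U := by
  have := hf.continuousOn_fderiv_of_isOpen hU le_rfl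
  exact (InnerProductSpace.toDual ℝ (Space d)).symm.continuous.comp_continuousOn this

/-- Points with `φ > 0` have a neighbourhood disjoint from `Ω`. Conversely, a zero of `φ` outside
the closure of `Ω` would be a local minimum of `φ`, which a non-zero gradient excludes. -/
theorem mem_frontier_iff_of_defining {d : ℕ} {Ω U : Set (Space d)} {φ : Space d → ℝ}
    (hΩ : IsOpen Ω) (hU : IsOpen U) (hφ : ContinuousOn φ U) (hi : ∀ x ∈ U, x ∈ Ω ↔ φ x < 0)
    {x : Space d} (hx : x ∈ U) (hg : gradient φ x ≠ 0) : x ∈ frontier Ω ↔ φ x = 0 := by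
  have hc : ContinuousAt φ x := hφ.continuousAt (hU.mem_nhds hx)
  rw [hΩ.frontier_eq, Set.mem_sdiff, hi x hx, not_lt]
  constructor
  · rintro ⟨h1, h2⟩
    refine le_antisymm (not_lt.1 fun h3 => ?_) h2
    have h4 : {y | 0 < φ y} ∩ U ∈ 𝓝 x := inter_mem (hc.eventually (lt_mem_nhds h3)) (hU.mem_nhds hx)
    obtain ⟨y, ⟨hy1, hy2⟩, hy3⟩ := mem_closure_iff_nhds.1 h1 _ h4
    exact absurd ((hi y hy2).1 hy3) (not_lt.2 (le_of_lt hy1))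
  · intro h0
    refine ⟨?_, h0.ge⟩
    by_contra hcl
    have : IsLocalMin φ x := by
      filter_upwards [isClosed_closure.isOpen_compl.mem_nhds hcl, hU.mem_nhds hx] with y hy hyU
      rw [h0]
      exact not_lt.1 fun h => hy (subset_closure ((hi y hyU).2 h))
    exact hg (by simp [gradient, this.fderiv_eq_zero])

/-- Normalizing moves `g` by `|1 - ‖g‖|`, which is at most `‖g - ν‖` because `ν` is a unit vector.
So the error at most doubles. -/
theorem norm_normalize_sub_le {d : ℕ} {g ν : Space d} (hν : ‖ν‖ = 1) {ε : ℝ}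
    (h : ‖g - ν‖ ≤ ε) (hg : g ≠ 0) : ‖‖g‖⁻¹ • g - ν‖ ≤ 2 * ε := by
  have h0 : ‖g‖ ≠ 0 := norm_ne_zero_iff.2 hg
  have h1 : ‖‖g‖⁻¹ • g - g‖ = |1 - ‖g‖| := by
    rw [show ‖g‖⁻¹ • g - g = (‖g‖⁻¹ - 1) • g by rw [sub_smul, one_smul], norm_smul,
      Real.norm_eq_abs, ← abs_of_nonneg (norm_nonneg g), ← abs_mul, abs_of_nonneg (norm_nonneg g),
      sub_mul, inv_mul_cancel₀ h0, one_mul]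
  have h2 : |1 - ‖g‖| ≤ ε := by
    rw [← hν]
    refine (abs_norm_sub_norm_le ν g).trans ?_
    rwa [norm_sub_rev]
  calc ‖‖g‖⁻¹ • g - ν‖ = ‖(‖g‖⁻¹ • g - g) + (g - ν)‖ := by congr 1; abel
    _ ≤ _ := norm_add_le _ _
    _ ≤ 2 * ε := by rw [h1]; linarith

/-- A chart `e` of `ℝ^d` flattening the boundary of `Ω` to the hyperplane through `p` orthogonal
to `ν`, with defining function `φ = ⟪e · - p, ν⟫`. Both `e` and its inverse are `K`-Lipschitz, and
both the gradient of `φ` and the outward normal are `ε`-close to `ν`. -/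
structure IsFlatteningChart {d : ℕ} (Ω : Set (Space d)) (p ν : Space d) (φ : Space d → ℝ)
    (e : OpenPartialHomeomorph (Space d) (Space d)) (K : ℝ≥0) (ε : ℝ) : Prop where
  mem_source : p ∈ e.source
  norm_normal : ‖ν‖ = 1
  lipschitz : LipschitzOnWith K e e.source
  lipschitz_symm : LipschitzOnWith K e.symm e.target
  contDiffOn : ContDiffOn ℝ ∞ φ e.source
  eq_inner : ∀ x ∈ e.source, φ x = ⟪e x - p, ν⟫
  mem_iff : ∀ x ∈ e.source, x ∈ Ω ↔ φ x < 0
  mem_frontier_iff : ∀ x ∈ e.source, x ∈ frontier Ω ↔ φ x = 0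
  gradient_near : ∀ x ∈ e.source, ‖gradient φ x - ν‖ ≤ ε
  normal_near : ∀ x ∈ e.source, x ∈ frontier Ω → ‖outwardNormal Ω x - ν‖ ≤ ε

/-- The chart `x ↦ x + (φ x - ⟪x - p, ν⟫) ν` turns the height over the tangent hyperplane into `φ`.
When `φ` has gradient `ν` at `p`, its strict derivative there is the identity, so near `p` it
deviates from the identity by a map with arbitrarily small Lipschitz constant. -/
theorem exists_isFlatteningChart {d : ℕ} {Ω : Set (Space d)} (hΩ : IsSmoothBoundedDomain Ω)
    {p : Space d} (hp : p ∈ frontier Ω) {K : ℝ≥0} (hK : 1 < K) {ε : ℝ} (hε : 0 < ε)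
    {W : Set (Space d)} (hW : W ∈ 𝓝 p) :
    ∃ (φ : Space d → ℝ) (e : OpenPartialHomeomorph (Space d) (Space d)),
      e.source ⊆ W ∧ IsFlatteningChart Ω p (outwardNormal Ω p) φ e K ε := by
  obtain ⟨φ₀, hφ₀⟩ := hΩ.smoothBoundary p hp
  have hc : 0 < ‖gradient φ₀ p‖⁻¹ := inv_pos.2 (norm_pos_iff.2 hφ₀.2.1)
  have hφ := hφ₀.const_mul hc
  have hν : outwardNormal Ω p = gradient (fun x => ‖gradient φ₀ p‖⁻¹ * φ₀ x) p := by
    have h1 : IsOutwardUnitNormal Ω p (‖gradient φ₀ p‖⁻¹ • gradient φ₀ p) := ⟨φ₀, hφ₀, rfl⟩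
    rw [gradient_const_mul]
    exact h1.outwardNormal_eq
  have hν1 : ‖outwardNormal Ω p‖ = 1 := by
    rw [hν, gradient_const_mul, norm_smul, norm_inv, norm_norm,
      inv_mul_cancel₀ (norm_ne_zero_iff.2 hφ₀.2.1)]
  generalize outwardNormal Ω p = ν at *
  generalize (fun x => ‖gradient φ₀ p‖⁻¹ * φ₀ x) = φ at *
  obtain ⟨h0, hg, U, hU, hpU, hs, hi⟩ := hφ
  set Φ : Space d → Space d := fun x => x + (φ x - ⟪x - p, ν⟫) • ν with hΦ
  have hstrict : HasStrictFDerivAt Φ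
      ((ContinuousLinearEquiv.refl ℝ (Space d) : Space d ≃L[ℝ] Space d) :
        Space d →L[ℝ] Space d) p := by
    have h1 : HasStrictFDerivAt φ (innerSL ℝ ν) p := by
      have := (hs.contDiffAt (hU.mem_nhds hpU)).hasStrictFDerivAt (by simp)
      have heq : fderiv ℝ φ p = innerSL ℝ ν := ContinuousLinearMap.ext fun v => by
        rw [fderiv_eq_inner_gradient, ← hν]
        rfl
      rwa [heq] at this
    have h2 : HasStrictFDerivAt (fun x : Space d => ⟪x - p, ν⟫) (innerSL ℝ ν) p := by
      have := ((innerSL ℝ ν).hasStrictFDerivAt (x := p)).sub_const (⟪ν, p⟫)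
      refine this.congr_of_eventuallyEq (Eventually.of_forall fun x => ?_)
      simp [real_inner_comm, inner_sub_right]
    have := (hasStrictFDerivAt_id p).add ((h1.sub h2).smul_const ν)
    have heq : ContinuousLinearMap.id ℝ (Space d) + (innerSL ℝ ν - innerSL ℝ ν).smulRight ν =
      ((ContinuousLinearEquiv.refl ℝ (Space d) : Space d ≃L[ℝ] Space d) :
        Space d →L[ℝ] Space d) := ContinuousLinearMap.ext fun v => by simp
    rw [heq] at this
    exact this
  -- the constant of linear approximation
  obtain ⟨c, hc0, hc1, hcK, hcK'⟩ : ∃ c : ℝ≥0, 0 < c ∧ (c : ℝ) < 1 ∧ 1 + (c : ℝ) ≤ K ∧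
      1 ≤ (K : ℝ) * (1 - c) := by
    have hK' : (1 : ℝ) < K := by exact_mod_cast hK
    have hpos : (0 : ℝ) < (K - 1) / K := div_pos (by linarith) (by linarith)
    -- `c = (K - 1) / K` solves `K (1 - c) = 1`, and `1 + c ≤ K` because dividing by `K > 1` only
    -- decreases `K - 1`.
    refine ⟨Real.toNNReal (((K : ℝ) - 1) / K), Real.toNNReal_pos.2 hpos, ?_, ?_, ?_⟩ <;>
      rw [Real.coe_toNNReal _ hpos.le]
    · rw [div_lt_one (by linarith)]; linarith
    · have : ((K : ℝ) - 1) / K ≤ K - 1 := div_le_self (by linarith) hK'.le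
      linarith
    · rw [mul_sub, mul_div_cancel₀ _ (by linarith)]; linarith
  obtain ⟨s, hsp, hsa⟩ := hstrict.approximates_deriv_on_nhds (c := c) (Or.inr hc0)
  have hgc : ContinuousAt (gradient φ) p :=
    (continuousOn_gradient hU (hs.of_le (by simp))).continuousAt (hU.mem_nhds hpU)
  -- The bound `ε / 2` leaves room for the doubling of the error when the gradient is normalized;
  -- the bound `1 / 2` keeps the gradient away from zero.
  have hgn : {x | ‖gradient φ x - ν‖ ≤ min (ε / 2) (1 / 2)} ∈ 𝓝 p := by
    have := hgc.eventually (Metric.closedBall_mem_nhds (gradient φ p)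
      (show 0 < min (ε / 2) (1 / 2) by positivity))
    filter_upwards [this] with x hx
    rw [hν]
    simpa [dist_eq_norm] using hx
  obtain ⟨t, hts, hto, hpt⟩ := mem_nhds_iff.1
    (inter_mem (inter_mem hsp hW) (inter_mem hgn (hU.mem_nhds hpU)))
  have hta : ApproximatesLinearOn Φ _ t c := hsa.mono_set fun x hx => (hts hx).1.1
  -- The identity has norm one only on a nontrivial space, hence the separate case.
  have hcN : Subsingleton (Space d) ∨
      c < ‖(((ContinuousLinearEquiv.refl ℝ (Space d)).symm : Space d ≃L[ℝ] Space d) :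
        Space d →L[ℝ] Space d)‖₊⁻¹ := by
    rcases subsingleton_or_nontrivial (Space d) with h | h
    · exact Or.inl h
    · right
      have : ‖(((ContinuousLinearEquiv.refl ℝ (Space d)).symm : Space d ≃L[ℝ] Space d) :
        Space d →L[ℝ] Space d)‖₊ = 1 := by
        simp
      rw [this, inv_one]
      exact_mod_cast hc1
  set e := hta.toOpenPartialHomeomorph Φ t hcN hto with he
  have hgt : ∀ x ∈ t, gradient φ x ≠ 0 := by
    intro x hx h
    have := (hts hx).2.1
    simp only [mem_ofPred_eq, h, zero_sub, norm_neg, hν1] at this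
    have := this.trans (min_le_right _ _)
    norm_num at this
  have hfr : ∀ x ∈ t, x ∈ frontier Ω ↔ φ x = 0 := fun x hx =>
    mem_frontier_iff_of_defining hΩ.isOpen hU hs.continuousOn hi (hts hx).2.2 (hgt x hx)
  have hdiff : ∀ x ∈ t, ∀ y ∈ t, ‖Φ x - Φ y - (x - y)‖ ≤ c * dist x y := fun x hx y hy => by
    simpa [dist_eq_norm] using hta x hx y hy
  -- Since `Φ` deviates from the identity by a `c`-Lipschitz map, it shrinks distances by at most
  -- the factor `1 - c`; this is the Lipschitz bound of the inverse.
  have hlow : ∀ x ∈ t, ∀ y ∈ t, dist x y ≤ K * dist (Φ x) (Φ y) := by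
    intro x hx y hy
    have h1 := hdiff x hx y hy
    have h2 : dist x y ≤ dist (Φ x) (Φ y) + c * dist x y := by
      have := norm_sub_le (Φ x - Φ y) (Φ x - Φ y - (x - y))
      rw [sub_sub_cancel] at this
      simp only [dist_eq_norm] at *
      linarith
    have h3 : (K : ℝ) * (1 - c) * dist x y ≤ K * dist (Φ x) (Φ y) := by
      rw [mul_assoc]
      exact mul_le_mul_of_nonneg_left (by linarith) K.coe_nonneg
    nlinarith [dist_nonneg (x := x) (y := y)]
  refine ⟨φ, e, fun x hx => (hts hx).1.2, hpt, hν1, ?_, ?_, hs.mono fun x hx => (hts hx).2.2, ?_,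
    fun x hx => hi x (hts hx).2.2, hfr, fun x hx => (hts hx).2.1.trans ?_, ?_⟩
  · refine LipschitzOnWith.of_dist_le_mul fun x hx y hy => ?_
    have h1 := hdiff x hx y hy
    have h2 := norm_add_le (Φ x - Φ y - (x - y)) (x - y)
    rw [sub_add_cancel] at h2
    change dist (Φ x) (Φ y) ≤ _
    refine le_trans ?_ (mul_le_mul_of_nonneg_right hcK dist_nonneg)
    rw [dist_eq_norm (Φ x), add_mul, one_mul, dist_eq_norm x y] at *
    linarith
  · refine LipschitzOnWith.of_dist_le_mul fun x hx y hy => ?_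
    have := hlow _ (e.map_target hx) _ (e.map_target hy)
    have hx' : Φ (e.symm x) = x := e.right_inv hx
    have hy' : Φ (e.symm y) = y := e.right_inv hy
    rwa [hx', hy'] at this
  · intro x hx
    have : e x = Φ x := rfl
    rw [this, hΦ]
    simp only
    rw [show x + (φ x - ⟪x - p, ν⟫) • ν - p = (x - p) + (φ x - ⟪x - p, ν⟫) • ν by abel,
      inner_add_left, real_inner_smul_left, real_inner_self_eq_norm_sq, hν1]
    ring
  · exact (min_le_left _ _).trans (by linarith)
  · intro x hx hxf
    have h1 : IsOutwardUnitNormal Ω x (‖gradient φ x‖⁻¹ • gradient φ x) :=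
      ⟨φ, ⟨(hfr x hx).1 hxf, hgt x hx, U, hU, (hts hx).2.2, hs, hi⟩, rfl⟩
    rw [h1.outwardNormal_eq]
    refine (norm_normalize_sub_le hν1 ((hts hx).2.1.trans (min_le_left _ _)) (hgt x hx)).trans ?_
    linarith

/-! ### Transport of surface and layer integrals by charts -/

section Bilipschitz

variable {X : Type*} [MetricSpace X] [MeasurableSpace X] [BorelSpace X]
  (e : OpenPartialHomeomorph X X) {K : ℝ≥0}

/-- A map that is bi-Lipschitz with constant `K` distorts `k`-dimensional integrals by at most a
factor `K ^ k`. -/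
theorem setIntegral_comp_bilipschitz (h : LipschitzOnWith K e e.source)
    (h' : LipschitzOnWith K e.symm e.target) (k : ℕ) {g : X → ℝ} (hg : Continuous g)
    (hg0 : ∀ y, 0 ≤ g y) (hsupp : ∀ y ∉ e.target, g y = 0) {B : Set X} (hB : IsClosed B)
    (hi : IntegrableOn g B μHE[k]) :
    IntegrableOn (fun x => g (e x)) (e.source ∩ e ⁻¹' B) μHE[k] ∧
    ∫ x in e.source ∩ e ⁻¹' B, g (e x) ∂μHE[k] ≤ (K : ℝ) ^ k * ∫ y in B, g y ∂μHE[k] ∧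
    ∫ y in B, g y ∂μHE[k] ≤ (K : ℝ) ^ k * ∫ x in e.source ∩ e ⁻¹' B, g (e x) ∂μHE[k] := by
  have hmA := measurableSet_source_inter_preimage e hB
  set a := ∫⁻ x in e.source ∩ e ⁻¹' B, ENNReal.ofReal (g (e x)) ∂μHE[k] with ha
  set b := ∫⁻ y in B, ENNReal.ofReal (g y) ∂μHE[k] with hb
  have hcont : ContinuousOn (fun x => g (e x)) e.source := hg.comp_continuousOn e.continuousOn
  have hb' : b = ∫⁻ y in e.target ∩ B, ENNReal.ofReal (g y) ∂μHE[k] := by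
    rw [← setLIntegral_indicator e.open_target.measurableSet, hb]
    refine lintegral_congr fun y => ?_
    by_cases hy : y ∈ e.target <;> simp [hy, hsupp]
  have hab : a ≤ (K : ℝ≥0∞) ^ k * b := by
    rw [hb']
    exact setLIntegral_comp_le_of_lipschitzOn e h' k (by fun_prop) hB
  -- The same estimate for the inverse chart, applied to the integrand cut off to the part of the
  -- source that is mapped into `B`.
  have hba : b ≤ (K : ℝ≥0∞) ^ k * a := by
    have := lintegral_comp_le_of_lipschitzOn e.symm (by simpa using h) k
      (g := (e.source ∩ e ⁻¹' B).indicator fun x => ENNReal.ofReal (g (e x))) (by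
        have h1 : AEMeasurable (fun x => ENNReal.ofReal (g (e x))) ((μHE[k]).restrict e.source) :=
          (hcont.aemeasurable e.open_source.measurableSet).ennreal_ofReal
        exact h1.indicator hmA)
    rw [e.symm_target, setLIntegral_indicator hmA, show e.source ∩ e ⁻¹' B ∩ e.source =
      e.source ∩ e ⁻¹' B by ext x; simp only [mem_inter_iff]; tauto] at this
    refine le_trans (le_of_eq ?_) this
    rw [hb', ← inter_comm B, ← setLIntegral_indicator hB.measurableSet, e.symm_source]
    refine setLIntegral_congr_fun e.open_target.measurableSet fun y hy => ?_
    by_cases hyB : y ∈ B <;> simp [indicator, hy, hyB]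
  have hbtop : b ≠ ⊤ := by
    have := hi.hasFiniteIntegral
    rw [hasFiniteIntegral_iff_ofReal (Eventually.of_forall hg0)] at this
    exact this.ne
  have hKtop : (K : ℝ≥0∞) ^ k ≠ ⊤ := ENNReal.pow_ne_top ENNReal.coe_ne_top
  have hatop : a ≠ ⊤ := ne_top_of_le_ne_top (ENNReal.mul_ne_top hKtop hbtop) hab
  have hsm : AEStronglyMeasurable (fun x => g (e x)) ((μHE[k]).restrict (e.source ∩ e ⁻¹' B)) :=
    ((hcont.mono inter_subset_left).aemeasurable hmA).aestronglyMeasurable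
  have ea : ∫ x in e.source ∩ e ⁻¹' B, g (e x) ∂μHE[k] = a.toReal :=
    integral_eq_lintegral_of_nonneg_ae (Eventually.of_forall fun x => hg0 _) hsm
  have eb : ∫ y in B, g y ∂μHE[k] = b.toReal :=
    integral_eq_lintegral_of_nonneg_ae (Eventually.of_forall fun x => hg0 _)
      hg.aestronglyMeasurable
  refine ⟨⟨hsm, ?_⟩, ?_, ?_⟩
  · rw [hasFiniteIntegral_iff_ofReal (Eventually.of_forall fun x => hg0 _)]
    exact lt_top_iff_ne_top.2 hatop
  · rw [ea, eb]
    simpa using ENNReal.toReal_mono (ENNReal.mul_ne_top hKtop hbtop) hab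
  · rw [ea, eb]
    simpa using ENNReal.toReal_mono (ENNReal.mul_ne_top hKtop hatop) hba

end Bilipschitz

/-- A function with compact support in the source of a chart, transported to the target. -/
theorem transport_continuous_compactSupport {X : Type*} [TopologicalSpace X] [T2Space X]
    (e : OpenPartialHomeomorph X X) {ψ : X → ℝ} (hψ : Continuous ψ) (hc : HasCompactSupport ψ)
    (hs : tsupport ψ ⊆ e.source) :
    Continuous (e.target.indicator (ψ ∘ e.symm)) ∧
      HasCompactSupport (e.target.indicator (ψ ∘ e.symm)) := by
  have hK : IsCompact (e '' tsupport ψ) := hc.isCompact.image_of_continuousOn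
    (e.continuousOn.mono hs)
  have hz : ∀ y ∉ e '' tsupport ψ, e.target.indicator (ψ ∘ e.symm) y = 0 := by
    intro y hy
    by_cases hyt : y ∈ e.target
    · rw [indicator_of_mem hyt]
      exact image_eq_zero_of_notMem_tsupport (f := ψ) fun h => hy ⟨_, h, e.right_inv hyt⟩
    · exact indicator_of_notMem hyt _
  refine ⟨continuous_iff_continuousAt.2 fun y => ?_, HasCompactSupport.intro hK hz⟩
  by_cases hy : y ∈ e '' tsupport ψ
  · have hyt : y ∈ e.target := by
      obtain ⟨x, hx, rfl⟩ := hy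
      exact e.map_source (hs hx)
    have h1 : ContinuousOn (ψ ∘ e.symm) e.target := hψ.comp_continuousOn e.continuousOn_symm
    refine (h1.continuousAt (e.open_target.mem_nhds hyt)).congr ?_
    filter_upwards [e.open_target.mem_nhds hyt] with z hz using (indicator_of_mem hz _).symm
  · refine (continuousAt_const (y := (0 : ℝ))).congr ?_
    filter_upwards [hK.isClosed.isOpen_compl.mem_nhds hy] with z hzz using (hz z hzz).symm

section LayerComparison

variable {n : ℕ} {Ω : Set (Space (n + 1))} {p ν : Space (n + 1)} {φ : Space (n + 1) → ℝ}
  {e : OpenPartialHomeomorph (Space (n + 1)) (Space (n + 1))} {K : ℝ≥0} {ε : ℝ}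

/-- The integral over a layer `{-2δ < φ < -δ}` is, up to powers of `K`, close to the integral over
the boundary. -/
theorem IsFlatteningChart.layer_comparison (h : IsFlatteningChart Ω p ν φ e K ε)
    {ψ : Space (n + 1) → ℝ} (hψ : Continuous ψ) (hc : HasCompactSupport ψ)
    (hs : tsupport ψ ⊆ e.source) (h0 : ∀ x, 0 ≤ ψ x) :
    ∃ (J : ℝ → ℝ) (J0 : ℝ), Tendsto J (𝓝[>] 0) (𝓝 J0) ∧
      IntegrableOn ψ (frontier Ω) μHE[n] ∧
      ∫ x in frontier Ω, ψ x ∂μHE[n] ≤ (K : ℝ) ^ n * J0 ∧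
      J0 ≤ (K : ℝ) ^ n * ∫ x in frontier Ω, ψ x ∂μHE[n] ∧
      ∀ δ : ℝ, 0 < δ →
        IntegrableOn (fun x => ψ x * (δ⁻¹ * deriv layerCutoff (-φ x / δ))) e.source ∧
        ∫ x in e.source, ψ x * (δ⁻¹ * deriv layerCutoff (-φ x / δ)) ≤ (K : ℝ) ^ (n + 1) * J δ ∧
        J δ ≤ (K : ℝ) ^ (n + 1) *
          ∫ x in e.source, ψ x * (δ⁻¹ * deriv layerCutoff (-φ x / δ)) := by
  obtain ⟨hcont, hcomp⟩ := transport_continuous_compactSupport e hψ hc hs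
  set ψ' := e.target.indicator (ψ ∘ e.symm) with hψ'
  have hψe : ∀ x ∈ e.source, ψ' (e x) = ψ x := fun x hx => by
    rw [hψ', indicator_of_mem (e.map_source hx), Function.comp_apply, e.left_inv hx]
  have hψ0 : ∀ y, 0 ≤ ψ' y := fun y => indicator_nonneg (fun x _ => h0 _) y
  have hψt : ∀ y ∉ e.target, ψ' y = 0 := fun y hy => indicator_of_notMem hy _
  obtain ⟨i1, i2, i3⟩ := setIntegral_comp_bilipschitz e h.lipschitz h.lipschitz_symm n hcont hψ0
    hψt (isClosed_hyperplane p ν) (integrableOn_hyperplane p hcont hcomp h.norm_normal)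
  -- In the chart, the boundary of `Ω` is exactly the tangent hyperplane, because both are the zero
  -- set of `φ`.
  have hset : e.source ∩ e ⁻¹' hyperplane p ν = frontier Ω ∩ e.source := by
    ext x
    simp only [mem_inter_iff, mem_preimage, hyperplane, mem_ofPred_eq]
    constructor
    · rintro ⟨hx, h1⟩
      exact ⟨(h.mem_frontier_iff x hx).2 (by rw [h.eq_inner x hx, h1]), hx⟩
    · rintro ⟨h1, hx⟩
      exact ⟨hx, by rw [← h.eq_inner x hx, (h.mem_frontier_iff x hx).1 h1]⟩
  have hms : MeasurableSet (frontier Ω ∩ e.source) :=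
    isClosed_frontier.measurableSet.inter e.open_source.measurableSet
  have hz : ∀ x ∈ frontier Ω \ (frontier Ω ∩ e.source), ψ x = 0 := fun x hx =>
    image_eq_zero_of_notMem_tsupport fun hx' => hx.2 ⟨hx.1, hs hx'⟩
  have heq : ∫ x in frontier Ω ∩ e.source, ψ' (e x) ∂μHE[n] = ∫ x in frontier Ω, ψ x ∂μHE[n] := by
    rw [setIntegral_congr_fun hms fun x hx => hψe x hx.2]
    exact (setIntegral_eq_of_subset_of_forall_sdiff_eq_zero isClosed_frontier.measurableSet
      inter_subset_left hz).symm
  rw [hset] at i1 i2 i3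
  rw [heq] at i2 i3
  -- `J δ` is the layer integral of the transported function in flat coordinates, and `J0` is its
  -- limit. Surface integrals are distorted with exponent `n` and layer integrals with exponent `n +
  -- 1`.
  refine ⟨_, _, tendsto_integral_layer p hcont hcomp h.norm_normal, ?_, i2, i3, fun δ hδ => ?_⟩
  · have h1 : IntegrableOn ψ (frontier Ω ∩ e.source) μHE[n] :=
      i1.congr_fun (fun x hx => hψe x hx.2) hms
    exact h1.of_forall_sdiff_eq_zero isClosed_frontier.measurableSet hz
  · have hk := continuous_deriv_layerCutoff
    have hgc : Continuous fun y => ψ' y * (δ⁻¹ * deriv layerCutoff (-⟪y - p, ν⟫ / δ)) := by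
      fun_prop
    obtain ⟨j1, j2, j3⟩ := setIntegral_comp_bilipschitz e h.lipschitz h.lipschitz_symm (n + 1) hgc
      (fun y => mul_nonneg (hψ0 y) (mul_nonneg (inv_nonneg.2 hδ.le) (deriv_layerCutoff_nonneg _)))
      (fun y hy => by rw [hψt y hy, zero_mul]) isClosed_univ
      ((by
        rw [EuclideanSpace.euclideanHausdorffMeasure_eq_volume]
        exact hgc.integrable_of_hasCompactSupport hcomp.mul_right :
          Integrable _ μHE[n + 1]).integrableOn)
    have hcongr : EqOn (fun x => ψ' (e x) * (δ⁻¹ * deriv layerCutoff (-⟪e x - p, ν⟫ / δ)))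
        (fun x => ψ x * (δ⁻¹ * deriv layerCutoff (-φ x / δ))) e.source := fun x hx => by
      simp only [hψe x hx, h.eq_inner x hx]
    simp only [preimage_univ, inter_univ, Measure.restrict_univ,
      EuclideanSpace.euclideanHausdorffMeasure_eq_volume] at j1 j2 j3
    rw [setIntegral_congr_fun e.open_source.measurableSet hcongr] at j2 j3
    exact ⟨j1.congr_fun hcongr e.open_source.measurableSet, j2, j3⟩

end LayerComparison

/-! ### Vector calculus and fields of compact support -/

section Calculus

variable {d : ℕ}

theorem sum_smul_single (v : Space d) : ∑ j : Fin d, v j • EuclideanSpace.single j (1 : ℝ) = v := by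
  have := (EuclideanSpace.basisFun (Fin d) ℝ).sum_repr v
  simpa using this

theorem inner_gradient_eq_sum (f : Space d → ℝ) (x v : Space d) :
    ⟪gradient f x, v⟫ = ∑ j : Fin d, fderiv ℝ f x (EuclideanSpace.single j 1) * v j := by
  rw [← fderiv_eq_inner_gradient]
  conv_lhs => rw [← sum_smul_single v]
  simp [mul_comm]

theorem divergence_smul {f : Space d → ℝ} {X : Space d → Space d} {x : Space d}
    (hf : DifferentiableAt ℝ f x) (hX : DifferentiableAt ℝ X x) :
    divergence (fun y => f y • X y) x = f x * divergence X x + ⟪gradient f x, X x⟫ := by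
  rw [inner_gradient_eq_sum, divergence, divergence, Finset.mul_sum, ← Finset.sum_add_distrib]
  refine Finset.sum_congr rfl fun j _ => ?_
  rw [fderiv_fun_smul hf hX]
  simp

theorem divergence_sub {X Y : Space d → Space d} {x : Space d}
    (hX : DifferentiableAt ℝ X x) (hY : DifferentiableAt ℝ Y x) :
    divergence (fun y => X y - Y y) x = divergence X x - divergence Y x := by
  simp only [divergence, fderiv_fun_sub hX hY, ← Finset.sum_sub_distrib]
  simp

theorem divergence_const_smul {X : Space d → Space d} (c : ℝ) (x : Space d) :
    divergence (fun y => c • X y) x = c * divergence X x := by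
  have : (fun y => c • X y) = c • X := rfl
  rw [divergence, divergence, this, fderiv_const_smul_field, Finset.mul_sum]
  simp

theorem divergence_congr {X Y : Space d → Space d} {x : Space d} (h : X =ᶠ[𝓝 x] Y) :
    divergence X x = divergence Y x := by
  rw [divergence, divergence, h.fderiv_eq]

theorem gradient_mul {f g : Space d → ℝ} {x : Space d}
    (hf : DifferentiableAt ℝ f x) (hg : DifferentiableAt ℝ g x) :
    gradient (fun y => f y * g y) x = f x • gradient g x + g x • gradient f x := by
  rw [gradient, fderiv_fun_mul hf hg]
  simp [gradient]

theorem gradient_comp_real {f : Space d → ℝ} {θ : ℝ → ℝ} {x : Space d}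
    (hθ : DifferentiableAt ℝ θ (f x)) (hf : DifferentiableAt ℝ f x) :
    gradient (fun y => θ (f y)) x = deriv θ (f x) • gradient f x := by
  rw [gradient, show (fun y => θ (f y)) = θ ∘ f from rfl, fderiv_comp x hθ hf]
  have : (fderiv ℝ θ (f x)).comp (fderiv ℝ f x) = deriv θ (f x) • fderiv ℝ f x := by
    ext1 v
    simp [mul_comm]
  rw [this]
  simp [gradient]

theorem continuousOn_divergence {X : Space d → Space d} {U : Set (Space d)} (hU : IsOpen U)
    (hX : ContDiffOn ℝ 1 X U) : ContinuousOn (divergence X) U := by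
  have := hX.continuousOn_fderiv_of_isOpen hU le_rfl
  unfold divergence
  fun_prop

theorem gradient_contDiffOn {f : Space d → ℝ} {U : Set (Space d)} (hU : IsOpen U) {m k : ℕ∞ω}
    (hf : ContDiffOn ℝ k f U) (hmk : m + 1 ≤ k) : ContDiffOn ℝ m (gradient f) U :=
  (InnerProductSpace.toDual ℝ (Space d)).symm.toContinuousLinearEquiv.contDiff.comp_contDiffOn
    (hf.fderiv_of_isOpen hU hmk)

/-- Integration by parts against the constant function `1`. -/
theorem integral_fderiv_apply_eq_zero {f : Space d → ℝ} (hf : ContDiff ℝ 1 f)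
    (hc : HasCompactSupport f) (v : Space d) : ∫ x, fderiv ℝ f x v = 0 := by
  have h1 : Integrable fun x => fderiv ℝ f x v :=
    ((hf.continuous_fderiv (by simp)).clm_apply continuous_const).integrable_of_hasCompactSupport
      (hc.fderiv_apply (𝕜 := ℝ) v)
  have := integral_mul_fderiv_eq_neg_fderiv_mul_of_integrable (μ := (volume : Measure (Space d)))
    (f := fun _ => (1 : ℝ)) (g := f) (v := v) (by simp) (by simpa using h1)
    (by simpa using hf.continuous.integrable_of_hasCompactSupport hc) (by simp)
    (fun x _ => hf.differentiable (by simp) x)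
  simpa using this

theorem contDiff_of_eq_zero_off_compact {E F : Type*} [NormedAddCommGroup E] [NormedSpace ℝ E]
    [NormedAddCommGroup F] [NormedSpace ℝ F] {Ω A : Set E} (hΩ : IsOpen Ω) {X : E → F}
    {k : ℕ∞ω} (hX : ContDiffOn ℝ k X Ω) (hA : IsCompact A)
    (hAΩ : A ⊆ Ω) (h0 : ∀ x ∉ A, X x = 0) : ContDiff ℝ k X := by
  refine contDiff_iff_contDiffAt.2 fun x => ?_
  by_cases hx : x ∈ Ω
  · exact hX.contDiffAt (hΩ.mem_nhds hx)
  · refine (contDiffAt_const (c := (0 : F))).congr_of_eventuallyEq ?_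
    filter_upwards [hA.isClosed.isOpen_compl.mem_nhds fun h => hx (hAΩ h)] with y hy using h0 y hy

/-- The divergence of a compactly supported vector field has vanishing integral. -/
theorem setIntegral_divergence_eq_zero {Ω A : Set (Space d)} (hΩ : IsOpen Ω)
    {X : Space d → Space d} (hX : ContDiffOn ℝ 1 X Ω) (hA : IsCompact A) (hAΩ : A ⊆ Ω)
    (h0 : ∀ x ∉ A, X x = 0) : ∫ x in Ω, divergence X x = 0 := by
  have hX' : ContDiff ℝ 1 X := contDiff_of_eq_zero_off_compact hΩ hX hA hAΩ h0
  have hd : ∀ x ∉ A, fderiv ℝ X x = 0 := by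
    intro x hx
    have : X =ᶠ[𝓝 x] fun _ => 0 := by
      filter_upwards [hA.isClosed.isOpen_compl.mem_nhds hx] with y hy using h0 y hy
    rw [this.fderiv_eq]
    simp
  rw [setIntegral_eq_integral_of_forall_compl_eq_zero fun x hx => by
    simp [divergence, hd x fun h => hx (hAΩ h)]]
  have hc : ∀ j : Fin d, HasCompactSupport fun x => X x j := fun j =>
    HasCompactSupport.intro hA fun x hx => by simp [h0 x hx]
  have hj : ∀ j : Fin d, ContDiff ℝ 1 fun x => X x j := fun j => by fun_prop
  have he : ∀ (j : Fin d) (x v : Space d), (fderiv ℝ X x v) j = fderiv ℝ (fun y => X y j) x v := by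
    intro j x v
    have h1 := (EuclideanSpace.proj (𝕜 := ℝ) j).hasFDerivAt.comp x
      (hX'.differentiable (by simp) x).hasFDerivAt
    have h2 : HasFDerivAt (fun y => X y j) ((EuclideanSpace.proj (𝕜 := ℝ) j).comp (fderiv ℝ X x)) x :=
      h1
    rw [h2.fderiv]
    rfl
  unfold divergence
  simp_rw [he]
  rw [integral_finsetSum]
  · exact Finset.sum_eq_zero fun j _ => integral_fderiv_apply_eq_zero (hj j) (hc j) _
  · intro j _
    exact (((hj j).continuous_fderiv (by simp)).clm_apply
      continuous_const).integrable_of_hasCompactSupport ((hc j).fderiv_apply (𝕜 := ℝ) _)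

theorem integrableOn_of_eq_zero_off_compact {X : Type*} [TopologicalSpace X] [T2Space X]
    [MeasurableSpace X] [OpensMeasurableSpace X] {μ : Measure X} [IsFiniteMeasureOnCompacts μ]
    {Ω A : Set X} {f : X → ℝ}
    (hA : IsCompact A) (hf : ContinuousOn f A) (h0 : ∀ x ∉ A, f x = 0) :
    IntegrableOn f Ω μ := by
  have h1 : IntegrableOn f A μ := hf.integrableOn_compact hA
  have h2 : IntegrableOn f univ μ := h1.of_forall_sdiff_eq_zero MeasurableSet.univ
    fun x hx => h0 x hx.2
  exact h2.mono_set (subset_univ _)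

end Calculus

/-! ### The divergence inequality near a boundary point -/

section FluxEstimate

variable {n : ℕ} {Ω : Set (Space (n + 1))} {p ν : Space (n + 1)} {φ : Space (n + 1) → ℝ}
  {e : OpenPartialHomeomorph (Space (n + 1)) (Space (n + 1))} {K : ℝ≥0} {ε : ℝ}

/-- Integration by parts against a cutoff vanishing near the boundary. -/
theorem IsFlatteningChart.integral_cutoff_divergence (h : IsFlatteningChart Ω p ν φ e K ε)
    (hΩ : IsOpen Ω) {G : Space (n + 1) → Space (n + 1)} (hG : ContDiffOn ℝ 1 G Ω)
    {ψ : Space (n + 1) → ℝ} (hψ : ContDiff ℝ ∞ ψ) (hc : HasCompactSupport ψ)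
    (hs : tsupport ψ ⊆ e.source) {δ : ℝ} (hδ : 0 < δ) :
    IntegrableOn (fun x => ψ x * layerCutoff (-φ x / δ) * divergence G x) (Ω ∩ e.source) ∧
    IntegrableOn (fun x => ψ x * (δ⁻¹ * deriv layerCutoff (-φ x / δ)) * ⟪gradient φ x, G x⟫)
      (Ω ∩ e.source) ∧
    ∫ x in Ω ∩ e.source, ψ x * layerCutoff (-φ x / δ) * divergence G x =
      -(∫ x in Ω ∩ e.source, layerCutoff (-φ x / δ) * ⟪gradient ψ x, G x⟫) +
      ∫ x in Ω ∩ e.source, ψ x * (δ⁻¹ * deriv layerCutoff (-φ x / δ)) * ⟪gradient φ x, G x⟫ := by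
  set O := Ω ∩ e.source with hO
  have hOo : IsOpen O := hΩ.inter e.open_source
  have hφO : ContDiffOn ℝ ∞ φ O := h.contDiffOn.mono inter_subset_right
  have hGO : ContDiffOn ℝ 1 G O := hG.mono inter_subset_left
  -- On the support of `ψ` the cutoff vanishes where `φ > -δ`. So every integrand lives on this
  -- compact subset of `Ω`, away from the boundary where `G` need not be differentiable.
  set A := tsupport ψ ∩ φ ⁻¹' Iic (-δ) with hA
  have hAc : IsCompact A := by
    have h1 : IsClosed A := (h.contDiffOn.continuousOn.mono hs).preimage_isClosed_of_isClosed
      (isClosed_tsupport ψ) isClosed_Iic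
    exact hc.isCompact.of_isClosed_subset h1 inter_subset_left
  have hAO : A ⊆ O := fun x hx =>
    ⟨(h.mem_iff x (hs hx.1)).2 (lt_of_le_of_lt hx.2 (by linarith)), hs hx.1⟩
  have hcut : ∀ x, x ∉ A → x ∈ tsupport ψ → -φ x / δ < 1 := by
    intro x hx hx'
    have : -δ < φ x := by
      by_contra hcon
      exact hx ⟨hx', not_lt.1 hcon⟩
    rw [div_lt_one hδ]
    linarith
  have z1 : ∀ x ∉ A, ψ x * layerCutoff (-φ x / δ) = 0 := by
    intro x hx
    by_cases hx' : x ∈ tsupport ψ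
    · rw [layerCutoff_of_le (hcut x hx hx').le, mul_zero]
    · rw [image_eq_zero_of_notMem_tsupport hx', zero_mul]
  have z2 : ∀ x ∉ A, ψ x * (δ⁻¹ * deriv layerCutoff (-φ x / δ)) = 0 := by
    intro x hx
    by_cases hx' : x ∈ tsupport ψ
    · rw [deriv_layerCutoff_of_lt (hcut x hx hx'), mul_zero, mul_zero]
    · rw [image_eq_zero_of_notMem_tsupport hx', zero_mul]
  have z3 : ∀ x ∉ A, layerCutoff (-φ x / δ) * ⟪gradient ψ x, G x⟫ = 0 := by
    intro x hx
    by_cases hx' : x ∈ tsupport ψ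
    · rw [layerCutoff_of_le (hcut x hx hx').le, zero_mul]
    · have : gradient ψ x = 0 := by
        have : fderiv ℝ ψ x = 0 := by
          by_contra hne
          exact hx' (support_fderiv_subset ℝ hne)
        simp [gradient, this]
      rw [this, inner_zero_left, mul_zero]
  have cφ : ContinuousOn φ A := hφO.continuousOn.mono hAO
  have cG : ContinuousOn G A := hGO.continuousOn.mono hAO
  have cd : ContinuousOn (divergence G) A := (continuousOn_divergence hOo hGO).mono hAO
  have cgφ : ContinuousOn (gradient φ) A := (continuousOn_gradient hOo
    (hφO.of_le (by simp))).mono hAO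
  have cgψ : Continuous (gradient ψ) := by
    rw [← continuousOn_univ]
    exact continuousOn_gradient isOpen_univ (hψ.of_le (by simp)).contDiffOn
  have hk := continuous_deriv_layerCutoff
  have hk' : Continuous layerCutoff := layerCutoff_contDiff.continuous
  have hψc := hψ.continuous
  have i1 : IntegrableOn (fun x => ψ x * layerCutoff (-φ x / δ) * divergence G x) O :=
    integrableOn_of_eq_zero_off_compact hAc (by fun_prop) fun x hx => by rw [z1 x hx, zero_mul]
  have i2 : IntegrableOn
      (fun x => ψ x * (δ⁻¹ * deriv layerCutoff (-φ x / δ)) * ⟪gradient φ x, G x⟫) O :=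
    integrableOn_of_eq_zero_off_compact hAc (by fun_prop) fun x hx => by rw [z2 x hx, zero_mul]
  have i3 : IntegrableOn (fun x => layerCutoff (-φ x / δ) * ⟪gradient ψ x, G x⟫) O :=
    integrableOn_of_eq_zero_off_compact hAc (by fun_prop) z3
  refine ⟨i1, i2, ?_⟩
  have hlc : ContDiffOn ℝ 1 (fun x => ψ x * layerCutoff (-φ x / δ)) O := by
    have a1 : ContDiffOn ℝ 1 (fun x => layerCutoff (-φ x / δ)) O :=
      (layerCutoff_contDiff.of_le (by simp)).comp_contDiffOn
        (((hφO.of_le (by simp)).neg).div_const δ)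
    exact (hψ.of_le (by simp)).contDiffOn.mul a1
  -- The cut-off field has compact support in `Ω`, so its divergence integrates to zero. The product
  -- rule splits this integral into the three terms of the claim.
  have hdiv : ∫ x in O, divergence (fun y => (ψ y * layerCutoff (-φ y / δ)) • G y) x = 0 :=
    setIntegral_divergence_eq_zero hOo (hlc.smul hGO) hAc hAO (fun x hx => by simp [z1 x hx])
  have heq : ∀ x ∈ O, divergence (fun y => (ψ y * layerCutoff (-φ y / δ)) • G y) x =
      ψ x * layerCutoff (-φ x / δ) * divergence G x +
        layerCutoff (-φ x / δ) * ⟪gradient ψ x, G x⟫ -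
        ψ x * (δ⁻¹ * deriv layerCutoff (-φ x / δ)) * ⟪gradient φ x, G x⟫ := by
    intro x hx
    have dφ : DifferentiableAt ℝ φ x :=
      (hφO.contDiffAt (hOo.mem_nhds hx)).differentiableAt (by simp)
    have dψ : DifferentiableAt ℝ ψ x := hψ.differentiable (by simp) x
    have dG : DifferentiableAt ℝ G x :=
      (hGO.contDiffAt (hOo.mem_nhds hx)).differentiableAt (by simp)
    have dφ' : DifferentiableAt ℝ (fun y => -δ⁻¹ * φ y) x := dφ.const_mul _
    have e1 : ∀ y, -φ y / δ = -δ⁻¹ * φ y := fun y => by ring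
    simp_rw [e1]
    have dl : DifferentiableAt ℝ layerCutoff (-δ⁻¹ * φ x) := layerCutoff_differentiable _
    have dc : DifferentiableAt ℝ (fun y => layerCutoff (-δ⁻¹ * φ y)) x :=
      DifferentiableAt.comp (g := layerCutoff) x dl dφ'
    have dm : DifferentiableAt ℝ (fun y => ψ y * layerCutoff (-δ⁻¹ * φ y)) x :=
      dψ.mul dc
    rw [divergence_smul dm dG]
    have e2 : gradient (fun y => ψ y * layerCutoff (-δ⁻¹ * φ y)) x =
        ψ x • (deriv layerCutoff (-δ⁻¹ * φ x) • (-δ⁻¹) • gradient φ x) +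
          layerCutoff (-δ⁻¹ * φ x) • gradient ψ x := by
      rw [gradient_mul (g := fun y => layerCutoff (-δ⁻¹ * φ y)) dψ dc,
        gradient_comp_real (f := fun y => -δ⁻¹ * φ y) dl dφ', gradient_const_mul]
    rw [e2]
    simp only [inner_add_left, real_inner_smul_left]
    ring
  have i13 : IntegrableOn (fun x => ψ x * layerCutoff (-φ x / δ) * divergence G x +
      layerCutoff (-φ x / δ) * ⟪gradient ψ x, G x⟫) O := i1.add i3
  rw [setIntegral_congr_fun hOo.measurableSet heq, integral_sub i13 i2,
    integral_add i1 i3] at hdiv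
  linarith

/-- The divergence theorem near a boundary point, as an inequality up to an error proportional
to the boundary measure. -/
theorem IsFlatteningChart.setIntegral_divergence_le (h : IsFlatteningChart Ω p ν φ e K ε)
    (hΩ : IsOpen Ω) (hΩb : Bornology.IsBounded Ω) (hK : 1 ≤ K)
    {G : Space (n + 1) → Space (n + 1)} (hG : ContDiffOn ℝ 1 G Ω)
    (hdiv : ∀ x ∈ Ω, 0 ≤ divergence G x) {M : ℝ} (hM0 : 0 ≤ M)
    (hM : ∀ x ∈ closure Ω, ‖G x‖ ≤ M) (hGε : ∀ x ∈ e.source ∩ closure Ω, ‖G x - G p‖ ≤ ε)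
    (hp : p ∈ closure Ω)
    {ψ : Space (n + 1) → ℝ} (hψ : ContDiff ℝ ∞ ψ) (hc : HasCompactSupport ψ)
    (hs : tsupport ψ ⊆ e.source) (h0 : ∀ x, 0 ≤ ψ x) {A : Set (Space (n + 1))}
    (hA : IsCompact A) (hAΩ : A ⊆ Ω)
    (hi : IntegrableOn (fun x => ψ x * ⟪G x, outwardNormal Ω x⟫) (frontier Ω) μHE[n])
    {η C : ℝ} (hη : η = (M + 1) * ε)
    (hC : C = η + M * ((K : ℝ) ^ n - 1) +
      (η + (M + η) * ((K : ℝ) ^ (n + 1) - 1)) * (K : ℝ) ^ n) :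
    ∫ x in A, ψ x * divergence G x ≤ -(∫ x in Ω, ⟪gradient ψ x, G x⟫) +
      (∫ x in frontier Ω, ψ x * ⟪G x, outwardNormal Ω x⟫ ∂μHE[n]) +
      C * ∫ x in frontier Ω, ψ x ∂μHE[n] := by
  obtain ⟨J, J0, hJ, hSi, hS1, hS2, hI⟩ := h.layer_comparison hψ.continuous hc hs h0
  set S := ∫ x in frontier Ω, ψ x ∂μHE[n] with hS
  set γ := ⟪G p, ν⟫ with hγ
  set O := Ω ∩ e.source with hO
  have hOo : IsOpen O := hΩ.inter e.open_source
  have hK1 : (1 : ℝ) ≤ K := by exact_mod_cast hK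
  have hε : 0 ≤ ε := (norm_nonneg _).trans (h.gradient_near p h.mem_source)
  have hη0 : 0 ≤ η := by rw [hη]; positivity
  have hγM : |γ| ≤ M := by
    refine (abs_real_inner_le_norm _ _).trans ?_
    rw [h.norm_normal, mul_one]
    exact hM p hp
  -- Every vector `ε`-close to `ν` sees almost the same normal component of `G`: changing the vector
  -- costs `M ε` and freezing `G` at `p` costs `ε`. This is used both for the gradient of `φ` in the
  -- layer and for the outward normal on the boundary.
  have hnear : ∀ x ∈ e.source, x ∈ closure Ω → ∀ v : Space (n + 1), ‖v - ν‖ ≤ ε →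
      |⟪v, G x⟫ - γ| ≤ η := by
    intro x hx hxc v hv
    have e1 : ⟪v, G x⟫ - γ = ⟪v - ν, G x⟫ + ⟪ν, G x - G p⟫ := by
      rw [hγ, inner_sub_left, inner_sub_right, real_inner_comm ν (G p)]; ring
    rw [e1]
    refine (abs_add_le _ _).trans ?_
    have e2 := (abs_real_inner_le_norm (v - ν) (G x)).trans
      (mul_le_mul hv (hM x hxc) (norm_nonneg _) hε)
    have e3 := abs_real_inner_le_norm ν (G x - G p)
    rw [h.norm_normal, one_mul] at e3
    have e4 := e3.trans (hGε x ⟨hx, hxc⟩)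
    rw [hη]; linarith
  have hlayer : ∀ δ : ℝ, 0 < δ →
      ∫ x in Ω ∩ e.source, ψ x * (δ⁻¹ * deriv layerCutoff (-φ x / δ)) * ⟪gradient φ x, G x⟫ ≤
        (γ + η + (M + η) * ((K : ℝ) ^ (n + 1) - 1)) * J δ := by
    intro δ hδ
    obtain ⟨hIi, hI1, hI2⟩ := hI δ hδ
    set I := ∫ x in e.source, ψ x * (δ⁻¹ * deriv layerCutoff (-φ x / δ)) with hIdef
    have hnn : ∀ x, 0 ≤ ψ x * (δ⁻¹ * deriv layerCutoff (-φ x / δ)) := fun x =>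
      mul_nonneg (h0 x) (mul_nonneg (inv_nonneg.2 hδ.le) (deriv_layerCutoff_nonneg _))
    -- The layer lies entirely inside `Ω`: where `φ ≥ 0` the derivative of the cutoff vanishes.
    have hintO : ∫ x in O, ψ x * (δ⁻¹ * deriv layerCutoff (-φ x / δ)) = I := by
      refine (setIntegral_eq_of_subset_of_forall_sdiff_eq_zero e.open_source.measurableSet
        inter_subset_right fun x hx => ?_).symm
      have : 0 ≤ φ x := not_lt.1 fun hlt => hx.2 ⟨(h.mem_iff x hx.1).2 hlt, hx.1⟩
      have h2 : -φ x / δ < 1 := by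
        rw [div_lt_one hδ]; linarith
      rw [deriv_layerCutoff_of_lt h2, mul_zero, mul_zero]
    have hI0 : 0 ≤ I := integral_nonneg hnn
    have hKp : (1 : ℝ) ≤ (K : ℝ) ^ (n + 1) := one_le_pow₀ hK1
    have hJ0 : 0 ≤ J δ := by
      by_contra hneg
      nlinarith [not_le.1 hneg]
    have h1 : ∫ x in O, ψ x * (δ⁻¹ * deriv layerCutoff (-φ x / δ)) * ⟪gradient φ x, G x⟫ ≤
        ∫ x in O, ψ x * (δ⁻¹ * deriv layerCutoff (-φ x / δ)) * (γ + η) := by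
      refine setIntegral_mono_on (h.integral_cutoff_divergence hΩ hG hψ hc hs hδ).2.1
        ((hIi.mono_set inter_subset_right).mul_const _) hOo.measurableSet fun x hx => ?_
      refine mul_le_mul_of_nonneg_left ?_ (hnn x)
      have := (abs_le.1 (hnear x hx.2 (subset_closure hx.1) _ (h.gradient_near x hx.2))).2
      linarith
    rw [integral_mul_const, hintO] at h1
    refine h1.trans ?_
    have hγ' := abs_le.1 hγM
    -- `I` and `J δ` agree up to the factor `q = K ^ (n + 1)` in both directions. The lower bound
    -- uses `1 - 1 / q ≤ q - 1`.
    have hIJ : |I - J δ| ≤ ((K : ℝ) ^ (n + 1) - 1) * J δ := by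
      rw [abs_le]
      constructor
      · by_contra hcon
        nlinarith [mul_nonneg (sub_nonneg.2 hKp) (mul_nonneg (sub_nonneg.2 hKp) hJ0)]
      · linarith
    have h2 : (γ + η) * (I - J δ) ≤ (M + η) * (((K : ℝ) ^ (n + 1) - 1) * J δ) := by
      refine (le_abs_self _).trans ?_
      rw [abs_mul]
      refine mul_le_mul ?_ hIJ (abs_nonneg _) (by linarith)
      rw [abs_le]
      constructor <;> linarith
    nlinarith
  -- As `δ` tends to `0` the cutoff tends to `1` at each point of `Ω`, with a constant as dominating
  -- function.
  have hT : Tendsto (fun δ : ℝ => ∫ x in Ω ∩ e.source, layerCutoff (-φ x / δ) * ⟪gradient ψ x, G x⟫)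
      (𝓝[>] 0) (𝓝 (∫ x in Ω, ⟪gradient ψ x, G x⟫)) := by
    have hgz : ∀ x ∉ tsupport ψ, gradient ψ x = 0 := fun x hx => by
      have : fderiv ℝ ψ x = 0 := by
        by_contra hne
        exact hx (support_fderiv_subset ℝ hne)
      simp [gradient, this]
    rw [setIntegral_eq_of_subset_of_forall_sdiff_eq_zero hΩ.measurableSet
      (inter_subset_left (t := e.source)) fun x hx => by
        rw [hgz x fun hx' => hx.2 ⟨hx.1, hs hx'⟩, inner_zero_left]]
    have cgψ : Continuous (gradient ψ) := by
      rw [← continuousOn_univ]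
      exact continuousOn_gradient isOpen_univ (hψ.of_le (by simp)).contDiffOn
    obtain ⟨C', hC'⟩ := (HasCompactSupport.intro hc.isCompact hgz).exists_bound_of_continuous cgψ
    refine tendsto_integral_filter_of_dominated_convergence (fun _ => C' * M) ?_ ?_ ?_ ?_
    · refine Eventually.of_forall fun δ => ContinuousOn.aestronglyMeasurable ?_ hOo.measurableSet
      have hk' : Continuous layerCutoff := layerCutoff_contDiff.continuous
      have c1 : ContinuousOn φ O := h.contDiffOn.continuousOn.mono inter_subset_right
      have c2 : ContinuousOn G O := hG.continuousOn.mono inter_subset_left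
      fun_prop
    · refine Eventually.of_forall fun δ => (ae_restrict_mem hOo.measurableSet).mono fun x hx => ?_
      rw [norm_mul, Real.norm_of_nonneg (layerCutoff_nonneg _)]
      have e1 := (norm_inner_le_norm (𝕜 := ℝ) (gradient ψ x) (G x)).trans
        (mul_le_mul (hC' x) (hM x (subset_closure hx.1)) (norm_nonneg _)
          ((norm_nonneg _).trans (hC' x)))
      exact (mul_le_of_le_one_left (norm_nonneg _) (layerCutoff_le_one _)).trans e1
    · exact integrableOn_const ((hΩb.subset inter_subset_left).measure_lt_top.ne)
    · refine (ae_restrict_mem hOo.measurableSet).mono fun x hx => ?_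
      have hφx : φ x < 0 := (h.mem_iff x hx.2).1 hx.1
      refine tendsto_const_nhds.congr' ?_
      filter_upwards [Ioo_mem_nhdsGT (show 0 < -φ x / 2 by linarith)] with δ hδ
      have : 2 ≤ -φ x / δ := by
        rw [le_div_iff₀ hδ.1]
        linarith [hδ.2]
      rw [layerCutoff_of_ge this, one_mul]
  -- The part of the compact set `A` seen by `ψ` lies at a positive depth `m`, so for `δ < m / 2`
  -- the cutoff equals `1` there. Working on `A` avoids any assumption that the divergence is
  -- integrable up to the boundary.
  obtain ⟨m, hm0, hm⟩ : ∃ m : ℝ, 0 < m ∧ ∀ x ∈ A ∩ tsupport ψ, φ x ≤ -m := by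
    rcases (A ∩ tsupport ψ).eq_empty_or_nonempty with he | hne
    · exact ⟨1, one_pos, by simp [he]⟩
    · obtain ⟨z, hz, hzm⟩ := (hA.inter_right (isClosed_tsupport ψ)).exists_isMaxOn hne
        (h.contDiffOn.continuousOn.mono fun x hx => hs hx.2)
      exact ⟨-φ z, neg_pos.2 ((h.mem_iff z (hs hz.2)).1 (hAΩ hz.1)), fun x hx => by
        simpa using hzm hx⟩
  have hev : ∀ᶠ δ in 𝓝[>] (0 : ℝ), ∫ x in A, ψ x * divergence G x ≤
      -(∫ x in Ω ∩ e.source, layerCutoff (-φ x / δ) * ⟪gradient ψ x, G x⟫) +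
      (γ + η + (M + η) * ((K : ℝ) ^ (n + 1) - 1)) * J δ := by
    filter_upwards [Ioo_mem_nhdsGT (show 0 < m / 2 by linarith)] with δ hδ
    obtain ⟨j1, j2, j3⟩ := h.integral_cutoff_divergence hΩ hG hψ hc hs hδ.1
    refine le_trans ?_ (add_le_add_right (hlayer δ hδ.1) _)
    rw [← j3]
    have hAm : MeasurableSet (A ∩ tsupport ψ) :=
      hA.measurableSet.inter (isClosed_tsupport ψ).measurableSet
    rw [setIntegral_eq_of_subset_of_forall_sdiff_eq_zero hA.measurableSet
      (inter_subset_left (t := tsupport ψ)) fun x hx => by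
        rw [image_eq_zero_of_notMem_tsupport fun hx' => hx.2 ⟨hx.1, hx'⟩, zero_mul]]
    have e1 : ∫ x in A ∩ tsupport ψ, ψ x * divergence G x =
        ∫ x in A ∩ tsupport ψ, ψ x * layerCutoff (-φ x / δ) * divergence G x := by
      refine setIntegral_congr_fun hAm fun x hx => ?_
      have : 2 ≤ -φ x / δ := by
        rw [le_div_iff₀ hδ.1]
        have := hm x hx
        linarith [hδ.2]
      simp only [layerCutoff_of_ge this, mul_one]
    rw [e1]
    -- Only here is the sign of the divergence needed: enlarging the domain from `A` to the whole
    -- chart can only increase the integral.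
    refine setIntegral_mono_set j1 ?_ (Eventually.of_forall fun x hx => ⟨hAΩ hx.1, hs hx.2⟩)
    refine (ae_restrict_mem hOo.measurableSet).mono fun x hx => ?_
    exact mul_nonneg (mul_nonneg (h0 x) (layerCutoff_nonneg _)) (hdiv x hx.1)
  have hlim := ge_of_tendsto (hT.neg.add (hJ.const_mul
    (γ + η + (M + η) * ((K : ℝ) ^ (n + 1) - 1)))) hev
  have hKn : (1 : ℝ) ≤ (K : ℝ) ^ n := one_le_pow₀ hK1
  have hKn1 : (1 : ℝ) ≤ (K : ℝ) ^ (n + 1) := one_le_pow₀ hK1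
  have hS0 : 0 ≤ S := integral_nonneg h0
  have hJS : |J0 - S| ≤ ((K : ℝ) ^ n - 1) * S := by
    rw [abs_le]
    constructor
    · have : 0 ≤ J0 := by
        by_contra hneg
        nlinarith [not_le.1 hneg]
      by_contra hcon
      nlinarith [mul_nonneg (sub_nonneg.2 hKn) (mul_nonneg (sub_nonneg.2 hKn) hS0)]
    · linarith
  -- On the boundary the frozen normal component `γ` is replaced by the true one, at the cost of
  -- `η`.
  have hγS : γ * S ≤ ∫ x in frontier Ω, ψ x * ⟪G x, outwardNormal Ω x⟫ ∂μHE[n] + η * S := by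
    have : ∫ x in frontier Ω, (γ - η) * ψ x ∂μHE[n] ≤
        ∫ x in frontier Ω, ψ x * ⟪G x, outwardNormal Ω x⟫ ∂μHE[n] := by
      refine setIntegral_mono_on (hSi.const_mul _) hi isClosed_frontier.measurableSet fun x hx => ?_
      by_cases hx' : x ∈ tsupport ψ
      · have := (abs_le.1 (hnear x (hs hx') (frontier_subset_closure hx) _
          (h.normal_near x (hs hx') hx))).1
        rw [mul_comm, real_inner_comm]
        exact mul_le_mul_of_nonneg_left (by linarith) (h0 x)
      · rw [image_eq_zero_of_notMem_tsupport hx', mul_zero, zero_mul]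
    rw [integral_const_mul] at this
    linarith
  have hγJ : γ * (J0 - S) ≤ M * (((K : ℝ) ^ n - 1) * S) := by
    refine (le_abs_self _).trans ?_
    rw [abs_mul]
    exact mul_le_mul hγM hJS (abs_nonneg _) hM0
  have hrest : (η + (M + η) * ((K : ℝ) ^ (n + 1) - 1)) * J0 ≤
      (η + (M + η) * ((K : ℝ) ^ (n + 1) - 1)) * ((K : ℝ) ^ n * S) :=
    mul_le_mul_of_nonneg_left hS2 (by
      have := mul_nonneg (add_nonneg hM0 hη0) (sub_nonneg.2 hKn1)
      linarith)
  rw [hC]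
  linarith

end FluxEstimate

/-! ### Fields with nonnegative divergence and zero flux -/

section Flux

variable {n : ℕ} {Ω : Set (Space (n + 1))}

/-- By compactness local finiteness suffices. A bump function supported in a chart around `p` is
integrable over the boundary, so the set where it is at least `1 / 2`, a neighbourhood of `p`, meets
the boundary in finite measure. -/
theorem IsSmoothBoundedDomain.measure_frontier_lt_top (hΩ : IsSmoothBoundedDomain Ω) :
    μHE[n] (frontier Ω) < ⊤ := by
  have hcomp : IsCompact (frontier Ω) :=
    hΩ.isBounded.isCompact_closure.of_isClosed_subset isClosed_frontier frontier_subset_closure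
  refine hcomp.measure_lt_top_of_nhdsWithin fun p hp => ?_
  obtain ⟨φ, e, -, he⟩ := exists_isFlatteningChart hΩ hp (K := 2) (by norm_num)
    (ε := 1) one_pos univ_mem
  obtain ⟨f, hfs, hfc, hf, hfr, hf1⟩ := exists_contDiff_tsupport_subset (n := ⊤)
    (e.open_source.mem_nhds he.mem_source)
  obtain ⟨_, _, _, hi, _⟩ := he.layer_comparison hf.continuous hfc hfs
    fun x => (hfr (mem_range_self x)).1
  have hlt := hi.measure_norm_ge_lt_top (ε := 1 / 2) (by norm_num)
  have hmeas : MeasurableSet {a | 1 / 2 ≤ ‖f a‖} :=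
    (isClosed_le continuous_const hf.continuous.norm).measurableSet
  rw [Measure.restrict_apply hmeas] at hlt
  refine ⟨{a | 1 / 2 ≤ ‖f a‖} ∩ frontier Ω, inter_mem ?_ self_mem_nhdsWithin, hlt⟩
  refine mem_nhdsWithin_of_mem_nhds ?_
  have : ContinuousAt (fun a => ‖f a‖) p := hf.continuous.norm.continuousAt
  filter_upwards [this.eventually (lt_mem_nhds (show (1 / 2 : ℝ) < ‖f p‖ by rw [hf1]; norm_num))]
    with a ha using le_of_lt ha

theorem IsSmoothBoundedDomain.continuousOn_outwardNormal (hΩ : IsSmoothBoundedDomain Ω) :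
    ContinuousOn (outwardNormal Ω) (frontier Ω) := by
  intro p hp
  rw [ContinuousWithinAt, Metric.tendsto_nhds]
  intro ε hε
  obtain ⟨φ, e, -, he⟩ := exists_isFlatteningChart hΩ hp (K := 2) (by norm_num)
    (half_pos hε) univ_mem
  filter_upwards [mem_nhdsWithin_of_mem_nhds (e.open_source.mem_nhds he.mem_source),
    self_mem_nhdsWithin] with x hx hxf
  rw [dist_eq_norm]
  exact lt_of_le_of_lt (he.normal_near x hx hxf) (half_lt_self hε)

/-- The local divergence inequality on a neighbourhood of each point of the closure. -/
theorem IsSmoothBoundedDomain.exists_nhds_setIntegral_divergence_le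
    (hΩ : IsSmoothBoundedDomain Ω) {G : Space (n + 1) → Space (n + 1)}
    (hGc : ContinuousOn G (closure Ω)) (hG : ContDiffOn ℝ 1 G Ω)
    (hdiv : ∀ x ∈ Ω, 0 ≤ divergence G x) {p : Space (n + 1)} (hp : p ∈ closure Ω)
    {η : ℝ} (hη : 0 < η) :
    ∃ W : Set (Space (n + 1)), IsOpen W ∧ p ∈ W ∧ Bornology.IsBounded W ∧
      ∀ ψ : Space (n + 1) → ℝ, ContDiff ℝ ∞ ψ → HasCompactSupport ψ → tsupport ψ ⊆ W →
        (∀ x, 0 ≤ ψ x) → ∀ A : Set (Space (n + 1)), IsCompact A → A ⊆ Ω →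
        ∫ x in A, ψ x * divergence G x ≤ -(∫ x in Ω, ⟪gradient ψ x, G x⟫) +
          (∫ x in frontier Ω, ψ x * ⟪G x, outwardNormal Ω x⟫ ∂μHE[n]) +
          η * ∫ x in frontier Ω, ψ x ∂μHE[n] := by
  have hcl : IsCompact (closure Ω) := hΩ.isBounded.isCompact_closure
  -- For an interior point, `Ω` itself serves as neighbourhood: the support of `ψ` avoids the
  -- boundary and both surface integrals vanish.
  by_cases hpΩ : p ∈ Ω
  · refine ⟨Ω, hΩ.isOpen, hpΩ, hΩ.isBounded, fun ψ hψ hc hs h0 A hA hAΩ => ?_⟩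
    have hfr : ∀ x ∈ frontier Ω, ψ x = 0 := fun x hx =>
      image_eq_zero_of_notMem_tsupport fun hx' => by
        rw [hΩ.isOpen.frontier_eq] at hx
        exact hx.2 (hs hx')
    have s1 : ∫ x in frontier Ω, ψ x * ⟪G x, outwardNormal Ω x⟫ ∂μHE[n] = 0 :=
      setIntegral_eq_zero_of_forall_eq_zero fun x hx => by rw [hfr x hx, zero_mul]
    have s2 : ∫ x in frontier Ω, ψ x ∂μHE[n] = 0 :=
      setIntegral_eq_zero_of_forall_eq_zero hfr
    rw [s1, s2, mul_zero, add_zero, add_zero]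
    have hgz : ∀ x ∉ tsupport ψ, gradient ψ x = 0 := fun x hx => by
      have : fderiv ℝ ψ x = 0 := by
        by_contra hne
        exact hx (support_fderiv_subset ℝ hne)
      simp [gradient, this]
    have cgψ : Continuous (gradient ψ) := by
      rw [← continuousOn_univ]
      exact continuousOn_gradient isOpen_univ (hψ.of_le (by simp)).contDiffOn
    have hz : ∀ x ∉ tsupport ψ, ψ x = 0 := fun x hx => image_eq_zero_of_notMem_tsupport hx
    have c1 : ContinuousOn (divergence G) (tsupport ψ) :=
      (continuousOn_divergence hΩ.isOpen hG).mono hs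
    have c2 : ContinuousOn G (tsupport ψ) := hG.continuousOn.mono hs
    have c3 := hψ.continuous
    have i1 : IntegrableOn (fun x => ψ x * divergence G x) Ω :=
      integrableOn_of_eq_zero_off_compact hc.isCompact (by fun_prop) fun x hx => by
        rw [hz x hx, zero_mul]
    have i2 : IntegrableOn (fun x => ⟪gradient ψ x, G x⟫) Ω :=
      integrableOn_of_eq_zero_off_compact hc.isCompact (by fun_prop) fun x hx => by
        rw [hgz x hx, inner_zero_left]
    have h1 : ∫ x in Ω, divergence (fun y => ψ y • G y) x = 0 :=
      setIntegral_divergence_eq_zero hΩ.isOpen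
        ((hψ.of_le (by simp)).contDiffOn.smul hG) hc.isCompact hs
        fun x hx => by rw [hz x hx, zero_smul]
    rw [setIntegral_congr_fun hΩ.isOpen.measurableSet fun x hx =>
      divergence_smul (hψ.differentiable (by simp) x)
        ((hG.contDiffAt (hΩ.isOpen.mem_nhds hx)).differentiableAt (by simp)),
      integral_add i1 i2] at h1
    have h2 : ∫ x in A, ψ x * divergence G x ≤ ∫ x in Ω, ψ x * divergence G x :=
      setIntegral_mono_set i1 ((ae_restrict_mem hΩ.isOpen.measurableSet).mono fun x hx =>
        mul_nonneg (h0 x) (hdiv x hx)) (Eventually.of_forall hAΩ)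
    linarith
  · have hpf : p ∈ frontier Ω := by
      rw [hΩ.isOpen.frontier_eq]
      exact ⟨hp, hpΩ⟩
    obtain ⟨M, hM⟩ := hcl.exists_bound_of_continuousOn hGc
    have hM0 : 0 ≤ M := (norm_nonneg _).trans (hM p hp)
    -- The expression is the error constant of the local estimate for a chart with Lipschitz
    -- constant `K = 1 + ε`. It is continuous in `ε` and vanishes at `ε = 0`.
    obtain ⟨ε, hε0, hε⟩ : ∃ ε : ℝ, 0 < ε ∧
        ((M + 1) * ε + M * ((1 + ε) ^ n - 1) +
          ((M + 1) * ε + (M + (M + 1) * ε) * ((1 + ε) ^ (n + 1) - 1)) * (1 + ε) ^ n) < η := by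
      have hcont : Continuous fun ε : ℝ => (M + 1) * ε + M * ((1 + ε) ^ n - 1) +
          ((M + 1) * ε + (M + (M + 1) * ε) * ((1 + ε) ^ (n + 1) - 1)) * (1 + ε) ^ n := by
        fun_prop
      have h2 := (hcont.tendsto 0).eventually_lt_const (u := η) (by simpa using hη)
      have h3 := h2.filter_mono (nhdsWithin_le_nhds (s := Ioi 0))
      obtain ⟨ε, h4, h5⟩ := (h3.and self_mem_nhdsWithin).exists
      exact ⟨ε, h5, h4⟩
    have hW : {x | x ∈ closure Ω → ‖G x - G p‖ ≤ ε} ∈ 𝓝 p := by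
      have := (hGc p hp).eventually (Metric.closedBall_mem_nhds (G p) hε0)
      rw [eventually_nhdsWithin_iff] at this
      filter_upwards [this] with x hx hxc
      simpa [dist_eq_norm] using hx hxc
    obtain ⟨φ, e, hes, he⟩ := exists_isFlatteningChart hΩ hpf (K := 1 + ε.toNNReal)
      (by simpa using hε0) hε0 (inter_mem hW (Metric.ball_mem_nhds p one_pos))
    refine ⟨e.source, e.open_source, he.mem_source,
      Metric.isBounded_ball.subset fun x hx => (hes hx).2, fun ψ hψ hc hs h0 A hA hAΩ => ?_⟩
    have hi : IntegrableOn (fun x => ψ x * ⟪G x, outwardNormal Ω x⟫) (frontier Ω) μHE[n] := by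
      have hfc : IsCompact (frontier Ω) :=
        hcl.of_isClosed_subset isClosed_frontier frontier_subset_closure
      have c1 := hΩ.continuousOn_outwardNormal
      have c2 := hGc.mono frontier_subset_closure
      have c3 := hψ.continuous
      have c4 : ContinuousOn (fun x => ψ x * ⟪G x, outwardNormal Ω x⟫) (frontier Ω) := by fun_prop
      obtain ⟨B, hB⟩ := hfc.exists_bound_of_continuousOn c4
      exact IntegrableOn.of_bound hΩ.measure_frontier_lt_top
        (c4.aestronglyMeasurable isClosed_frontier.measurableSet) B
        ((ae_restrict_mem isClosed_frontier.measurableSet).mono hB)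
    have hKc : ((1 + ε.toNNReal : ℝ≥0) : ℝ) = 1 + ε := by
      rw [NNReal.coe_add, Real.coe_toNNReal _ hε0.le, NNReal.coe_one]
    refine (he.setIntegral_divergence_le hΩ.isOpen hΩ.isBounded (by simp) hG hdiv hM0 hM
      (fun x hx => (hes hx.1).1 hx.2) hp hψ hc hs h0 hA hAΩ hi rfl rfl).trans ?_
    rw [hKc]
    have := mul_le_mul_of_nonneg_right hε.le
      (integral_nonneg h0 : 0 ≤ ∫ x in frontier Ω, ψ x ∂μHE[n])
    linarith

/-- If the divergence of a vector field is nonnegative and its flux through the boundary vanishes,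
then its divergence vanishes. -/
theorem IsSmoothBoundedDomain.divergence_eq_zero_of_surfaceFlux_eq_zero
    (hΩ : IsSmoothBoundedDomain Ω) {G : Space (n + 1) → Space (n + 1)}
    (hGc : ContinuousOn G (closure Ω)) (hG : ContDiffOn ℝ 1 G Ω)
    (hdiv : ∀ x ∈ Ω, 0 ≤ divergence G x) (hflux : surfaceFlux Ω G = 0) {x : Space (n + 1)}
    (hx : x ∈ Ω) : divergence G x = 0 := by
  have hcl : IsCompact (closure Ω) := hΩ.isBounded.isCompact_closure
  have hfc : IsCompact (frontier Ω) :=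
    hcl.of_isClosed_subset isClosed_frontier frontier_subset_closure
  have hint : ∀ f : Space (n + 1) → ℝ, ContinuousOn f (frontier Ω) →
      IntegrableOn f (frontier Ω) μHE[n] := by
    intro f hf
    obtain ⟨B, hB⟩ := hfc.exists_bound_of_continuousOn hf
    exact IntegrableOn.of_bound hΩ.measure_frontier_lt_top
      (hf.aestronglyMeasurable isClosed_frontier.measurableSet) B
      ((ae_restrict_mem isClosed_frontier.measurableSet).mono hB)
  -- The local inequalities are summed over a partition of unity on the closure of `Ω`: the
  -- gradients of the partition add up to zero, the boundary terms add up to the flux, which is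
  -- zero, and only the error `η` times the boundary measure survives.
  have key : ∀ A : Set (Space (n + 1)), IsCompact A → A ⊆ Ω → ∀ η : ℝ, 0 < η →
      ∫ x in A, divergence G x ≤ η * (μHE[n]).real (frontier Ω) := by
    intro A hA hAΩ η hη
    choose! W hWo hpW hWb hW using fun p (hp : p ∈ closure Ω) =>
      hΩ.exists_nhds_setIntegral_divergence_le hGc hG hdiv hp hη
    obtain ⟨t, ht, htc⟩ := hcl.elim_nhds_subcover W fun p hp => (hWo p hp).mem_nhds (hpW p hp)
    obtain ⟨f, hf⟩ := SmoothPartitionOfUnity.exists_isSubordinate 𝓘(ℝ, Space (n + 1))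
      (isClosed_closure (s := Ω)) (fun i : t => W i) (fun i => hWo _ (ht _ i.2)) (by
        intro y hy
        obtain ⟨i, hi, hyi⟩ := mem_iUnion₂.1 (htc hy)
        exact mem_iUnion.2 ⟨⟨i, hi⟩, hyi⟩)
    have hfs : ∀ i, ContDiff ℝ ∞ (f i) := fun i => (f i).contMDiff.contDiff
    have hfsum : ∀ y ∈ closure Ω, ∑ i, f i y = 1 := fun y hy => by
      rw [← finsum_eq_sum_of_fintype]
      exact f.sum_eq_one hy
    have hfcs : ∀ i, HasCompactSupport (f i) := fun i =>
      (hWb _ (ht _ i.2)).isCompact_closure.of_isClosed_subset (isClosed_tsupport _)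
        ((hf i).trans subset_closure)
    have hsum := Finset.sum_le_sum fun (i : t) (_ : i ∈ Finset.univ) =>
      hW i (ht _ i.2) (f i) (hfs i) (hfcs i) (hf i) (fun y => f.nonneg i y) A hA hAΩ
    simp only [Finset.sum_add_distrib, Finset.sum_neg_distrib, ← Finset.mul_sum] at hsum
    have c0 : ∀ i, Continuous (f i) := fun i => (hfs i).continuous
    have cgψ : ∀ i, Continuous (gradient (f i)) := fun i => by
      rw [← continuousOn_univ]
      exact continuousOn_gradient isOpen_univ ((hfs i).of_le (by simp)).contDiffOn
    have cn := hΩ.continuousOn_outwardNormal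
    have cG := hGc.mono frontier_subset_closure
    have e1 : ∑ i, ∫ x in A, f i x * divergence G x = ∫ x in A, divergence G x := by
      rw [← integral_finsetSum]
      · refine setIntegral_congr_fun hA.measurableSet fun y hy => ?_
        simp only [← Finset.sum_mul, hfsum y (subset_closure (hAΩ hy)), one_mul]
      · intro i _
        have := (continuousOn_divergence hΩ.isOpen hG).mono hAΩ
        have := c0 i
        have h1 : ContinuousOn (fun x => f i x * divergence G x) A := by fun_prop
        exact h1.integrableOn_compact hA
    have e2 : ∑ i, ∫ x in Ω, ⟪gradient (f i) x, G x⟫ = 0 := by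
      rw [← integral_finsetSum]
      · refine setIntegral_eq_zero_of_forall_eq_zero fun y hy => ?_
        rw [← sum_inner]
        have h1 : HasFDerivAt (fun z => ∑ i, f i z) (∑ i, fderiv ℝ (f i) y) y :=
          HasFDerivAt.fun_sum fun i _ => ((hfs i).differentiable (by simp) y).hasFDerivAt
        have h2 : HasFDerivAt (fun z => ∑ i, f i z) (0 : Space (n + 1) →L[ℝ] ℝ) y := by
          refine (hasFDerivAt_const (1 : ℝ) y).congr_of_eventuallyEq ?_
          filter_upwards [hΩ.isOpen.mem_nhds hy] with z hz using hfsum z (subset_closure hz)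
        have h3 : ∑ i, gradient (f i) y = 0 := by
          simp only [gradient, ← map_sum, h1.unique h2, map_zero]
        rw [h3, inner_zero_left]
      · intro i _
        have := cgψ i
        have h1 : ContinuousOn (fun x => ⟪gradient (f i) x, G x⟫) (closure Ω) := by fun_prop
        exact (h1.integrableOn_compact hcl).mono_set subset_closure
    have e3 : ∑ i, ∫ x in frontier Ω, f i x * ⟪G x, outwardNormal Ω x⟫ ∂μHE[n] = 0 := by
      rw [← integral_finsetSum]
      · refine Eq.trans ?_ hflux
        refine setIntegral_congr_fun isClosed_frontier.measurableSet fun y hy => ?_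
        simp only [← Finset.sum_mul, hfsum y (frontier_subset_closure hy), one_mul]
      · intro i _
        have := c0 i
        exact hint _ (by fun_prop)
    have e4 : ∑ i, ∫ x in frontier Ω, f i x ∂μHE[n] = (μHE[n]).real (frontier Ω) := by
      rw [← integral_finsetSum]
      · rw [setIntegral_congr_fun isClosed_frontier.measurableSet fun y hy =>
          hfsum y (frontier_subset_closure hy)]
        simp
      · intro i _
        exact hint _ (c0 i).continuousOn
    rw [e1, e2, e3, e4] at hsum
    linarith
  by_contra hne
  have hpos : 0 < divergence G x := lt_of_le_of_ne (hdiv x hx) (Ne.symm hne)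
  have hc := (continuousOn_divergence hΩ.isOpen hG).continuousAt (hΩ.isOpen.mem_nhds hx)
  obtain ⟨r, hr, hball⟩ := Metric.nhds_basis_closedBall.mem_iff.1
    (inter_mem (hΩ.isOpen.mem_nhds hx)
      (hc.eventually (lt_mem_nhds (show divergence G x / 2 < divergence G x by linarith))))
  have hA : IsCompact (Metric.closedBall x r) := isCompact_closedBall x r
  have hAΩ : Metric.closedBall x r ⊆ Ω := fun y hy => (hball hy).1
  have hvol : 0 < (volume : Measure (Space (n + 1))).real (Metric.closedBall x r) :=
    ENNReal.toReal_pos (Metric.measure_closedBall_pos volume x hr).ne' measure_closedBall_lt_top.ne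
  have hlow : divergence G x / 2 * (volume : Measure (Space (n + 1))).real (Metric.closedBall x r) ≤
      ∫ y in Metric.closedBall x r, divergence G y := by
    have : ∫ y in Metric.closedBall x r, divergence G x / 2 ≤
        ∫ y in Metric.closedBall x r, divergence G y :=
      setIntegral_mono_on (integrableOn_const measure_closedBall_lt_top.ne)
        (((continuousOn_divergence hΩ.isOpen hG).mono hAΩ).integrableOn_compact hA)
        hA.measurableSet fun y hy => le_of_lt (hball hy).2
    simpa [mul_comm] using this
  set H := (μHE[n]).real (frontier Ω) with hH
  have hH0 : 0 ≤ H := measureReal_nonneg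
  have hprod : 0 < divergence G x / 2 *
      (volume : Measure (Space (n + 1))).real (Metric.closedBall x r) := by positivity
  -- If `c > 0` is the lower bound on the integral over the ball and `H` the boundary measure, then
  -- `η = c / (2 (H + 1))` gives `η H < c`. The summand `1` covers `H = 0`.
  have := key _ hA hAΩ (divergence G x / 2 *
      (volume : Measure (Space (n + 1))).real (Metric.closedBall x r) / (2 * (H + 1)))
    (by positivity)
  have h2 : divergence G x / 2 * (volume : Measure (Space (n + 1))).real (Metric.closedBall x r) /
      (2 * (H + 1)) * H < divergence G x / 2 *
      (volume : Measure (Space (n + 1))).real (Metric.closedBall x r) := by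
    rw [div_mul_eq_mul_div, div_lt_iff₀ (by positivity)]
    nlinarith
  linarith

end Flux

/-! ### Weak identities in the position of a single particle -/

section Slices

variable {d : ℕ} {Ω A : Set (Space d)}

theorem gradient_sub {f g : Space d → ℝ} {x : Space d}
    (hf : DifferentiableAt ℝ f x) (hg : DifferentiableAt ℝ g x) :
    gradient (fun y => f y - g y) x = gradient f x - gradient g x := by
  simp [gradient, fderiv_fun_sub hf hg]

theorem gradient_sub_const {f : Space d → ℝ} {x : Space d} (c : ℝ) :
    gradient (fun y => f y - c) x = gradient f x := by
  simp [gradient, fderiv_sub_const]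

theorem gradient_eq_zero_of_eventually {φ : Space d → ℝ} (hA : IsClosed A)
    (h : ∀ z ∉ A, φ z = 0) {z : Space d} (hz : z ∉ A) : gradient φ z = 0 := by
  have : φ =ᶠ[𝓝 z] fun _ => 0 := by
    filter_upwards [hA.isOpen_compl.mem_nhds hz] with y hy using h y hy
  simp [gradient, this.fderiv_eq]

/-- The weak form, in the position of a single particle, of the difference of two Smoluchowski
operators. -/
theorem setIntegral_smoluchowski_difference (hΩ : IsOpen Ω) (hA : IsCompact A) (hAΩ : A ⊆ Ω)
    {φ : Space d → ℝ} (hφ : ContDiff ℝ ∞ φ) (hφA : ∀ z ∉ A, φ z = 0)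
    {p p' v v' : Space d → ℝ} {H : Space d → Space d} (hp : ContDiffOn ℝ 2 p Ω)
    (hp' : ContDiffOn ℝ 2 p' Ω) (hv : ContDiffOn ℝ 2 v Ω) (hv' : ContDiffOn ℝ 2 v' Ω)
    (hH : ContDiffOn ℝ 1 H Ω) (β c : ℝ) :
    ∫ z in Ω, (φ z * (divergence (fun y => gradient p y - (β * p y) • (-gradient v y + H y)) z -
        divergence (fun y => gradient p' y - (β * p' y) • (-gradient v' y + H y)) z) -
      ((p z - p' z) * (divergence (gradient φ) z + β * ⟪gradient φ z, H z - gradient v z⟫) +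
        β * ((v z - v' z - c) *
          (⟪gradient p' z, gradient φ z⟫ + p' z * divergence (gradient φ) z)))) = 0 := by
  have one_le : (1 : ℕ∞ω) ≤ 2 := by norm_num
  have gp := gradient_contDiffOn (m := 1) hΩ hp (by norm_num)
  have gp' := gradient_contDiffOn (m := 1) hΩ hp' (by norm_num)
  have gv := gradient_contDiffOn (m := 1) hΩ hv (by norm_num)
  have gv' := gradient_contDiffOn (m := 1) hΩ hv' (by norm_num)
  have gφ : ContDiffOn ℝ 1 (gradient φ) Ω :=
    gradient_contDiffOn (m := 1) hΩ (contDiff_infty.1 hφ 2).contDiffOn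
      (by norm_num)
  have hp1 := hp.of_le one_le
  have hp1' := hp'.of_le one_le
  have hv1 := hv.of_le one_le
  have hv1' := hv'.of_le one_le
  have hφ1 : ContDiffOn ℝ 1 φ Ω := (hφ.of_le (by simp)).contDiffOn
  have cb : ContDiffOn ℝ 1 (fun y => gradient p y - (β * p y) • (-gradient v y + H y)) Ω := by
    fun_prop
  have cb' : ContDiffOn ℝ 1 (fun y => gradient p' y - (β * p' y) • (-gradient v' y + H y)) Ω := by
    fun_prop
  set b := fun y => gradient p y - (β * p y) • (-gradient v y + H y) with hb
  set b' := fun y => gradient p' y - (β * p' y) • (-gradient v' y + H y) with hb'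
  -- The integrand is the divergence of this compactly supported field. The constant `c` is free
  -- because the potentials enter the brackets through their gradients only.
  have cX : ContDiffOn ℝ 1 (fun y => (φ y • (b y - b' y) - (p y - p' y) • gradient φ y) -
      (β * ((v y - v' y - c) * p' y)) • gradient φ y) Ω := by fun_prop
  refine Eq.trans ?_ (setIntegral_divergence_eq_zero hΩ cX hA hAΩ fun x hx => by
    rw [hφA x hx, gradient_eq_zero_of_eventually hA.isClosed hφA hx]; simp)
  refine setIntegral_congr_fun hΩ.measurableSet fun z hz => ?_
  have D : ∀ {F : Type} [NormedAddCommGroup F] [NormedSpace ℝ F] {f : Space d → F},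
      ContDiffOn ℝ 1 f Ω → DifferentiableAt ℝ f z := fun h =>
    (h.contDiffAt (hΩ.mem_nhds hz)).differentiableAt (by simp)
  have dp := D hp1
  have dp' := D hp1'
  have dv := D hv1
  have dv' := D hv1'
  have dφ := D hφ1
  have dgφ := D gφ
  have dδ : DifferentiableAt ℝ (fun y => v y - v' y - c) z := (dv.sub dv').sub_const c
  have dδp : DifferentiableAt ℝ (fun y => (v y - v' y - c) * p' y) z := dδ.mul dp'
  have dβ : DifferentiableAt ℝ (fun y => β * ((v y - v' y - c) * p' y)) z := dδp.const_mul β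
  have dq : DifferentiableAt ℝ (fun y => p y - p' y) z := dp.sub dp'
  have db : DifferentiableAt ℝ (fun y => b y - b' y) z := (D cb).sub (D cb')
  have dT1 : DifferentiableAt ℝ (fun y => φ y • (b y - b' y)) z := dφ.smul db
  have dT2 : DifferentiableAt ℝ (fun y => (p y - p' y) • gradient φ y) z := dq.smul dgφ
  have dT3 : DifferentiableAt ℝ
    (fun y => (β * ((v y - v' y - c) * p' y)) • gradient φ y) z := dβ.smul dgφ
  have dT12 : DifferentiableAt ℝ
    (fun y => φ y • (b y - b' y) - (p y - p' y) • gradient φ y) z := dT1.sub dT2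
  rw [divergence_sub dT12 dT3, divergence_sub dT1 dT2, divergence_smul dφ db,
    divergence_sub (D cb) (D cb'), divergence_smul dq dgφ, divergence_smul dβ dgφ,
    gradient_sub dp dp', gradient_const_mul, gradient_mul dδ dp', gradient_sub_const,
    gradient_sub dv dv']
  simp only [hb, hb', inner_sub_right, inner_sub_left, inner_add_left, inner_add_right,
    inner_neg_right, real_inner_smul_left, real_inner_smul_right]
  rw [real_inner_comm (gradient p z) (gradient φ z), real_inner_comm (gradient p' z) (gradient φ z),
    real_inner_comm (gradient v z) (gradient φ z), real_inner_comm (gradient v' z) (gradient φ z)]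
  ring

/-- The integrand is the divergence of the compactly supported field `(f - c) p ∇φ`. -/
theorem setIntegral_weighted_laplacian (hΩ : IsOpen Ω) (hA : IsCompact A) (hAΩ : A ⊆ Ω)
    {φ : Space d → ℝ} (hφ : ContDiff ℝ ∞ φ) (hφA : ∀ z ∉ A, φ z = 0)
    {p f : Space d → ℝ} (hp : ContDiffOn ℝ 1 p Ω) (hf : ContDiffOn ℝ 1 f Ω) (c : ℝ) :
    ∫ z in Ω, ((f z - c) * (⟪gradient p z, gradient φ z⟫ + p z * divergence (gradient φ) z) +
      p z * ⟪gradient φ z, gradient f z⟫) = 0 := by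
  have gφ : ContDiffOn ℝ 1 (gradient φ) Ω :=
    gradient_contDiffOn (m := 1) hΩ (contDiff_infty.1 hφ 2).contDiffOn
      (by norm_num)
  have cX : ContDiffOn ℝ 1 (fun y => ((f y - c) * p y) • gradient φ y) Ω := by fun_prop
  refine Eq.trans ?_ (setIntegral_divergence_eq_zero hΩ cX hA hAΩ fun x hx => by
    rw [gradient_eq_zero_of_eventually hA.isClosed hφA hx]; simp)
  refine setIntegral_congr_fun hΩ.measurableSet fun z hz => ?_
  have D : ∀ {F : Type} [NormedAddCommGroup F] [NormedSpace ℝ F] {f : Space d → F},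
      ContDiffOn ℝ 1 f Ω → DifferentiableAt ℝ f z := fun h =>
    (h.contDiffAt (hΩ.mem_nhds hz)).differentiableAt (by simp)
  have df : DifferentiableAt ℝ (fun y => f y - c) z := (D hf).sub_const c
  have dfp : DifferentiableAt ℝ (fun y => (f y - c) * p y) z := df.mul (D hp)
  rw [divergence_smul dfp (D gφ), gradient_mul df (D hp), gradient_sub_const]
  simp only [inner_add_left, real_inner_smul_left]
  rw [real_inner_comm (gradient f z) (gradient φ z)]
  ring

end Slices

/-! ### Integration over configuration space -/

section Fubini

variable {d M : ℕ} {Ω : Set (Space d)}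

theorem isOpen_configSpace (hΩ : IsOpen Ω) (n : ℕ) : IsOpen (configSpace Ω n) :=
  isOpen_set_pi finite_univ fun _ _ => hΩ

theorem update_mem_configSpace {n : ℕ} {x : Config n d} (hx : x ∈ configSpace Ω n) (i : Fin n)
    {z : Space d} (hz : z ∈ Ω) : Function.update x i z ∈ configSpace Ω n := by
  intro j _
  by_cases hj : j = i
  · subst hj
    simpa using hz
  · simpa [hj] using hx j trivial

theorem insertNth_mem_configSpace_iff (i : Fin (M + 1)) (z : Space d) (y : Config M d) :
    (i.insertNth z y : Config (M + 1) d) ∈ configSpace Ω (M + 1) ↔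
      z ∈ Ω ∧ y ∈ configSpace Ω M := by
  simp only [configSpace, mem_univ_pi]
  rw [Fin.forall_iff_succAbove i]
  simp

theorem configSpace_measure_lt_top (hΩ : Bornology.IsBounded Ω) (n : ℕ) :
    volume (configSpace Ω n) < ⊤ := by
  rw [configSpace, volume_pi_pi]
  exact ENNReal.prod_lt_top fun _ _ => hΩ.measure_lt_top

/-- Singling out the position of particle `i` in an integral over configuration space. -/
theorem setIntegral_configSpace_insertNth (i : Fin (M + 1))
    (f : Config (M + 1) d → ℝ) :
    (IntegrableOn f (configSpace Ω (M + 1)) →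
      IntegrableOn (fun q : Space d × Config M d => f (i.insertNth q.1 q.2 : Config (M + 1) d))
        (Ω ×ˢ configSpace Ω M)) ∧
    ∫ x in configSpace Ω (M + 1), f x =
      ∫ q in Ω ×ˢ configSpace Ω M, f (i.insertNth q.1 q.2 : Config (M + 1) d) := by
  have hmp := (volume_preserving_piFinSuccAbove (fun _ : Fin (M + 1) => Space d) i).symm
  have hme := (MeasurableEquiv.piFinSuccAbove
    (fun _ : Fin (M + 1) => Space d) i).symm.measurableEmbedding
  have hpre : (MeasurableEquiv.piFinSuccAbove (fun _ : Fin (M + 1) => Space d) i).symm ⁻¹'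
      configSpace Ω (M + 1) = Ω ×ˢ configSpace Ω M := by
    ext q
    exact insertNth_mem_configSpace_iff i q.1 q.2
  constructor
  · intro hf
    rw [← hpre]
    exact (hmp.integrableOn_comp_preimage hme).2 hf
  · rw [← hpre]
    exact (hmp.setIntegral_preimage_emb hme f _).symm

theorem update_insertNth_self (i : Fin (M + 1)) (z z' : Space d) (y : Config M d) :
    Function.update (i.insertNth z y : Config (M + 1) d) i z' = i.insertNth z' y := by
  ext1 j
  refine Fin.succAboveCases i ?_ (fun k => ?_) j <;> simp

/-- An integral over configuration space vanishes if the integral over the position of one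
particle does. -/
theorem setIntegral_configSpace_eq_zero {N : ℕ} {f : Config N d → ℝ}
    (hf : IntegrableOn f (configSpace Ω N)) (i : Fin N)
    (h : ∀ x ∈ configSpace Ω N, ∫ z in Ω, f (Function.update x i z) = 0) :
    ∫ x in configSpace Ω N, f x = 0 := by
  obtain ⟨M, rfl⟩ : ∃ M, N = M + 1 := ⟨N - 1, by have := i.2; omega⟩
  obtain ⟨h1, h2⟩ := setIntegral_configSpace_insertNth (Ω := Ω) i f
  rw [h2]
  have h3 := h1 hf
  rw [IntegrableOn, Measure.volume_eq_prod, ← Measure.prod_restrict] at h3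
  rw [Measure.volume_eq_prod, ← Measure.prod_restrict, integral_prod_symm _ h3]
  refine setIntegral_eq_zero_of_forall_eq_zero fun y hy => ?_
  -- A point of `Ω` is needed to complete `y` to a configuration. Its choice is irrelevant, since
  -- this entry is overwritten.
  rcases Ω.eq_empty_or_nonempty with he | ⟨z₀, hz₀⟩
  · simp [he]
  · have := h (i.insertNth z₀ y : Config (M + 1) d)
      ((insertNth_mem_configSpace_iff i z₀ y).2 ⟨hz₀, hy⟩)
    simpa only [update_insertNth_self] using this

/-- Integrals over configuration space as iterated integrals, with the first particle outermost. -/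
theorem setIntegral_configSpace_cons {f : Config (M + 1) d → ℝ}
    (hf : IntegrableOn f (configSpace Ω (M + 1))) :
    ∫ x in configSpace Ω (M + 1), f x =
      ∫ z in Ω, ∫ y in configSpace Ω M, f (Fin.cons z y : Config (M + 1) d) := by
  obtain ⟨h1, h2⟩ := setIntegral_configSpace_insertNth (Ω := Ω) 0 f
  rw [h2]
  have h3 := h1 hf
  rw [IntegrableOn, Measure.volume_eq_prod, ← Measure.prod_restrict] at h3
  rw [Measure.volume_eq_prod, ← Measure.prod_restrict, integral_prod _ h3]
  simp only [Fin.insertNth_zero']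

end Fubini

/-! ### Derivatives in the position of one particle -/

section ConfigCalculus

variable {d n : ℕ} {Ω : Set (Space d)}

/-- The inclusion of displacements of particle `i` into displacements of configurations. -/
noncomputable def particleInclusion (i : Fin n) : Space d →L[ℝ] Config n d :=
  .pi (Pi.single i (.id ℝ (Space d)))

theorem hasFDerivAt_update_self (i : Fin n) (x : Config n d) :
    HasFDerivAt (Function.update x i) (particleInclusion i) (x i) :=
  hasFDerivAt_update x (x i)

/-- The chain rule. Written through the full derivative, the partial gradient inherits regularity
jointly in all positions. -/
theorem gradAt_eq {f : Config n d → ℝ} {x : Config n d} (i : Fin n)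
    (hf : DifferentiableAt ℝ f x) :
    gradAt i f x =
      (InnerProductSpace.toDual ℝ (Space d)).symm ((fderiv ℝ f x).comp (particleInclusion i)) := by
  have h1 : HasFDerivAt f (fderiv ℝ f x) (Function.update x i (x i)) := by
    rw [Function.update_eq_self]; exact hf.hasFDerivAt
  have h2 := h1.comp (x i) (hasFDerivAt_update_self i x)
  rw [gradAt, gradient]
  congr 1
  exact h2.fderiv

theorem divAt_eq {F : Config n d → Space d} {x : Config n d} (i : Fin n)
    (hF : DifferentiableAt ℝ F x) :
    divAt i F x =
      ∑ j : Fin d, (fderiv ℝ F x (particleInclusion i (EuclideanSpace.single j 1))) j := by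
  have h1 : HasFDerivAt F (fderiv ℝ F x) (Function.update x i (x i)) := by
    rw [Function.update_eq_self]; exact hF.hasFDerivAt
  have h2 := h1.comp (x i) (hasFDerivAt_update_self i x)
  rw [divAt, divergence]
  refine Finset.sum_congr rfl fun j _ => ?_
  have h3 : fderiv ℝ (fun z => F (Function.update x i z)) (x i) =
    (fderiv ℝ F x).comp (particleInclusion i) := h2.fderiv
  rw [h3]
  rfl

theorem gradAt_contDiffOn {f : Config n d → ℝ} {S : Set (Config n d)} (hS : IsOpen S)
    {m k : ℕ∞ω} (hf : ContDiffOn ℝ k f S) (hmk : m + 1 ≤ k) (i : Fin n) :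
    ContDiffOn ℝ m (gradAt i f) S := by
  have hk : (1 : ℕ∞ω) ≤ k := le_trans (by simp) hmk
  have h1 : ContDiffOn ℝ m (fun x => (InnerProductSpace.toDual ℝ (Space d)).symm
      ((fderiv ℝ f x).comp (particleInclusion i))) S :=
    (InnerProductSpace.toDual ℝ (Space d)).symm.toContinuousLinearEquiv.contDiff.comp_contDiffOn
      ((hf.fderiv_of_isOpen hS hmk).clm_comp contDiffOn_const)
  refine h1.congr fun x hx => gradAt_eq i ?_
  exact (hf.contDiffAt (hS.mem_nhds hx)).differentiableAt
    (by rintro rfl; simp at hk)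

theorem continuousOn_divAt {F : Config n d → Space d} {S : Set (Config n d)} (hS : IsOpen S)
    (hF : ContDiffOn ℝ 1 F S) (i : Fin n) : ContinuousOn (divAt i F) S := by
  have h1 := hF.continuousOn_fderiv_of_isOpen hS le_rfl
  have h2 : ContinuousOn (fun x => ∑ j : Fin d,
      (fderiv ℝ F x (particleInclusion i (EuclideanSpace.single j 1))) j) S := by
    fun_prop
  exact h2.congr fun x hx => divAt_eq i
    ((hF.contDiffAt (hS.mem_nhds hx)).differentiableAt (by simp))

theorem contDiffOn_slice {F : Type*} [NormedAddCommGroup F] [NormedSpace ℝ F]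
    {f : Config n d → F} {k : ℕ∞ω} (hf : ContDiffOn ℝ k f (configSpace Ω n)) {x : Config n d}
    (hx : x ∈ configSpace Ω n) (i : Fin n) :
    ContDiffOn ℝ k (fun z => f (Function.update x i z)) Ω :=
  hf.comp (contDiff_update k x i).contDiffOn fun _ hz => update_mem_configSpace hx i hz

theorem gradAt_update (f : Config n d → ℝ) (x : Config n d) (i : Fin n) (z : Space d) :
    gradAt i f (Function.update x i z) = gradient (fun z' => f (Function.update x i z')) z := by
  simp [gradAt]

theorem divAt_update (F : Config n d → Space d) (x : Config n d) (i : Fin n) (z : Space d) :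
    divAt i F (Function.update x i z) = divergence (fun z' => F (Function.update x i z')) z := by
  simp [divAt]

theorem divAt_gradAt_update (f : Config n d → ℝ) (x : Config n d) (i : Fin n) (z : Space d) :
    divAt i (gradAt i f) (Function.update x i z) =
      divergence (gradient fun z' => f (Function.update x i z')) z := by
  rw [divAt_update]
  simp_rw [gradAt_update]

end ConfigCalculus

/-! ### Regularity in space and time -/

section SpaceTime

variable {X F : Type*} [NormedAddCommGroup X] [NormedSpace ℝ X]
  [NormedAddCommGroup F] [NormedSpace ℝ F] {S : Set X} {f : X → ℝ → F} {k : ℕ}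

theorem ContDiffSpaceTime.slice (h : ContDiffSpaceTime k S f) {t : ℝ} (ht : 0 ≤ t) :
    ContDiffOn ℝ k (fun x => f x t) S :=
  ContDiffOn.comp h (contDiff_id.prodMk contDiff_const).contDiffOn fun _ hx => ⟨hx, ht⟩

theorem ContDiffSpaceTime.contDiffOn_time (h : ContDiffSpaceTime k S f) {x : X} (hx : x ∈ S) :
    ContDiffOn ℝ k (f x) (Ici 0) :=
  ContDiffOn.comp (g := fun p : X × ℝ => f p.1 p.2) (f := fun t => (x, t)) h
    (contDiff_const.prodMk contDiff_id).contDiffOn fun _ ht => ⟨hx, ht⟩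

theorem ContDiffSpaceTime.continuousOn (h : ContDiffSpaceTime k S f) :
    ContinuousOn (fun p : X × ℝ => f p.1 p.2) (S ×ˢ Ici 0) :=
  ContDiffOn.continuousOn h

/-- The spatial derivative of a function that is `C¹` on space-time is continuous on space-time. -/
theorem ContDiffSpaceTime.continuousOn_fderiv (hS : IsOpen S) (h : ContDiffSpaceTime k S f)
    (hk : 1 ≤ k) : ContinuousOn (fun p : X × ℝ => fderiv ℝ (fun x => f x p.2) p.1)
      (S ×ˢ Ici 0) := by
  have h1 : ContDiffOn ℝ 1 (fun p : X × ℝ => f p.1 p.2) (S ×ˢ Ici 0) :=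
    ContDiffOn.of_le h (by exact_mod_cast hk)
  have h2 := h1.continuousOn_fderivWithin (hS.uniqueDiffOn.prod (uniqueDiffOn_Ici 0)) le_rfl
  have h3 : ContinuousOn (fun p : X × ℝ => (fderivWithin ℝ (fun p : X × ℝ => f p.1 p.2)
      (S ×ˢ Ici 0) p).comp (ContinuousLinearMap.inl ℝ X ℝ)) (S ×ˢ Ici 0) :=
    h2.clm_comp continuousOn_const
  refine h3.congr fun p hp => ?_
  have h4 := ((h1 p hp).differentiableWithinAt (by simp)).hasFDerivWithinAt
  have h5 : HasFDerivWithinAt (fun x : X => (x, p.2)) (ContinuousLinearMap.inl ℝ X ℝ) S p.1 :=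
    (hasFDerivAt_prodMk_left p.1 p.2).hasFDerivWithinAt
  have h6 := HasFDerivWithinAt.comp (t := S ×ˢ Ici 0) p.1 h4 h5 fun x hx => ⟨hx, hp.2⟩
  exact (h6.hasFDerivAt (hS.mem_nhds hp.1)).fderiv

end SpaceTime

section Gradients

variable {d n : ℕ} {k : ℕ}

theorem ContDiffSpaceTime.continuousOn_gradient {S : Set (Space d)} {f : Space d → ℝ → ℝ}
    (hS : IsOpen S) (h : ContDiffSpaceTime k S f) (hk : 1 ≤ k) :
    ContinuousOn (fun p : Space d × ℝ => gradient (fun x => f x p.2) p.1) (S ×ˢ Ici 0) :=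
  (InnerProductSpace.toDual ℝ (Space d)).symm.continuous.comp_continuousOn
    (h.continuousOn_fderiv hS hk)

theorem ContDiffSpaceTime.continuousOn_gradAt {S : Set (Config n d)} {f : Config n d → ℝ → ℝ}
    (hS : IsOpen S) (h : ContDiffSpaceTime k S f) (hk : 1 ≤ k) (i : Fin n) :
    ContinuousOn (fun p : Config n d × ℝ => gradAt i (fun x => f x p.2) p.1) (S ×ˢ Ici 0) := by
  have h1 : ContinuousOn (fun p : Config n d × ℝ => (InnerProductSpace.toDual ℝ (Space d)).symm
      ((fderiv ℝ (fun x => f x p.2) p.1).comp (particleInclusion i))) (S ×ˢ Ici 0) :=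
    (InnerProductSpace.toDual ℝ (Space d)).symm.continuous.comp_continuousOn
      ((h.continuousOn_fderiv hS hk).clm_comp continuousOn_const)
  refine h1.congr fun p hp => gradAt_eq i ?_
  exact ((h.slice hp.2).contDiffAt (hS.mem_nhds hp.1)).differentiableAt
    (by exact_mod_cast (by omega : k ≠ 0))

end Gradients

/-! ### Forces, currents and brackets -/

section Forces

variable {d N : ℕ} {Ω : Set (Space d)} {m : Environment d} {V : Space d → ℝ → ℝ}
  {P : Config N d → ℝ → ℝ} {t : ℝ}

theorem force_contDiffOn (hΩ : IsOpen Ω) (hm : m.IsAdmissible Ω)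
    (hV : IsAdmissiblePotential Ω V) (ht : 0 ≤ t) (i : Fin N) :
    ContDiffOn ℝ 1 (fun x => force m V N i x t) (configSpace Ω N) := by
  have ev : ∀ j : Fin N, ContDiffOn ℝ 1 (fun x : Config N d => x j) (configSpace Ω N) :=
    fun j => (contDiff_apply ℝ (Space d) j).contDiffOn
  have h1 : ContDiffOn ℝ 1 (fun x : Config N d => gradient (fun z => V z t) (x i))
      (configSpace Ω N) :=
    (gradient_contDiffOn (m := 1) hΩ (hV.contDiff t ht) (by norm_num)).comp (ev i)
      fun x hx => hx i trivial
  have h2 : ContDiffOn ℝ 1 (fun x : Config N d => m.R (x i) t) (configSpace Ω N) :=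
    (hm.R_space t ht).comp (ev i) fun x hx => hx i trivial
  have h3 : ∀ j, ContDiffOn ℝ 1 (fun x : Config N d => m.pairForce (x i) (x j))
      (configSpace Ω N) := fun j =>
    ContDiffOn.comp (g := fun p : Space d × Space d => m.pairForce p.1 p.2)
      (f := fun x : Config N d => (x i, x j)) hm.pairForce_contDiff ((ev i).prodMk (ev j))
      fun x hx => ⟨hx i trivial, hx j trivial⟩
  have h4 : ContDiffOn ℝ 1 (fun x : Config N d =>
      ∑ j ∈ Finset.univ.filter (fun j : Fin N => (j : ℕ) < N ∧ j ≠ i), m.pairForce (x i) (x j))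
      (configSpace Ω N) := ContDiffOn.sum fun j _ => h3 j
  exact (h1.neg.add h2).add h4

theorem bracket_contDiffOn (hΩ : IsOpen Ω) (hm : m.IsAdmissible Ω)
    (hV : IsAdmissiblePotential Ω V) (ht : 0 ≤ t)
    (hP : ContDiffOn ℝ 2 (fun x => P x t) (configSpace Ω N)) (i : Fin N) :
    ContDiffOn ℝ 1 (fun x => bracket m V P N i x t) (configSpace Ω N) :=
  (gradAt_contDiffOn (m := 1) (isOpen_configSpace hΩ N) hP (by norm_num) i).sub
    ((contDiffOn_const.mul (hP.of_le (by norm_num))).smul (force_contDiffOn hΩ hm hV ht i))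

/-- The part of the force on particle `i` that is not due to the external potential, as a function
of the position of this particle. -/
noncomputable def nonpotentialForce (m : Environment d) (i : Fin N) (x : Config N d) (t : ℝ)
    (z : Space d) : Space d :=
  m.R z t + ∑ j ∈ Finset.univ.filter (fun j : Fin N => (j : ℕ) < N ∧ j ≠ i), m.pairForce z (x j)

/-- The sum runs over `j ≠ i`, so moving particle `i` leaves the second arguments of the pair forces
in place. -/
theorem force_update (i : Fin N) (x : Config N d) (z : Space d) :
    force m V N i (Function.update x i z) t =
      -gradient (fun z => V z t) z + nonpotentialForce m i x t z := by
  simp only [force, externalForce, nonpotentialForce, Function.update_self, add_assoc]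
  congr 2
  refine Finset.sum_congr rfl fun j hj => ?_
  rw [Function.update_of_ne (Finset.mem_filter.1 hj).2.2]

theorem nonpotentialForce_contDiffOn (hm : m.IsAdmissible Ω) (ht : 0 ≤ t) (i : Fin N)
    {x : Config N d} (hx : x ∈ configSpace Ω N) :
    ContDiffOn ℝ 1 (nonpotentialForce m i x t) Ω := by
  have h3 : ∀ j, ContDiffOn ℝ 1 (fun z : Space d => m.pairForce z (x j)) Ω := fun j =>
    ContDiffOn.comp (g := fun p : Space d × Space d => m.pairForce p.1 p.2)
      (f := fun z : Space d => (z, x j)) hm.pairForce_contDiff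
      (contDiffOn_id.prodMk contDiffOn_const) fun _ hz => ⟨hz, hx j trivial⟩
  have h4 : ContDiffOn ℝ 1 (fun z : Space d =>
      ∑ j ∈ Finset.univ.filter (fun j : Fin N => (j : ℕ) < N ∧ j ≠ i), m.pairForce z (x j)) Ω :=
    ContDiffOn.sum fun j _ => h3 j
  exact (hm.R_space t ht).add h4

theorem divAt_bracket_update (i : Fin N) (x : Config N d) (z : Space d) :
    divAt i (fun y => bracket m V P N i y t) (Function.update x i z) =
      divergence (fun z' => gradient (fun z => P (Function.update x i z) t) z' -
        (m.β * P (Function.update x i z') t) •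
          (-gradient (fun z => V z t) z' + nonpotentialForce m i x t z')) z := by
  rw [divAt_update]
  simp only [bracket, force_update, gradAt_update]

/-- The current is `-D` times the bracket, so the boundary condition is a statement about the terms
of the Smoluchowski operator. -/
theorem divAt_current (i : Fin N) (x : Config N d) :
    divAt i (fun y => current m V P i y t) x =
      -m.D * divAt i (fun y => bracket m V P N i y t) x := by
  have : (fun y => current m V P i y t) = fun y => (-m.D) • bracket m V P N i y t := by
    ext1 y
    simp only [current, bracket, smul_sub, smul_smul, neg_smul, neg_mul, mul_assoc]
    abel
  rw [this]
  simp only [divAt]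
  exact divergence_const_smul _ _

/-- Up to the factor `D`, the term of particle `i` is the difference of two consecutive partial sums
`smolOpMinus`. Both are bounded by assumption, or empty when `i` is the first particle. -/
theorem exists_bound_divAt_bracket (hD : 0 < m.D) (hP : IsWellBehaved m Ω V P) (i : Fin N) :
    ∃ C : ℝ, ∀ x ∈ configSpace Ω N, ∀ t : ℝ, 0 ≤ t →
      |divAt i (fun y => bracket m V P N i y t) x| ≤ C := by
  have hb : ∀ n : ℕ, n ≤ N → ∃ C : ℝ, ∀ x ∈ configSpace Ω N, ∀ t : ℝ, 0 ≤ t →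
      ‖smolOpMinus m V P n x t‖ ≤ C := by
    intro n hn
    rcases Nat.eq_zero_or_pos n with rfl | h0
    · exact ⟨0, fun x _ t _ => by simp [smolOpMinus]⟩
    · exact hP.smolOpMinus_bounded n h0 hn
  obtain ⟨C₁, h₁⟩ := hb (i + 1) i.2
  obtain ⟨C₂, h₂⟩ := hb i i.2.le
  refine ⟨(C₁ + C₂) / m.D, fun x hx t ht => ?_⟩
  have hsub : smolOpMinus m V P (i + 1) x t - smolOpMinus m V P i x t =
      m.D * divAt i (fun y => bracket m V P N i y t) x := by
    have hins : Finset.univ.filter (fun j : Fin N => (j : ℕ) < i + 1) =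
        insert i (Finset.univ.filter (fun j : Fin N => (j : ℕ) < i)) := by
      ext j
      simp only [Finset.mem_filter, Finset.mem_univ, true_and, Finset.mem_insert, Fin.ext_iff]
      omega
    rw [smolOpMinus, smolOpMinus, hins, Finset.sum_insert (by simp)]
    ring
  have h3 := norm_sub_le (smolOpMinus m V P (i + 1) x t) (smolOpMinus m V P i x t)
  rw [hsub, Real.norm_eq_abs, abs_mul, abs_of_pos hD] at h3
  rw [le_div_iff₀ hD]
  linarith [h₁ x hx t ht, h₂ x hx t ht]

end Forces

/-! ### Test functions on configuration space -/

section TestFunctions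

variable {d N : ℕ} {Ω A : Set (Space d)}

/-- Test functions on configuration space: smooth functions which, as functions of the position of
each single particle, are either constant or supported in the compact set `A ⊆ Ω`. -/
structure IsTestFunction (Ω A : Set (Space d)) (χ : Config N d → ℝ) : Prop where
  contDiff : ContDiff ℝ ∞ χ
  isCompact : IsCompact A
  subset : A ⊆ Ω
  slices : ∀ i : Fin N, (∀ x z, χ (Function.update x i z) = χ x) ∨ ∀ x, x i ∉ A → χ x = 0

variable {χ : Config N d → ℝ}

theorem IsTestFunction.slice_contDiff (h : IsTestFunction Ω A χ) (i : Fin N) (x : Config N d) :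
    ContDiff ℝ ∞ fun z => χ (Function.update x i z) :=
  h.contDiff.comp (contDiff_update _ x i)

theorem gradAt_eq_zero_of_slice_const {i : Fin N} (h : ∀ x z, χ (Function.update x i z) = χ x)
    (x : Config N d) : gradAt i χ x = 0 := by
  simp [gradAt, gradient, h x]

theorem laplaceAt_eq_zero_of_slice_const {i : Fin N} (h : ∀ x z, χ (Function.update x i z) = χ x)
    (x : Config N d) : divAt i (gradAt i χ) x = 0 := by
  simp [divAt, divergence, gradAt_eq_zero_of_slice_const h]

theorem IsTestFunction.gradAt_eq_zero (h : IsTestFunction Ω A χ) {i : Fin N} {x : Config N d}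
    (hx : x i ∉ A) : gradAt i χ x = 0 := by
  rcases h.slices i with h1 | h1
  · exact gradAt_eq_zero_of_slice_const h1 x
  · exact gradient_eq_zero_of_eventually h.isCompact.isClosed (fun z hz => h1 _ (by simpa)) hx

theorem IsTestFunction.laplaceAt_eq_zero (h : IsTestFunction Ω A χ) {i : Fin N} {x : Config N d}
    (hx : x i ∉ A) : divAt i (gradAt i χ) x = 0 := by
  have : (fun z => gradAt i χ (Function.update x i z)) =ᶠ[𝓝 (x i)] fun _ => 0 := by
    filter_upwards [h.isCompact.isClosed.isOpen_compl.mem_nhds hx] with z hz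
    exact h.gradAt_eq_zero (by simpa using hz)
  rw [divAt, divergence_congr this]
  simp [divergence]

theorem IsTestFunction.continuous_gradAt (h : IsTestFunction Ω A χ) (i : Fin N) :
    Continuous (gradAt i χ) := by
  rw [← continuousOn_univ]
  exact (gradAt_contDiffOn (m := 1) isOpen_univ (contDiff_infty.1 h.contDiff 2).contDiffOn
    (by norm_num) i).continuousOn

theorem IsTestFunction.continuous_laplaceAt (h : IsTestFunction Ω A χ) (i : Fin N) :
    Continuous (divAt i (gradAt i χ)) := by
  rw [← continuousOn_univ]
  exact continuousOn_divAt isOpen_univ (gradAt_contDiffOn (m := 1) isOpen_univ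
    (contDiff_infty.1 h.contDiff 2).contDiffOn (by norm_num) i) i

theorem exists_bound_on_configSpace {F : Type*} [NormedAddCommGroup F]
    (hΩ : Bornology.IsBounded Ω) {f : Config N d → F} (hf : Continuous f) :
    ∃ C : ℝ, 0 ≤ C ∧ ∀ x ∈ configSpace Ω N, ‖f x‖ ≤ C := by
  have hb : Bornology.IsBounded (configSpace Ω N) := Bornology.IsBounded.pi fun _ => hΩ
  obtain ⟨C, hC⟩ := hb.isCompact_closure.exists_bound_of_continuousOn hf.continuousOn
  exact ⟨max C 0, le_max_right _ _, fun x hx => (hC x (subset_closure hx)).trans (le_max_left _ _)⟩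

end TestFunctions

/-! ### Bounds and regularity of the distribution and the forces -/

section Bounds

variable {d N : ℕ} {Ω A : Set (Space d)} {m : Environment d} {V V' : Space d → ℝ → ℝ}
  {P P' : Config N d → ℝ → ℝ} {χ : Config N d → ℝ}

theorem exists_bound_on_compact {F : Type*} [NormedAddCommGroup F] {g : Space d → ℝ → F}
    (hg : ContinuousOn (fun p : Space d × ℝ => g p.1 p.2) (Ω ×ˢ Ici 0)) (hA : IsCompact A)
    (hAΩ : A ⊆ Ω) : ∃ C : ℝ, 0 ≤ C ∧ ∀ x ∈ A, ∀ t ∈ Icc (0 : ℝ) 1, ‖g x t‖ ≤ C := by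
  obtain ⟨C, hC⟩ := (hA.prod (isCompact_Icc (a := (0 : ℝ)) (b := 1))).exists_bound_of_continuousOn
    (hg.mono (prod_mono hAΩ Icc_subset_Ici_self))
  exact ⟨max C 0, le_max_right _ _, fun x hx t ht => (hC (x, t) ⟨hx, ht⟩).trans (le_max_left _ _)⟩

/-- Nothing is integrated out: the configuration space of `N - N` particles is a single point of
measure one. This is how the assumptions on the reduced densities apply to `P` itself. -/
theorem reducedDensity_self (Ω : Set (Space d)) (P : Config N d → ℝ → ℝ) (x : Config N d) (t : ℝ) :
    reducedDensity Ω P N x t = (N.factorial : ℝ) * P x t := by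
  have hg : ∀ y, glue N x y = x := fun y => by
    ext1 i
    simp [glue]
  have hE : IsEmpty (Fin (N - N)) := by rw [Nat.sub_self]; infer_instance
  have hs : configSpace Ω (N - N) = univ := by
    ext y
    simp only [configSpace, mem_univ_pi, mem_univ, iff_true]
    exact fun i => hE.elim i
  have hv : (volume : Measure (Config (N - N) d)).real univ = 1 := by
    rw [Measure.real, volume_pi, Measure.pi_of_empty]
    simp
  simp only [reducedDensity, hg, hs, Nat.descFactorial_self, Measure.restrict_univ,
    integral_const, hv, smul_eq_mul, one_mul]

theorem timeDeriv_eq_reducedDensity (Ω : Set (Space d)) (P : Config N d → ℝ → ℝ) (k : ℕ)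
    (x : Config N d) (t : ℝ) : timeDeriv k (P x) t =
      (N.factorial : ℝ)⁻¹ * timeDeriv k (reducedDensity Ω P N x) t := by
  have h1 : reducedDensity Ω P N x = (N.factorial : ℝ) • P x :=
    funext fun t => reducedDensity_self Ω P x t
  rw [h1, timeDeriv, timeDeriv, iteratedDerivWithin_const_smul_field, smul_eq_mul,
    inv_mul_cancel_left₀ (by positivity)]

theorem IsAnalyticallyAccessible.contDiff_timeDeriv
    (h : IsAnalyticallyAccessible m Ω V P) (hN : 1 ≤ N) (k : ℕ) :
    ContDiffSpaceTime 2 (configSpace Ω N) fun x t => timeDeriv k (P x) t := by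
  have := h.densities_contDiff N hN le_rfl k
  simp_rw [timeDeriv_eq_reducedDensity Ω P]
  exact contDiffOn_const.mul this

theorem IsAnalyticallyAccessible.bounded_timeDeriv
    (h : IsAnalyticallyAccessible m Ω V P) (hN : 1 ≤ N) (k : ℕ) :
    ∃ C : ℝ, 0 ≤ C ∧ ∀ x ∈ configSpace Ω N, ∀ t : ℝ, 0 ≤ t → |timeDeriv k (P x) t| ≤ C := by
  obtain ⟨C, hC⟩ := h.densities_bounded N hN le_rfl k
  refine ⟨(N.factorial : ℝ)⁻¹ * max C 0, by positivity, fun x hx t ht => ?_⟩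
  rw [timeDeriv_eq_reducedDensity Ω P, abs_mul, abs_of_nonneg (by positivity)]
  exact mul_le_mul_of_nonneg_left ((hC x hx t ht).trans (le_max_left _ _)) (by positivity)

theorem timeDeriv_zero {F : Type*} [NormedAddCommGroup F] [NormedSpace ℝ F] (f : ℝ → F) :
    timeDeriv 0 f = f := by
  ext1 t
  simp [timeDeriv]

/-- Where a test function varies with the position of a particle, the force on this particle is
bounded, locally uniformly in time. -/
theorem exists_bound_force (hΩ : IsOpen Ω) (hm : m.IsAdmissible Ω)
    (h : IsAnalyticallyAccessible m Ω V P) (hA : IsCompact A) (hAΩ : A ⊆ Ω) :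
    ∃ C : ℝ, 0 ≤ C ∧ ∀ (i : Fin N), ∀ x ∈ configSpace Ω N, x i ∈ A → ∀ t ∈ Icc (0 : ℝ) 1,
      ‖force m V N i x t‖ ≤ C := by
  have hV := h.potential_contDiff 0
  have hR := h.R_contDiff 0
  simp only [timeDeriv_zero] at hV hR
  obtain ⟨C₁, h₁, hC₁⟩ := exists_bound_on_compact (g := fun x t => gradient (fun z => V z t) x)
    (hV.continuousOn_gradient hΩ (by norm_num)) hA hAΩ
  obtain ⟨C₂, h₂, hC₂⟩ := exists_bound_on_compact hR.continuousOn hA hAΩ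
  obtain ⟨C₃, hC₃⟩ := hm.pairForce_bounded
  refine ⟨C₁ + C₂ + N * max C₃ 0, by positivity, fun i x hx hxA t ht => ?_⟩
  have h3 : ‖∑ j ∈ Finset.univ.filter (fun j : Fin N => (j : ℕ) < N ∧ j ≠ i),
      m.pairForce (x i) (x j)‖ ≤ N * max C₃ 0 := by
    refine (norm_sum_le_of_le _ fun j _ =>
      (hC₃ _ (hx i trivial) _ (hx j trivial)).trans (le_max_left C₃ 0)).trans ?_
    rw [Finset.sum_const, nsmul_eq_mul]
    refine mul_le_mul_of_nonneg_right ?_ (le_max_right _ _)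
    exact_mod_cast (Finset.card_le_univ _).trans (by simp)
  refine (norm_add_le _ _).trans (add_le_add ((norm_add_le _ _).trans (add_le_add ?_ ?_)) h3)
  · rw [norm_neg]
    exact hC₁ _ hxA t ht
  · exact hC₂ _ hxA t ht

end Bounds

/-! ### Weak form of the difference of two Smoluchowski equations -/

section WeakForm

variable {d N : ℕ} {Ω A : Set (Space d)} {m : Environment d} {V V' : Space d → ℝ → ℝ}
  {P P' : Config N d → ℝ → ℝ} {χ : Config N d → ℝ} {t : ℝ}

/-- The formal adjoint `(Δ_i + β F_{N,i} · ∇_i) χ` of the `i`-th part of the Smoluchowski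
operator. -/
noncomputable def adjointOp (m : Environment d) (V : Space d → ℝ → ℝ) (χ : Config N d → ℝ)
    (i : Fin N) (x : Config N d) (t : ℝ) : ℝ :=
  divAt i (gradAt i χ) x + m.β * ⟪gradAt i χ x, force m V N i x t⟫

/-- The divergence `∇_i · (P ∇_i χ)`. -/
noncomputable def weightedLaplace (P : Config N d → ℝ → ℝ) (χ : Config N d → ℝ) (i : Fin N)
    (x : Config N d) (t : ℝ) : ℝ :=
  ⟪gradAt i (fun y => P y t) x, gradAt i χ x⟫ + P x t * divAt i (gradAt i χ) x

theorem IsTestFunction.weightedLaplace_eq_zero (h : IsTestFunction Ω A χ)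
    {i : Fin N} {x : Config N d} (hx : x i ∉ A) : weightedLaplace P χ i x t = 0 := by
  simp [weightedLaplace, h.gradAt_eq_zero hx, h.laplaceAt_eq_zero hx]

theorem IsTestFunction.adjointOp_eq_zero (h : IsTestFunction Ω A χ)
    {i : Fin N} {x : Config N d} (hx : x i ∉ A) : adjointOp m V χ i x t = 0 := by
  simp [adjointOp, h.gradAt_eq_zero hx, h.laplaceAt_eq_zero hx]

theorem exists_bound_adjointOp (hΩ : IsSmoothBoundedDomain Ω) (hm : m.IsAdmissible Ω)
    (hP : IsAnalyticallyAccessibleSystem m Ω V P) (hχ : IsTestFunction Ω A χ) (i : Fin N) :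
    ∃ C : ℝ, 0 ≤ C ∧ ∀ x ∈ configSpace Ω N, ∀ t ∈ Icc (0 : ℝ) 1, |adjointOp m V χ i x t| ≤ C := by
  obtain ⟨C₁, h₁, hC₁⟩ := exists_bound_force (N := N) hΩ.isOpen hm hP.accessible hχ.isCompact
    hχ.subset
  obtain ⟨C₂, h₂, hC₂⟩ := exists_bound_on_configSpace hΩ.isBounded (hχ.continuous_gradAt i)
  obtain ⟨C₃, h₃, hC₃⟩ := exists_bound_on_configSpace hΩ.isBounded (hχ.continuous_laplaceAt i)
  have hβ := hm.β_pos
  refine ⟨C₃ + m.β * (C₂ * C₁), by positivity, fun x hx t ht => ?_⟩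
  by_cases hxA : x i ∈ A
  · refine (abs_add_le _ _).trans (add_le_add (hC₃ x hx) ?_)
    rw [abs_mul, abs_of_pos hβ]
    refine mul_le_mul_of_nonneg_left ((abs_real_inner_le_norm _ _).trans ?_) hβ.le
    exact mul_le_mul (hC₂ x hx) (hC₁ i x hx hxA t ht) (norm_nonneg _) h₂
  · rw [hχ.adjointOp_eq_zero hxA, abs_zero]
    positivity

theorem exists_bound_weightedLaplace (hΩ : IsSmoothBoundedDomain Ω)
    (hP : IsAnalyticallyAccessibleSystem m Ω V P) (hχ : IsTestFunction Ω A χ) (i : Fin N) :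
    ∃ C : ℝ, 0 ≤ C ∧ ∀ x ∈ configSpace Ω N, ∀ t : ℝ, 0 ≤ t → |weightedLaplace P χ i x t| ≤ C := by
  obtain ⟨C₁, hC₁⟩ := hP.wellBehaved.gradient_bounded i
  obtain ⟨C₂, h₂, hC₂⟩ := exists_bound_on_configSpace hΩ.isBounded (hχ.continuous_gradAt i)
  obtain ⟨C₃, h₃, hC₃⟩ := exists_bound_on_configSpace hΩ.isBounded (hχ.continuous_laplaceAt i)
  obtain ⟨C₄, h₄, hC₄⟩ := hP.accessible.bounded_timeDeriv (by have := i.2; omega) 0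
  simp only [timeDeriv_zero] at hC₄
  refine ⟨max C₁ 0 * C₂ + C₄ * C₃, by positivity, fun x hx t ht => ?_⟩
  refine (abs_add_le _ _).trans (add_le_add ((abs_real_inner_le_norm _ _).trans ?_) ?_)
  · exact mul_le_mul ((hC₁ x hx t ht).trans (le_max_left _ _)) (hC₂ x hx) (norm_nonneg _)
      (le_max_right _ _)
  · rw [abs_mul]
    exact mul_le_mul (hC₄ x hx t ht) (hC₃ x hx) (abs_nonneg _) h₄

theorem continuousOn_adjointOp (hΩ : IsOpen Ω) (hm : m.IsAdmissible Ω)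
    (hV : IsAdmissiblePotential Ω V) (hχ : IsTestFunction Ω A χ) (ht : 0 ≤ t) (i : Fin N) :
    ContinuousOn (fun x => adjointOp m V χ i x t) (configSpace Ω N) :=
  (hχ.continuous_laplaceAt i).continuousOn.add (continuousOn_const.mul
    ((hχ.continuous_gradAt i).continuousOn.inner (force_contDiffOn hΩ hm hV ht i).continuousOn))

theorem continuousOn_weightedLaplace (hΩ : IsOpen Ω) (hχ : IsTestFunction Ω A χ)
    (hP : ContDiffOn ℝ 2 (fun x => P x t) (configSpace Ω N)) (i : Fin N) :
    ContinuousOn (fun x => weightedLaplace P χ i x t) (configSpace Ω N) :=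
  ((gradAt_contDiffOn (m := 1) (isOpen_configSpace hΩ N) hP (by norm_num) i).continuousOn.inner
    (hχ.continuous_gradAt i).continuousOn).add
    (hP.continuousOn.mul (hχ.continuous_laplaceAt i).continuousOn)

theorem integrableOn_configSpace_of_bound (hΩ : IsSmoothBoundedDomain Ω) {f : Config N d → ℝ}
    (hf : ContinuousOn f (configSpace Ω N)) {C : ℝ} (hC : ∀ x ∈ configSpace Ω N, |f x| ≤ C) :
    IntegrableOn f (configSpace Ω N) := by
  have ho := isOpen_configSpace hΩ.isOpen N
  exact IntegrableOn.of_bound (configSpace_measure_lt_top hΩ.isBounded N)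
    (hf.aestronglyMeasurable ho.measurableSet) C
    ((ae_restrict_iff' ho.measurableSet).2 (Eventually.of_forall fun x hx => hC x hx))

theorem continuousOn_comp_particle {f : Space d → ℝ} (hf : ContinuousOn f Ω) (i : Fin N) :
    ContinuousOn (fun x : Config N d => f (x i)) (configSpace Ω N) :=
  hf.comp (continuous_apply i).continuousOn fun _ hx => hx i trivial

theorem integrableOn_adjointOp (hΩ : IsSmoothBoundedDomain Ω) (hm : m.IsAdmissible Ω)
    (hP : IsAnalyticallyAccessibleSystem m Ω V P) (hP' : IsAnalyticallyAccessibleSystem m Ω V' P')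
    (hχ : IsTestFunction Ω A χ) (ht : t ∈ Icc (0 : ℝ) 1) (i : Fin N) :
    IntegrableOn (fun x => (P x t - P' x t) * adjointOp m V χ i x t) (configSpace Ω N) := by
  have hN : 1 ≤ N := by have := i.2; omega
  obtain ⟨C₁, h₁, hC₁⟩ := hP.accessible.bounded_timeDeriv hN 0
  obtain ⟨C₂, h₂, hC₂⟩ := hP'.accessible.bounded_timeDeriv hN 0
  simp only [timeDeriv_zero] at hC₁ hC₂
  obtain ⟨C₃, h₃, hC₃⟩ := exists_bound_adjointOp hΩ hm hP hχ i
  refine integrableOn_configSpace_of_bound hΩ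
    (((hP.wellBehaved.contDiff.slice ht.1).continuousOn.sub
      (hP'.wellBehaved.contDiff.slice ht.1).continuousOn).mul
      (continuousOn_adjointOp hΩ.isOpen hm hP.potential hχ ht.1 i)) (C := (C₁ + C₂) * C₃)
    fun x hx => ?_
  rw [abs_mul]
  exact mul_le_mul ((abs_sub _ _).trans (add_le_add (hC₁ x hx t ht.1) (hC₂ x hx t ht.1)))
    (hC₃ x hx t ht) (abs_nonneg _) (by positivity)

theorem integrableOn_weightedLaplace (hΩ : IsSmoothBoundedDomain Ω)
    (hP' : IsAnalyticallyAccessibleSystem m Ω V' P')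
    (hχ : IsTestFunction Ω A χ) (ht : 0 ≤ t) (i : Fin N) {g : Space d → ℝ}
    (hg : ContinuousOn g Ω) :
    IntegrableOn (fun x => g (x i) * weightedLaplace P' χ i x t) (configSpace Ω N) := by
  obtain ⟨C₁, hC₁⟩ := hχ.isCompact.exists_bound_of_continuousOn (hg.mono hχ.subset)
  obtain ⟨C₂, h₂, hC₂⟩ := exists_bound_weightedLaplace hΩ hP' hχ i
  refine integrableOn_configSpace_of_bound hΩ ((continuousOn_comp_particle hg i).mul
    (continuousOn_weightedLaplace hΩ.isOpen hχ (hP'.wellBehaved.contDiff.slice ht) i))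
    (C := max C₁ 0 * C₂) fun x hx => ?_
  by_cases hxA : x i ∈ A
  · rw [abs_mul]
    exact mul_le_mul ((hC₁ _ hxA).trans (le_max_left _ _)) (hC₂ x hx t ht) (abs_nonneg _)
      (le_max_right _ _)
  · rw [hχ.weightedLaplace_eq_zero hxA, mul_zero, abs_zero]
    positivity

/-- The difference of the parts of two Smoluchowski operators that belong to particle `i`, tested
against `χ`. -/
theorem setIntegral_testFunction_mul_bracket (hΩ : IsSmoothBoundedDomain Ω)
    (hm : m.IsAdmissible Ω)
    (hP : IsAnalyticallyAccessibleSystem m Ω V P) (hP' : IsAnalyticallyAccessibleSystem m Ω V' P')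
    (hχ : IsTestFunction Ω A χ) (ht : t ∈ Icc (0 : ℝ) 1) (c : ℝ) (i : Fin N) :
    IntegrableOn (fun x => χ x * (divAt i (fun y => bracket m V P N i y t) x -
      divAt i (fun y => bracket m V' P' N i y t) x)) (configSpace Ω N) ∧
    ∫ x in configSpace Ω N, χ x * (divAt i (fun y => bracket m V P N i y t) x -
      divAt i (fun y => bracket m V' P' N i y t) x) =
    (∫ x in configSpace Ω N, (P x t - P' x t) * adjointOp m V χ i x t) +
      m.β * ∫ x in configSpace Ω N, (V (x i) t - V' (x i) t - c) * weightedLaplace P' χ i x t := by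
  have ho := isOpen_configSpace hΩ.isOpen N
  have sP := hP.wellBehaved.contDiff.slice ht.1
  have sP' := hP'.wellBehaved.contDiff.slice ht.1
  have i1 : IntegrableOn (fun x => χ x * (divAt i (fun y => bracket m V P N i y t) x -
      divAt i (fun y => bracket m V' P' N i y t) x)) (configSpace Ω N) := by
    obtain ⟨C₁, h₁, hC₁⟩ := exists_bound_on_configSpace hΩ.isBounded hχ.contDiff.continuous
    obtain ⟨C₂, hC₂⟩ := exists_bound_divAt_bracket hm.D_pos hP.wellBehaved i
    obtain ⟨C₃, hC₃⟩ := exists_bound_divAt_bracket hm.D_pos hP'.wellBehaved i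
    refine integrableOn_configSpace_of_bound hΩ (hχ.contDiff.continuous.continuousOn.mul
      ((continuousOn_divAt ho (bracket_contDiffOn hΩ.isOpen hm hP.potential ht.1 sP i) i).sub
      (continuousOn_divAt ho (bracket_contDiffOn hΩ.isOpen hm hP'.potential ht.1 sP' i) i)))
      (C := C₁ * (C₂ + C₃)) fun x hx => ?_
    rw [abs_mul]
    exact mul_le_mul (hC₁ x hx) ((abs_sub _ _).trans (add_le_add (hC₂ x hx t ht.1)
      (hC₃ x hx t ht.1))) (abs_nonneg _) h₁
  have i2 := integrableOn_adjointOp hΩ hm hP hP' hχ ht i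
  have i3 := integrableOn_weightedLaplace (g := fun z => V z t - V' z t - c) hΩ hP' hχ ht.1 i
    (((hP.potential.contDiff t ht.1).continuousOn.sub
      (hP'.potential.contDiff t ht.1).continuousOn).sub continuousOn_const)
  refine ⟨i1, ?_⟩
  have i4 : IntegrableOn (fun x => (P x t - P' x t) * adjointOp m V χ i x t +
      m.β * ((V (x i) t - V' (x i) t - c) * weightedLaplace P' χ i x t)) (configSpace Ω N) :=
    i2.add (i3.const_mul _)
  rw [← integral_const_mul, ← integral_add i2 (i3.const_mul _), ← sub_eq_zero,
    ← integral_sub i1 i4]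
  refine setIntegral_configSpace_eq_zero (i1.sub i4) i fun x hx => ?_
  -- If `χ` does not depend on particle `i`, all derivatives of `χ` vanish and the boundary
  -- condition removes the brackets. Otherwise `χ` is compactly supported in this position and
  -- integration by parts has no boundary terms.
  rcases hχ.slices i with h | h
  · have b1 := hP.boundary i x hx t ht.1
    have b2 := hP'.boundary i x hx t ht.1
    simp only [divAt_current, integral_const_mul, neg_eq_zero, mul_eq_zero,
      hm.D_pos.ne', false_or] at b1 b2
    have e : ∀ y, adjointOp m V χ i y t = 0 := fun y => by
      simp [adjointOp, gradAt_eq_zero_of_slice_const h, laplaceAt_eq_zero_of_slice_const h]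
    have e' : ∀ y, weightedLaplace P' χ i y t = 0 := fun y => by
      simp [weightedLaplace, gradAt_eq_zero_of_slice_const h, laplaceAt_eq_zero_of_slice_const h]
    simp only [e, e', mul_zero, add_zero, sub_zero, h, integral_const_mul]
    have hint : ∀ {W : Space d → ℝ → ℝ} {S : Config N d → ℝ → ℝ},
        IsAnalyticallyAccessibleSystem m Ω W S → IntegrableOn
          (fun z => divAt i (fun y => bracket m W S N i y t) (Function.update x i z)) Ω := by
      intro W S hS
      obtain ⟨C, hC⟩ := exists_bound_divAt_bracket hm.D_pos hS.wellBehaved i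
      refine IntegrableOn.of_bound hΩ.isBounded.measure_lt_top
        (ContinuousOn.aestronglyMeasurable ?_ hΩ.isOpen.measurableSet) C
        ((ae_restrict_iff' hΩ.isOpen.measurableSet).2 (Eventually.of_forall fun z hz =>
          hC _ (update_mem_configSpace hx i hz) t ht.1))
      exact (continuousOn_divAt ho (bracket_contDiffOn hΩ.isOpen hm hS.potential ht.1
        (hS.wellBehaved.contDiff.slice ht.1) i) i).comp
        (contDiff_update (𝕜 := ℝ) 1 x i).continuous.continuousOn
        fun z hz => update_mem_configSpace hx i hz
    rw [integral_sub (hint hP) (hint hP'), b1, b2]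
    simp
  · have key := setIntegral_smoluchowski_difference hΩ.isOpen hχ.isCompact hχ.subset
      (hχ.slice_contDiff i x) (fun z hz => h _ (by simpa using hz))
      (contDiffOn_slice sP hx i) (contDiffOn_slice sP' hx i)
      (hP.potential.contDiff t ht.1) (hP'.potential.contDiff t ht.1)
      (nonpotentialForce_contDiffOn hm ht.1 i hx) m.β c
    refine Eq.trans (integral_congr_ae (Eventually.of_forall fun z => ?_)) key
    simp only [divAt_bracket_update, adjointOp, weightedLaplace, force_update,
      divAt_gradAt_update, gradAt_update, Function.update_self, neg_add_eq_sub]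

/-- The weak form of the difference of two Smoluchowski equations. The constant `c` expresses that
potentials are only defined up to a function of time. -/
theorem setIntegral_testFunction_mul_timeDeriv (hΩ : IsSmoothBoundedDomain Ω)
    (hm : m.IsAdmissible Ω)
    (hP : IsAnalyticallyAccessibleSystem m Ω V P) (hP' : IsAnalyticallyAccessibleSystem m Ω V' P')
    (hχ : IsTestFunction Ω A χ) (ht : t ∈ Icc (0 : ℝ) 1) (c : ℝ) :
    ∫ x in configSpace Ω N, χ x * (timeDeriv 1 (P x) t - timeDeriv 1 (P' x) t) =
      m.D * ∑ i, ((∫ x in configSpace Ω N, (P x t - P' x t) * adjointOp m V χ i x t) +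
      m.β * ∫ x in configSpace Ω N,
        (V (x i) t - V' (x i) t - c) * weightedLaplace P' χ i x t) := by
  have key := setIntegral_testFunction_mul_bracket hΩ hm hP hP' hχ ht c
  rw [Finset.sum_congr rfl fun i _ => (key i).2.symm, ← integral_finsetSum _ fun i _ => (key i).1,
    ← integral_const_mul]
  refine setIntegral_congr_fun (isOpen_configSpace hΩ.isOpen N).measurableSet fun x hx => ?_
  have hfil : Finset.univ.filter (fun i : Fin N => (i : ℕ) < N) = Finset.univ :=
    Finset.filter_true_of_mem fun i _ => i.2
  rw [hP.solution.smoluchowski x hx t ht.1, hP'.solution.smoluchowski x hx t ht.1, smolOp, smolOp,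
    hfil, ← mul_sub, ← Finset.sum_sub_distrib, ← Finset.mul_sum]
  ring

end WeakForm

/-! ### Leading order in time at the initial time -/

section TimeDerivatives

variable {u v : ℝ → ℝ} {m : ℕ} {C t : ℝ}

theorem timeDeriv_succ (k : ℕ) (u : ℝ → ℝ) (t : ℝ) :
    timeDeriv (k + 1) u t = timeDeriv k (timeDeriv 1 u) t := by
  have h : timeDeriv 1 u = derivWithin u (Ici 0) := by
    ext1 s
    simp [timeDeriv, iteratedDerivWithin_one]
  rw [h, timeDeriv, timeDeriv, iteratedDerivWithin_succ']

theorem timeDeriv_sub (hu : ContDiffOn ℝ m u (Ici 0)) (hv : ContDiffOn ℝ m v (Ici 0))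
    (ht : 0 ≤ t) :
    timeDeriv m (fun s => u s - v s) t = timeDeriv m u t - timeDeriv m v t :=
  iteratedDerivWithin_sub (mem_Ici.2 ht) (uniqueDiffOn_Ici 0) (hu t ht) (hv t ht)

theorem contDiffOn_of_timeDeriv (h : ∀ k, ContDiffOn ℝ 2 (timeDeriv k u) (Ici 0)) (n : ℕ) :
    ContDiffOn ℝ n u (Ici 0) :=
  contDiffOn_of_differentiableOn_deriv fun k _ => (h k).differentiableOn (by norm_num)

theorem contDiffOn_timeDeriv_one (hu : ContDiffOn ℝ (m + 1 : ℕ) u (Ici 0)) :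
    ContDiffOn ℝ m (timeDeriv 1 u) (Ici 0) := by
  have h : timeDeriv 1 u = derivWithin u (Ici 0) := by
    ext1 s
    simp [timeDeriv, iteratedDerivWithin_one]
  rw [h]
  exact hu.derivWithin (uniqueDiffOn_Ici 0) (by norm_cast)

/-- A function whose first `m` derivatives vanish at time `0` is `O(t^m)`. -/
theorem abs_le_mul_pow_of_timeDeriv_eq_zero (hu : ContDiffOn ℝ m u (Ici 0))
    (h0 : ∀ j < m, timeDeriv j u 0 = 0) (hC : ∀ t ∈ Icc (0 : ℝ) 1, |timeDeriv m u t| ≤ C)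
    (ht : t ∈ Icc (0 : ℝ) 1) : |u t| ≤ C * t ^ m := by
  induction m generalizing u t with
  | zero => simpa [timeDeriv_zero] using hC t ht
  | succ m ih =>
    -- The induction hypothesis bounds the first derivative by `C s ^ m`; the mean value inequality
    -- on `[0, t]` supplies the remaining factor `t`.
    have ih' : ∀ s ∈ Icc (0 : ℝ) 1, |timeDeriv 1 u s| ≤ C * s ^ m := fun s hs =>
      ih (contDiffOn_timeDeriv_one hu) (fun j hj => by rw [← timeDeriv_succ]; exact h0 _ (by omega))
        (fun s hs => by rw [← timeDeriv_succ]; exact hC s hs) hs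
    have hC0 : 0 ≤ C := (abs_nonneg _).trans (hC 0 (by simp))
    have hd : ∀ s ∈ Icc (0 : ℝ) t, HasDerivWithinAt u (timeDeriv 1 u s) (Icc 0 t) s := by
      intro s hs
      have := ((hu.differentiableOn (by simp)) s hs.1).hasDerivWithinAt
      rw [timeDeriv, iteratedDerivWithin_one]
      exact this.mono Icc_subset_Ici_self
    have key := Convex.norm_image_sub_le_of_norm_hasDerivWithin_le hd
      (fun s hs => (ih' s ⟨hs.1, hs.2.trans ht.2⟩).trans
        (mul_le_mul_of_nonneg_left (pow_le_pow_left₀ hs.1 hs.2 m) hC0))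
      (convex_Icc 0 t) (left_mem_Icc.2 ht.1) (right_mem_Icc.2 ht.1)
    have hu0 : u 0 = 0 := by simpa [timeDeriv_zero] using h0 0 (by omega)
    rw [hu0, sub_zero, sub_zero, Real.norm_of_nonneg ht.1, Real.norm_eq_abs] at key
    rw [pow_succ, ← mul_assoc]
    exact key

/-- All Taylor coefficients below order `m` vanish, so the Taylor polynomial is a single monomial
and the remainder is of smaller order. -/
theorem tendsto_div_pow_of_timeDeriv_eq_zero (hu : ContDiffOn ℝ m u (Ici 0))
    (h0 : ∀ j < m, timeDeriv j u 0 = 0) :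
    Tendsto (fun t => u t / t ^ m) (𝓝[>] 0) (𝓝 (timeDeriv m u 0 / m.factorial)) := by
  have h1 := (taylor_tendsto (convex_Ici (0 : ℝ)) self_mem_Ici hu).mono_left
    (nhdsWithin_mono (0 : ℝ) Ioi_subset_Ici_self)
  have h2 : ∀ t, taylorWithinEval u m (Ici 0) 0 t = timeDeriv m u 0 / m.factorial * t ^ m := by
    intro t
    rw [taylor_within_apply, Finset.sum_range_succ, Finset.sum_eq_zero]
    · simp only [sub_zero, zero_add, smul_eq_mul, timeDeriv]
      ring
    · intro j hj
      have := h0 j (Finset.mem_range.1 hj)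
      rw [timeDeriv] at this
      rw [this, smul_zero]
  have h3 := h1.add_const (timeDeriv m u 0 / m.factorial)
  rw [zero_add] at h3
  refine h3.congr' ?_
  filter_upwards [self_mem_nhdsWithin] with t ht
  have ht' : (0 : ℝ) < t := ht
  rw [h2, sub_zero, smul_eq_mul, inv_mul_eq_div]
  field_simp
  ring

/-- A function that is analytic on the time half line vanishes if all its derivatives do at time
`0`. -/
theorem eq_zero_of_analyticOn_of_timeDeriv_eq_zero (hu : AnalyticOn ℝ u (Ici 0))
    (h0 : ∀ k, timeDeriv k u 0 = 0) (ht : 0 ≤ t) : u t = 0 := by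
  have hu0 : u 0 = 0 := by simpa [timeDeriv_zero] using h0 0
  -- At `0` the analyticity of `u` is one-sided, so `u` is first continued to a function `g` that is
  -- analytic on a full neighbourhood.
  obtain ⟨g, hug, hg⟩ := analyticWithinAt_iff_exists_analyticAt.1 (hu 0 self_mem_Ici)
  rw [insert_eq_of_mem self_mem_Ici] at hug
  have hug' : u =ᶠ[𝓝[>] 0] g := hug.filter_mono (nhdsWithin_mono _ Ioi_subset_Ici_self)
  -- Otherwise `g` would be `t ^ n` times an analytic factor with non-zero value at `0`. But that
  -- value is the limit of `u t / t ^ n`, which is zero.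
  have hg0 : ∀ᶠ t in 𝓝 0, g t = 0 := by
    by_contra hne
    obtain ⟨n, h, hh, hh0, hgh⟩ := hg.exists_eventuallyEq_pow_smul_nonzero_iff.2 hne
    have h1 := tendsto_div_pow_of_timeDeriv_eq_zero (m := n)
      (hu.contDiffOn (uniqueDiffOn_Ici 0)) fun j _ => h0 j
    rw [h0 n, zero_div] at h1
    have h2 : Tendsto h (𝓝[>] 0) (𝓝 (h 0)) := hh.continuousAt.tendsto.mono_left nhdsWithin_le_nhds
    refine hh0 (tendsto_nhds_unique (h2.congr' ?_) h1)
    filter_upwards [hug', hgh.filter_mono nhdsWithin_le_nhds, self_mem_nhdsWithin] with t e1 e2 ht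
    have ht' : (0 : ℝ) < t := ht
    rw [e1, e2, sub_zero, smul_eq_mul]
    field_simp
  rcases ht.eq_or_lt with rfl | htp
  · exact hu0
  have hz : ∀ᶠ t in 𝓝[>] (0 : ℝ), u t = 0 := by
    filter_upwards [hug', hg0.filter_mono nhdsWithin_le_nhds] with t e1 e2
    rw [e1, e2]
  have hfr : ∃ s ∈ Ioi (0 : ℝ), u =ᶠ[𝓝 s] 0 := by
    obtain ⟨ε, hε, hs⟩ := mem_nhdsGT_iff_exists_Ioo_subset.1 hz
    have hε' : (0 : ℝ) < ε := hε
    exact ⟨ε / 2, half_pos hε', by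
      filter_upwards [Ioo_mem_nhds (half_pos hε') (half_lt_self hε')] with s h using hs h⟩
  obtain ⟨s, hs, hus⟩ := hfr
  -- The identity theorem on the connected open half line carries the vanishing near `0` to all
  -- positive times.
  exact ((isOpen_Ioi.analyticOn_iff_analyticOnNhd).1
    (hu.mono Ioi_subset_Ici_self)).eqOn_zero_of_preconnected_of_eventuallyEq_zero
    isPreconnected_Ioi hs hus htp

/-- Limits at time `0` of weighted integrals, where the leading order in time is `m`. -/
theorem tendsto_setIntegral_mul_div_pow {X : Type*} [MeasurableSpace X] {μ : Measure X} {S : Set X}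
    (hS : MeasurableSet S) (hμS : μ S < ⊤) {F G : X → ℝ → ℝ} {B : ℝ}
    (hF : ∀ x ∈ S, ContDiffOn ℝ m (F x) (Ici 0))
    (h0 : ∀ x ∈ S, ∀ j < m, timeDeriv j (F x) 0 = 0)
    (hC : ∀ x ∈ S, (∀ t ∈ Icc (0 : ℝ) 1, G x t = 0) ∨
      ∀ t ∈ Icc (0 : ℝ) 1, |timeDeriv m (F x) t| ≤ C)
    (hB : ∀ x ∈ S, ∀ t ∈ Icc (0 : ℝ) 1, |G x t| ≤ B)
    (hG : ∀ x ∈ S, Tendsto (G x) (𝓝[>] 0) (𝓝 (G x 0)))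
    (hmeas : ∀ t ∈ Icc (0 : ℝ) 1, AEStronglyMeasurable (fun x => F x t * G x t) (μ.restrict S)) :
    Tendsto (fun t => (∫ x in S, F x t * G x t ∂μ) / t ^ m) (𝓝[>] 0)
      (𝓝 (∫ x in S, timeDeriv m (F x) 0 / m.factorial * G x 0 ∂μ)) := by
  have hfin : IsFiniteMeasure (μ.restrict S) := ⟨by simpa using hμS⟩
  have hI : ∀ᶠ t in 𝓝[>] (0 : ℝ), t ∈ Ioc (0 : ℝ) 1 := Ioc_mem_nhdsGT one_pos
  simp_rw [div_eq_mul_inv _ (_ ^ m), ← integral_mul_const]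
  refine tendsto_integral_filter_of_dominated_convergence (fun _ => |C| * |B|) ?_ ?_
    (integrable_const _) ?_
  · filter_upwards [hI] with t ht
    exact (hmeas t ⟨ht.1.le, ht.2⟩).mul_const _
  · filter_upwards [hI] with t ht
    refine (ae_restrict_iff' hS).2 (Eventually.of_forall fun x hx => ?_)
    have htI : t ∈ Icc (0 : ℝ) 1 := ⟨ht.1.le, ht.2⟩
    have hpow : 0 < t ^ m := pow_pos ht.1 m
    -- A bound on the derivative is required only where the weight is not identically zero. In the
    -- applications the potentials are controlled on compact subsets of `Ω` only.
    rcases hC x hx with hz | hb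
    · rw [hz t htI]
      simp only [mul_zero, zero_mul, norm_zero]
      positivity
    · have h1 := abs_le_mul_pow_of_timeDeriv_eq_zero (hF x hx) (h0 x hx) hb htI
      rw [Real.norm_eq_abs, abs_mul, abs_mul, abs_inv, abs_of_pos hpow, ← div_eq_mul_inv,
        div_le_iff₀ hpow]
      have h2 : |F x t| ≤ |C| * t ^ m :=
        h1.trans (mul_le_mul_of_nonneg_right (le_abs_self C) hpow.le)
      calc |F x t| * |G x t| ≤ |C| * t ^ m * |B| :=
            mul_le_mul h2 ((hB x hx t htI).trans (le_abs_self B)) (abs_nonneg _) (by positivity)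
        _ = |C| * |B| * t ^ m := by ring
  · refine (ae_restrict_iff' hS).2 (Eventually.of_forall fun x hx => ?_)
    refine ((tendsto_div_pow_of_timeDeriv_eq_zero (hF x hx) (h0 x hx)).mul (hG x hx)).congr
      fun t => ?_
    ring

end TimeDerivatives

/-! ### The leading order of the difference of two distributions -/

section LeadingOrder

variable {d N : ℕ} {Ω A : Set (Space d)} {m : Environment d} {V V' : Space d → ℝ → ℝ}
  {P P' : Config N d → ℝ → ℝ} {χ : Config N d → ℝ} {t : ℝ} {x₀ : Space d}

theorem tendsto_slice_nhdsGT {X F : Type*} [TopologicalSpace X] [TopologicalSpace F] {S : Set X}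
    {g : X → ℝ → F} (hg : ContinuousOn (fun p : X × ℝ => g p.1 p.2) (S ×ˢ Ici 0)) {x : X}
    (hx : x ∈ S) : Tendsto (g x) (𝓝[>] 0) (𝓝 (g x 0)) := by
  have h : ContinuousOn (g x) (Ici 0) :=
    ContinuousOn.comp (g := fun p : X × ℝ => g p.1 p.2) (f := fun t => (x, t)) hg
      (by fun_prop) fun t ht => ⟨hx, ht⟩
  exact (h 0 self_mem_Ici).mono_left (nhdsWithin_mono _ Ioi_subset_Ici_self)

theorem IsAnalyticallyAccessible.contDiffOn_potential (h : IsAnalyticallyAccessible m Ω V P)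
    {x : Space d} (hx : x ∈ Ω) (n : ℕ) : ContDiffOn ℝ n (V x) (Ici 0) :=
  contDiffOn_of_timeDeriv (fun k => (h.potential_contDiff k).contDiffOn_time hx) n

theorem IsAnalyticallyAccessible.contDiffOn_time (h : IsAnalyticallyAccessible m Ω V P)
    {x : Config N d} (hN : 1 ≤ N) (hx : x ∈ configSpace Ω N) (n : ℕ) :
    ContDiffOn ℝ n (P x) (Ici 0) :=
  contDiffOn_of_timeDeriv (fun k => (h.contDiff_timeDeriv hN k).contDiffOn_time hx) n

theorem timeDeriv_potential_difference (h : IsAnalyticallyAccessible m Ω V P)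
    (h' : IsAnalyticallyAccessible m Ω V' P') {x : Space d} (hx : x ∈ Ω) (k : ℕ) (ht : 0 ≤ t) :
    timeDeriv k (fun s => V x s - V' x s) t = timeDeriv k (V x) t - timeDeriv k (V' x) t :=
  timeDeriv_sub (h.contDiffOn_potential hx k) (h'.contDiffOn_potential hx k) ht

/-- The potential difference relative to its value at a reference point. -/
theorem timeDeriv_relative_potential (h : IsAnalyticallyAccessible m Ω V P)
    (h' : IsAnalyticallyAccessible m Ω V' P') {x : Space d} (hx : x ∈ Ω) (hx₀ : x₀ ∈ Ω) (k : ℕ)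
    (ht : 0 ≤ t) : timeDeriv k (fun s => V x s - V' x s - (V x₀ s - V' x₀ s)) t =
      timeDeriv k (fun s => V x s - V' x s) t - timeDeriv k (fun s => V x₀ s - V' x₀ s) t :=
  timeDeriv_sub ((h.contDiffOn_potential hx k).sub (h'.contDiffOn_potential hx k))
    ((h.contDiffOn_potential hx₀ k).sub (h'.contDiffOn_potential hx₀ k)) ht

theorem exists_bound_relative_potential (h : IsAnalyticallyAccessible m Ω V P)
    (h' : IsAnalyticallyAccessible m Ω V' P') (hA : IsCompact A) (hAΩ : A ⊆ Ω) (hx₀ : x₀ ∈ Ω)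
    (k : ℕ) : ∃ C : ℝ, ∀ x ∈ A, ∀ t ∈ Icc (0 : ℝ) 1,
      |timeDeriv k (fun s => V x s - V' x s - (V x₀ s - V' x₀ s)) t| ≤ C := by
  have hc : ContinuousOn (fun p : Space d × ℝ =>
      timeDeriv k (fun s => V p.1 s - V' p.1 s) p.2) (Ω ×ˢ Ici 0) :=
    ((h.potential_contDiff k).continuousOn.sub (h'.potential_contDiff k).continuousOn).congr
      fun p hp => timeDeriv_potential_difference h h' hp.1 k hp.2
  obtain ⟨C₁, -, h₁⟩ := exists_bound_on_compact
    (g := fun x t => timeDeriv k (fun s => V x s - V' x s) t) hc hA hAΩ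
  obtain ⟨C₂, -, h₂⟩ := exists_bound_on_compact
    (g := fun x t => timeDeriv k (fun s => V x s - V' x s) t) hc isCompact_singleton
    (singleton_subset_iff.2 hx₀)
  refine ⟨C₁ + C₂, fun x hx t ht => ?_⟩
  rw [timeDeriv_relative_potential h h' (hAΩ hx) hx₀ k ht.1]
  exact (abs_sub _ _).trans (add_le_add (h₁ x hx t ht) (h₂ x₀ rfl t ht))

theorem tendsto_adjointOp (hΩ : IsOpen Ω) (h : IsAnalyticallyAccessible m Ω V P) (i : Fin N)
    {x : Config N d} (hx : x ∈ configSpace Ω N) :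
    Tendsto (adjointOp m V χ i x) (𝓝[>] 0) (𝓝 (adjointOp m V χ i x 0)) := by
  have hV := h.potential_contDiff 0
  have hR := h.R_contDiff 0
  simp only [timeDeriv_zero] at hV hR
  have h1 := tendsto_slice_nhdsGT (g := fun x t => gradient (fun z => V z t) x)
    (hV.continuousOn_gradient hΩ (by norm_num)) (hx i trivial)
  have h2 := tendsto_slice_nhdsGT hR.continuousOn (hx i trivial)
  exact tendsto_const_nhds.add (tendsto_const_nhds.mul
    (tendsto_const_nhds.inner ((h1.neg.add h2).add_const _)))

theorem tendsto_weightedLaplace (hΩ : IsOpen Ω) (h : IsWellBehaved m Ω V P) (i : Fin N)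
    {x : Config N d} (hx : x ∈ configSpace Ω N) :
    Tendsto (weightedLaplace P χ i x) (𝓝[>] 0) (𝓝 (weightedLaplace P χ i x 0)) := by
  have h1 := tendsto_slice_nhdsGT (g := fun x t => gradAt i (fun y => P y t) x)
    (h.contDiff.continuousOn_gradAt (isOpen_configSpace hΩ N) (by norm_num) i) hx
  have h2 := tendsto_slice_nhdsGT h.contDiff.continuousOn hx
  exact (h1.inner tendsto_const_nhds).add (h2.mul tendsto_const_nhds)

/-- The leading order in time of the difference of two distributions is driven by the leading order
of the difference of the potentials. -/
theorem setIntegral_testFunction_mul_timeDeriv_succ (hΩ : IsSmoothBoundedDomain Ω)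
    (hm : m.IsAdmissible Ω) (hN : 1 ≤ N)
    (hP : IsAnalyticallyAccessibleSystem m Ω V P) (hP' : IsAnalyticallyAccessibleSystem m Ω V' P')
    (hχ : IsTestFunction Ω A χ) (hx₀ : x₀ ∈ Ω) {k : ℕ}
    (hd : ∀ j < k, ∀ x ∈ Ω, potentialDiff V V' j x = potentialDiff V V' j x₀)
    (hw : ∀ j ≤ k, ∀ x ∈ configSpace Ω N, timeDeriv j (fun s => P x s - P' x s) 0 = 0) :
    ∫ x in configSpace Ω N, timeDeriv (k + 1) (fun s => P x s - P' x s) 0 * χ x =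
      m.D * (m.β * ∑ i, ∫ x in configSpace Ω N,
        (potentialDiff V V' k (x i) - potentialDiff V V' k x₀) * weightedLaplace P' χ i x 0) := by
  have ho := isOpen_configSpace hΩ.isOpen N
  have hfin := configSpace_measure_lt_top hΩ.isBounded N
  have hA := hP.accessible
  have hA' := hP'.accessible
  have cw : ∀ x ∈ configSpace Ω N, ∀ n : ℕ, ContDiffOn ℝ n (fun s => P x s - P' x s) (Ici 0) :=
    fun x hx n => (hA.contDiffOn_time hN hx n).sub (hA'.contDiffOn_time hN hx n)
  have dw : ∀ x ∈ configSpace Ω N, ∀ n : ℕ, ∀ t : ℝ, 0 ≤ t →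
      timeDeriv n (fun s => P x s - P' x s) t = timeDeriv n (P x) t - timeDeriv n (P' x) t :=
    fun x hx n t ht =>
      timeDeriv_sub (hA.contDiffOn_time hN hx n) (hA'.contDiffOn_time hN hx n) ht
  have bw : ∀ n : ℕ, ∃ C : ℝ, ∀ x ∈ configSpace Ω N, ∀ t : ℝ, 0 ≤ t →
      |timeDeriv n (fun s => P x s - P' x s) t| ≤ C := by
    intro n
    obtain ⟨C₁, -, h₁⟩ := hA.bounded_timeDeriv hN n
    obtain ⟨C₂, -, h₂⟩ := hA'.bounded_timeDeriv hN n
    refine ⟨C₁ + C₂, fun x hx t ht => ?_⟩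
    rw [dw x hx n t ht]
    exact (abs_sub _ _).trans (add_le_add (h₁ x hx t ht) (h₂ x hx t ht))
  -- The weak equation is divided by `t ^ k` and each of its terms has a limit as `t` decreases to
  -- `0`. This avoids differentiating the weak equation in time.
  have lim1 : Tendsto (fun t => (∫ x in configSpace Ω N,
      timeDeriv 1 (fun s => P x s - P' x s) t * χ x) / t ^ k) (𝓝[>] 0)
      (𝓝 (∫ x in configSpace Ω N,
        timeDeriv k (timeDeriv 1 (fun s => P x s - P' x s)) 0 / k.factorial * χ x)) := by
    obtain ⟨C, hC⟩ := bw (k + 1)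
    obtain ⟨B, -, hB⟩ := exists_bound_on_configSpace (N := N) hΩ.isBounded hχ.contDiff.continuous
    refine tendsto_setIntegral_mul_div_pow (C := C) (B := B) ho.measurableSet hfin
      (G := fun x _ => χ x)
      (fun x hx => contDiffOn_timeDeriv_one (cw x hx _))
      (fun x hx j hj => by rw [← timeDeriv_succ]; exact hw _ (by omega) x hx)
      (fun x hx => Or.inr fun t ht => by rw [← timeDeriv_succ]; exact hC x hx t ht.1)
      (fun x hx t _ => hB x hx) (fun x _ => tendsto_const_nhds) fun t ht => ?_
    refine ContinuousOn.aestronglyMeasurable (ContinuousOn.mul ?_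
      hχ.contDiff.continuous.continuousOn) ho.measurableSet
    exact (((hA.contDiff_timeDeriv hN 1).slice ht.1).continuousOn.sub
      ((hA'.contDiff_timeDeriv hN 1).slice ht.1).continuousOn).congr fun x hx => dw x hx 1 t ht.1
  -- The transport term is of higher order, because the derivatives of `P - P'` vanish through order
  -- `k`, the power divided out.
  have lim2 : ∀ i, Tendsto (fun t => (∫ x in configSpace Ω N,
      (P x t - P' x t) * adjointOp m V χ i x t) / t ^ k) (𝓝[>] 0) (𝓝 0) := by
    intro i
    obtain ⟨C, hC⟩ := bw k
    obtain ⟨B, -, hB⟩ := exists_bound_adjointOp hΩ hm hP hχ i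
    have := tendsto_setIntegral_mul_div_pow (C := C) (B := B) ho.measurableSet hfin
      (F := fun x t => P x t - P' x t) (G := adjointOp m V χ i) (fun x hx => cw x hx k)
      (fun x hx j hj => hw _ hj.le x hx) (fun x hx => Or.inr fun t ht => hC x hx t ht.1)
      hB (fun x hx => tendsto_adjointOp hΩ.isOpen hA i hx)
      fun t ht => (integrableOn_adjointOp hΩ hm hP hP' hχ ht i).1
    rwa [setIntegral_eq_zero_of_forall_eq_zero fun x hx => by
      rw [hw k le_rfl x hx, zero_div, zero_mul]] at this
  -- Subtracting the value at `x₀` removes the part of the potential difference that depends on time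
  -- only, so its derivatives below order `k` vanish.
  have lim3 : ∀ i, Tendsto (fun t => (∫ x in configSpace Ω N,
      (V (x i) t - V' (x i) t - (V x₀ t - V' x₀ t)) * weightedLaplace P' χ i x t) / t ^ k)
      (𝓝[>] 0) (𝓝 (∫ x in configSpace Ω N,
        (potentialDiff V V' k (x i) - potentialDiff V V' k x₀) / k.factorial *
          weightedLaplace P' χ i x 0)) := by
    intro i
    obtain ⟨C, hC⟩ := exists_bound_relative_potential hA hA' hχ.isCompact hχ.subset hx₀ k
    obtain ⟨B, -, hB⟩ := exists_bound_weightedLaplace hΩ hP' hχ i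
    have := tendsto_setIntegral_mul_div_pow (C := C) (B := B) (m := k) ho.measurableSet hfin
      (F := fun (x : Config N d) t => V (x i) t - V' (x i) t - (V x₀ t - V' x₀ t))
      (G := weightedLaplace P' χ i)
      (fun x hx => ((hA.contDiffOn_potential (hx i trivial) k).sub
        (hA'.contDiffOn_potential (hx i trivial) k)).sub
        ((hA.contDiffOn_potential hx₀ k).sub (hA'.contDiffOn_potential hx₀ k)))
      (fun x hx j hj => by
        rw [timeDeriv_relative_potential hA hA' (hx i trivial) hx₀ j le_rfl]
        exact sub_eq_zero.2 (hd j hj _ (hx i trivial)))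
      (fun x hx => by
        by_cases hxA : x i ∈ A
        · exact Or.inr (hC _ hxA)
        · exact Or.inl fun t _ => hχ.weightedLaplace_eq_zero hxA)
      (fun x hx t ht => hB x hx t ht.1)
      (fun x hx => tendsto_weightedLaplace hΩ.isOpen hP'.wellBehaved i hx)
      fun t ht => (integrableOn_weightedLaplace (g := fun z => V z t - V' z t -
        (V x₀ t - V' x₀ t)) hΩ hP' hχ ht.1 i (((hP.potential.contDiff t ht.1).continuousOn.sub
        (hP'.potential.contDiff t ht.1).continuousOn).sub continuousOn_const)).1
    rwa [setIntegral_congr_fun ho.measurableSet fun x hx => by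
      rw [timeDeriv_relative_potential hA hA' (hx i trivial) hx₀ k le_rfl]] at this
  have lim4 := (tendsto_finsetSum Finset.univ fun i _ =>
    (lim2 i).add ((lim3 i).const_mul m.β)).const_mul m.D
  have heq := tendsto_nhds_unique_of_eventuallyEq lim1 lim4 (by
    filter_upwards [Ioc_mem_nhdsGT (one_pos : (0 : ℝ) < 1)] with t ht
    have := setIntegral_testFunction_mul_timeDeriv hΩ hm hP hP' hχ ⟨ht.1.le, ht.2⟩
      (V x₀ t - V' x₀ t)
    rw [setIntegral_congr_fun (g := fun x => χ x * (timeDeriv 1 (P x) t - timeDeriv 1 (P' x) t))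
      ho.measurableSet fun x hx => by rw [dw x hx 1 t ht.1.le, mul_comm], this, mul_div_assoc,
      Finset.sum_div]
    simp only [add_div, mul_div_assoc])
  have hfac : (k.factorial : ℝ) ≠ 0 := by positivity
  simp only [div_mul_eq_mul_div, integral_div, zero_add, ← mul_div_assoc] at heq
  rw [← Finset.sum_div, ← mul_div_assoc, div_left_inj' hfac, ← Finset.mul_sum] at heq
  simp only [timeDeriv_succ k]
  exact heq

end LeadingOrder

/-! ### Vanishing of the initial derivatives of the difference -/

section InitialDerivatives

variable {d N : ℕ} {Ω A : Set (Space d)} {m : Environment d} {V V' : Space d → ℝ → ℝ}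
  {P P' : Config N d → ℝ → ℝ} {χ : Config N d → ℝ} {t : ℝ} {x₀ : Space d}

/-- The union of the coordinate projections of the support is one compact subset of `Ω` that serves
all particles. -/
theorem isTestFunction_of_hasCompactSupport (hχ : ContDiff ℝ ∞ χ) (hc : HasCompactSupport χ)
    (hs : tsupport χ ⊆ configSpace Ω N) :
    IsTestFunction Ω (⋃ i : Fin N, (fun x => x i) '' tsupport χ) χ where
  contDiff := hχ
  isCompact := isCompact_iUnion fun i => hc.isCompact.image (continuous_apply i)
  subset := iUnion_subset fun i => by
    rintro _ ⟨x, hx, rfl⟩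
    exact hs hx i trivial
  slices := fun i => Or.inr fun x hx => by
    by_contra hne
    exact hx (mem_iUnion.2 ⟨i, x, subset_tsupport _ hne, rfl⟩)

/-- The fundamental lemma of the calculus of variations gives vanishing almost everywhere;
continuity on an open set does the rest. -/
theorem eq_zero_of_forall_setIntegral_testFunction_eq_zero {E : Type*} [NormedAddCommGroup E]
    [NormedSpace ℝ E] [FiniteDimensional ℝ E] [MeasurableSpace E] [BorelSpace E]
    {μ : Measure E} [μ.IsOpenPosMeasure] [IsFiniteMeasureOnCompacts μ] {S : Set E} (hS : IsOpen S)
    {f : E → ℝ} (hf : ContinuousOn f S)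
    (h : ∀ g : E → ℝ, ContDiff ℝ ∞ g → HasCompactSupport g → tsupport g ⊆ S →
      ∫ x in S, g x * f x ∂μ = 0) {x : E} (hx : x ∈ S) : f x = 0 := by
  have hae := hS.ae_eq_zero_of_integral_contDiff_smul_eq_zero (f := f) (μ := μ)
    (hf.locallyIntegrableOn hS.measurableSet) fun g hg hgc hgs => by
      rw [← h g hg hgc hgs, setIntegral_eq_integral_of_forall_compl_eq_zero]
      · rfl
      · intro y hy
        rw [image_eq_zero_of_notMem_tsupport fun hy' => hy (hgs hy'), zero_mul]
  have hae' : f =ᵐ[μ.restrict S] 0 := (ae_restrict_iff' hS.measurableSet).2 hae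
  exact Measure.eqOn_open_of_ae_eq hae' hS hf continuousOn_const hx

/-- As long as the time derivatives of the potentials agree up to constants at the initial time, so
do the time derivatives of the distributions. -/
theorem timeDeriv_difference_eq_zero (hΩ : IsSmoothBoundedDomain Ω)
    (hm : m.IsAdmissible Ω) (hN : 1 ≤ N)
    (hP : IsAnalyticallyAccessibleSystem m Ω V P) (hP' : IsAnalyticallyAccessibleSystem m Ω V' P')
    (hinit : ∀ x ∈ configSpace Ω N, P x 0 = P' x 0) (hx₀ : x₀ ∈ Ω) {l : ℕ}
    (hd : ∀ j < l, ∀ x ∈ Ω, potentialDiff V V' j x = potentialDiff V V' j x₀) :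
    ∀ j ≤ l, ∀ x ∈ configSpace Ω N, timeDeriv j (fun s => P x s - P' x s) 0 = 0 := by
  intro j
  induction j using Nat.strong_induction_on with
  | _ j ih =>
    intro hj x hx
    rcases Nat.eq_zero_or_eq_succ_pred j with rfl | hs
    · simp [timeDeriv_zero, hinit x hx]
    obtain ⟨k, rfl⟩ : ∃ k, j = k + 1 := ⟨_, hs⟩
    have ho := isOpen_configSpace hΩ.isOpen N
    have hA := hP.accessible
    have hA' := hP'.accessible
    refine eq_zero_of_forall_setIntegral_testFunction_eq_zero (μ := volume) ho
      (f := fun x => timeDeriv (k + 1) (fun s => P x s - P' x s) 0) ?_ (fun g hg hgc hgs => ?_) hx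
    · exact (((hA.contDiff_timeDeriv hN (k + 1)).slice le_rfl).continuousOn.sub
        ((hA'.contDiff_timeDeriv hN (k + 1)).slice le_rfl).continuousOn).congr fun x hx =>
        timeDeriv_sub (hA.contDiffOn_time hN hx _) (hA'.contDiffOn_time hN hx _) le_rfl
    -- Since `k + 1 ≤ l`, the driving derivative of the potential difference has order `k < l` and
    -- is spatially constant, so the right side vanishes.
    · have key := setIntegral_testFunction_mul_timeDeriv_succ hΩ hm hN hP hP'
        (isTestFunction_of_hasCompactSupport hg hgc hgs) hx₀ (k := k)
        (fun j hj => hd j (by omega)) (fun j hj => ih j (by omega) (by omega))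
      simp only [mul_comm (g _)]
      rw [key, Finset.sum_eq_zero, mul_zero, mul_zero]
      intro i _
      refine setIntegral_eq_zero_of_forall_eq_zero fun y hy => ?_
      rw [hd k (by omega) _ (hy i trivial), sub_self, zero_mul]

end InitialDerivatives

/-! ### The equation for the one-body density -/

section OneBody

variable {d M : ℕ} {Ω A : Set (Space d)} {m : Environment d} {V V' : Space d → ℝ → ℝ}
  {P P' : Config (M + 1) d → ℝ → ℝ} {φ : Space d → ℝ} {t : ℝ} {x₀ : Space d}

theorem density_eq_setIntegral_cons (Ω : Set (Space d)) (P : Config (M + 1) d → ℝ → ℝ)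
    (z : Space d) (t : ℝ) : density Ω P z t =
      ((M + 1 : ℕ) : ℝ) * ∫ y in configSpace Ω M, P (Fin.cons z y : Config (M + 1) d) t := by
  have hg : ∀ y : Config M d,
      glue (M + 1) (n := 1) (fun _ => z) y = (Fin.cons z y : Config (M + 1) d) := fun y => by
    ext1 i
    refine Fin.cases ?_ (fun j => ?_) i
    · simp [glue]
    · simp only [glue, Fin.val_succ, Fin.cons_succ]
      rw [dif_neg (by omega)]
      congr 1
  rw [density, reducedDensity, Nat.descFactorial_one]
  congr 1
  exact integral_congr_ae (Eventually.of_forall fun y => congrArg (fun x => P x t) (hg y))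

theorem cons_mem_configSpace {z : Space d} (hz : z ∈ Ω) {y : Config M d}
    (hy : y ∈ configSpace Ω M) : (Fin.cons z y : Config (M + 1) d) ∈ configSpace Ω (M + 1) := by
  rw [← Fin.insertNth_zero']
  exact (insertNth_mem_configSpace_iff 0 z y).2 ⟨hz, hy⟩

theorem integrableOn_cons (hΩ : IsSmoothBoundedDomain Ω)
    (hP : IsAnalyticallyAccessibleSystem m Ω V P) {z : Space d} (hz : z ∈ Ω) (ht : 0 ≤ t) :
    IntegrableOn (fun y => P (Fin.cons z y : Config (M + 1) d) t) (configSpace Ω M) := by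
  obtain ⟨C, -, hC⟩ := hP.accessible.bounded_timeDeriv (by omega) 0
  simp only [timeDeriv_zero] at hC
  refine integrableOn_configSpace_of_bound hΩ ?_ fun y hy => hC _ (cons_mem_configSpace hz hy) t ht
  refine (hP.wellBehaved.contDiff.slice ht).continuousOn.comp (Continuous.continuousOn ?_)
    fun y hy => cons_mem_configSpace hz hy
  exact continuous_const.finCons continuous_id

theorem density_pos (hΩ : IsSmoothBoundedDomain Ω) (hP : IsAnalyticallyAccessibleSystem m Ω V P)
    (ht : 0 ≤ t) (hpos : ∀ x ∈ configSpace Ω (M + 1), 0 < P x t) {z : Space d} (hz : z ∈ Ω) :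
    0 < density Ω P z t := by
  rw [density_eq_setIntegral_cons]
  have ho := isOpen_configSpace hΩ.isOpen M
  refine mul_pos (by positivity) ?_
  rw [setIntegral_pos_iff_support_of_nonneg_ae
    ((ae_restrict_iff' ho.measurableSet).2 (Eventually.of_forall fun y hy =>
      (hpos _ (cons_mem_configSpace hz hy)).le)) (integrableOn_cons hΩ hP hz ht)]
  refine (ho.measure_pos volume ⟨fun _ => z, fun _ _ => hz⟩).trans_le (measure_mono fun y hy => ?_)
  exact ⟨(hpos _ (cons_mem_configSpace hz hy)).ne', hy⟩

theorem density_contDiffOn (hP : IsAnalyticallyAccessible m Ω V P) (ht : 0 ≤ t) :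
    ContDiffOn ℝ 2 (fun z => density Ω P z t) Ω := by
  have h := (hP.densities_contDiff 1 le_rfl (by omega) 0).slice ht
  simp only [timeDeriv_zero] at h
  exact h.comp (contDiff_pi.2 fun _ => contDiff_id).contDiffOn fun z hz _ _ => hz

theorem setIntegral_configSpace_eq_density (hΩ : IsSmoothBoundedDomain Ω)
    (hP : IsAnalyticallyAccessibleSystem m Ω V P) (ht : 0 ≤ t) {g : Space d → ℝ}
    (hg : ContinuousOn g Ω) {C : ℝ} (hC : ∀ z ∈ Ω, |g z| ≤ C) :
    IntegrableOn (fun x => P x t * g (x 0)) (configSpace Ω (M + 1)) ∧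
    ((M + 1 : ℕ) : ℝ) * ∫ x in configSpace Ω (M + 1), P x t * g (x 0) =
      ∫ z in Ω, density Ω P z t * g z := by
  obtain ⟨B, hB0, hB⟩ := hP.accessible.bounded_timeDeriv (by omega) 0
  simp only [timeDeriv_zero] at hB
  have hi : IntegrableOn (fun x => P x t * g (x 0)) (configSpace Ω (M + 1)) :=
    integrableOn_configSpace_of_bound hΩ ((hP.wellBehaved.contDiff.slice ht).continuousOn.mul
      (continuousOn_comp_particle hg 0)) (C := B * C) fun x hx => by
        rw [abs_mul]
        exact mul_le_mul (hB x hx t ht) (hC _ (hx 0 trivial)) (abs_nonneg _) hB0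
  refine ⟨hi, ?_⟩
  rw [setIntegral_configSpace_cons hi, ← integral_const_mul]
  refine integral_congr_ae (Eventually.of_forall fun z => ?_)
  simp only [Fin.cons_zero, integral_mul_const, density_eq_setIntegral_cons]
  ring

/-- Not compactly supported in the other particles; this is why test functions may be constant in a
position, and where the boundary condition is needed. -/
theorem isTestFunction_particle_zero (hφ : ContDiff ℝ ∞ φ) (hA : IsCompact A) (hAΩ : A ⊆ Ω)
    (hφA : ∀ z ∉ A, φ z = 0) : IsTestFunction Ω A (fun x : Config (M + 1) d => φ (x 0)) where
  contDiff := hφ.comp (contDiff_apply ℝ (Space d) 0)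
  isCompact := hA
  subset := hAΩ
  slices := fun i => by
    by_cases hi : i = 0
    · subst hi
      exact Or.inr fun x hx => hφA _ hx
    · exact Or.inl fun x z => by rw [Function.update_of_ne (Ne.symm hi)]

theorem potentialDiff_contDiffOn {N : ℕ} {P P' : Config N d → ℝ → ℝ} (h : IsAnalyticallyAccessible m Ω V P)
    (h' : IsAnalyticallyAccessible m Ω V' P') (k : ℕ) :
    ContDiffOn ℝ 2 (potentialDiff V V' k) Ω :=
  (((h.potential_contDiff k).slice le_rfl).sub ((h'.potential_contDiff k).slice le_rfl)).congr
    fun _ hx => timeDeriv_potential_difference h h' hx k le_rfl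

/-- If the one-body densities agree, then the first time derivative of the potential difference
that is not spatially constant solves a weighted Laplace equation. -/
theorem divergence_density_smul_gradient_potentialDiff_eq_zero (hΩ : IsSmoothBoundedDomain Ω)
    (hm : m.IsAdmissible Ω)
    (hP : IsAnalyticallyAccessibleSystem m Ω V P) (hP' : IsAnalyticallyAccessibleSystem m Ω V' P')
    (hinit : ∀ x ∈ configSpace Ω (M + 1), P x 0 = P' x 0) (hx₀ : x₀ ∈ Ω) {l : ℕ}
    (hd : ∀ j < l, ∀ x ∈ Ω, potentialDiff V V' j x = potentialDiff V V' j x₀)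
    (hρ : ∀ z ∈ Ω, ∀ t : ℝ, 0 ≤ t → density Ω P z t = density Ω P' z t) {z : Space d}
    (hz : z ∈ Ω) :
    divergence (fun z => density Ω P z 0 • gradient (potentialDiff V V' l) z) z = 0 := by
  have hN : 1 ≤ M + 1 := by omega
  have ho := isOpen_configSpace hΩ.isOpen (M + 1)
  have hfin := configSpace_measure_lt_top hΩ.isBounded (M + 1)
  have hA := hP.accessible
  have hA' := hP'.accessible
  have cf := potentialDiff_contDiffOn hA hA' l
  set f := potentialDiff V V' l with hf
  have gf := gradient_contDiffOn (m := 1) hΩ.isOpen cf (by norm_num)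
  have cρ := density_contDiffOn hA (t := 0) le_rfl
  have cX : ContDiffOn ℝ 1 (fun z => density Ω P z 0 • gradient f z) Ω :=
    (cρ.of_le (by norm_num)).smul gf
  refine eq_zero_of_forall_setIntegral_testFunction_eq_zero (μ := volume) hΩ.isOpen
    (continuousOn_divergence hΩ.isOpen cX) (fun φ hφ hφc hφs => ?_) hz
  set A := tsupport φ with hAdef
  have hAc : IsCompact A := hφc.isCompact
  have hφA : ∀ z ∉ A, φ z = 0 := fun z hz => image_eq_zero_of_notMem_tsupport hz
  have hχ : IsTestFunction Ω A (fun x : Config (M + 1) d => φ (x 0)) :=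
    isTestFunction_particle_zero hφ hAc hφs hφA
  have hw := timeDeriv_difference_eq_zero hΩ hm hN hP hP' hinit hx₀ hd
  have key := setIntegral_testFunction_mul_timeDeriv_succ hΩ hm hN hP hP' hχ hx₀ hd hw
  have cφ := hφ.continuous
  obtain ⟨B, hB⟩ := hφc.exists_bound_of_continuous cφ
  -- Tested against a function of one particle, `P - P'` reduces to the difference of the densities,
  -- which is zero at all times. So its coefficient of order `t ^ (l + 1)` vanishes too.
  have lhs : ∫ x in configSpace Ω (M + 1),
      timeDeriv (l + 1) (fun s => P x s - P' x s) 0 * φ (x 0) = 0 := by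
    have hv : ∀ t : ℝ, 0 ≤ t → ∫ x in configSpace Ω (M + 1), (P x t - P' x t) * φ (x 0) = 0 := by
      intro t ht
      obtain ⟨i1, e1⟩ := setIntegral_configSpace_eq_density hΩ hP ht cφ.continuousOn
        (C := B) fun z _ => hB z
      obtain ⟨i2, e2⟩ := setIntegral_configSpace_eq_density hΩ hP' ht cφ.continuousOn
        (C := B) fun z _ => hB z
      have e3 : ∫ z in Ω, density Ω P z t * φ z = ∫ z in Ω, density Ω P' z t * φ z :=
        setIntegral_congr_fun hΩ.isOpen.measurableSet fun z hz => by rw [hρ z hz t ht]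
      rw [← e1, ← e2] at e3
      simp only [sub_mul]
      rw [integral_sub i1 i2, sub_eq_zero]
      exact mul_left_cancel₀ (by positivity) e3
    have dw : ∀ x ∈ configSpace Ω (M + 1), ∀ t : ℝ, 0 ≤ t →
        timeDeriv (l + 1) (fun s => P x s - P' x s) t =
          timeDeriv (l + 1) (P x) t - timeDeriv (l + 1) (P' x) t := fun x hx t ht =>
      timeDeriv_sub (hA.contDiffOn_time hN hx _) (hA'.contDiffOn_time hN hx _) ht
    obtain ⟨C₁, -, h₁⟩ := hA.bounded_timeDeriv hN (l + 1)
    obtain ⟨C₂, -, h₂⟩ := hA'.bounded_timeDeriv hN (l + 1)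
    have lim := tendsto_setIntegral_mul_div_pow (m := l + 1) (C := C₁ + C₂) (B := B)
      (μ := volume) ho.measurableSet hfin (F := fun x t => P x t - P' x t)
      (G := fun x _ => φ (x 0))
      (fun x hx => (hA.contDiffOn_time hN hx _).sub (hA'.contDiffOn_time hN hx _))
      (fun x hx j hj => hw j (by omega) x hx)
      (fun x hx => Or.inr fun t ht => by
        rw [dw x hx t ht.1]
        exact (abs_sub _ _).trans (add_le_add (h₁ x hx t ht.1) (h₂ x hx t ht.1)))
      (fun x _ t _ => hB _) (fun x _ => tendsto_const_nhds) fun t ht =>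
        ContinuousOn.aestronglyMeasurable
          (((hP.wellBehaved.contDiff.slice ht.1).continuousOn.sub
            (hP'.wellBehaved.contDiff.slice ht.1).continuousOn).mul
            hχ.contDiff.continuous.continuousOn) ho.measurableSet
    have lim0 := tendsto_nhds_unique_of_eventuallyEq lim tendsto_const_nhds (b := 0) (by
      filter_upwards [self_mem_nhdsWithin] with t ht
      rw [hv t (le_of_lt ht), zero_div])
    simp only [div_mul_eq_mul_div, integral_div] at lim0
    exact (div_eq_zero_iff.1 lim0).resolve_right (by positivity)
  -- Only the particle on which the test function depends contributes to the sum.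
  rw [lhs, Finset.sum_eq_single 0 (fun i _ hi => by
    refine setIntegral_eq_zero_of_forall_eq_zero fun x _ => ?_
    have hc : ∀ (x : Config (M + 1) d) z, (fun x : Config (M + 1) d => φ (x 0))
        (Function.update x i z) = (fun x : Config (M + 1) d => φ (x 0)) x := fun x z => by
      simp only [Function.update_of_ne (Ne.symm hi)]
    rw [weightedLaplace, gradAt_eq_zero_of_slice_const (χ := fun x : Config (M + 1) d => φ (x 0)) hc,
      laplaceAt_eq_zero_of_slice_const (χ := fun x : Config (M + 1) d => φ (x 0)) hc]
    simp only [inner_zero_right, mul_zero, add_zero])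
    (by simp)] at key
  have key2 : ∫ x in configSpace Ω (M + 1), (f (x 0) - f x₀) *
      weightedLaplace P' (fun x => φ (x 0)) 0 x 0 = 0 := by
    have := key.symm
    simpa [hm.D_pos.ne', hm.β_pos.ne'] using this
  have gφ : Continuous (gradient φ) := by
    rw [← continuousOn_univ]
    exact (gradient_contDiffOn (m := 1) isOpen_univ (contDiff_infty.1 hφ 2).contDiffOn
      (by norm_num)).continuousOn
  have g0 : ∀ z ∉ A, gradient φ z = 0 := fun z hz =>
    gradient_eq_zero_of_eventually hAc.isClosed hφA hz
  have cg : ContinuousOn (fun z => ⟪gradient φ z, gradient f z⟫) Ω :=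
    gφ.continuousOn.inner gf.continuousOn
  obtain ⟨C, hC⟩ := hAc.exists_bound_of_continuousOn (cg.mono hφs)
  have hC' : ∀ z ∈ Ω, |⟪gradient φ z, gradient f z⟫| ≤ max C 0 := by
    intro z _
    by_cases hzA : z ∈ A
    · exact (hC z hzA).trans (le_max_left _ _)
    · rw [g0 z hzA, inner_zero_left, abs_zero]
      exact le_max_right _ _
  obtain ⟨i1, e1⟩ := setIntegral_configSpace_eq_density hΩ hP' le_rfl cg hC'
  have i2 := integrableOn_weightedLaplace (g := fun z => f z - f x₀) hΩ hP' hχ le_rfl 0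
    (cf.continuousOn.sub continuousOn_const)
  -- Integration by parts in that position replaces the weighted Laplacian of `φ` by `-P' ∇φ · ∇f`.
  -- Integrating out the other particles turns `P'` into the density.
  have e2 := setIntegral_configSpace_eq_zero (i2.add i1) 0 fun x hx => by
    have h := setIntegral_weighted_laplacian hΩ.isOpen hAc hφs hφ hφA
      (contDiffOn_slice ((hP'.wellBehaved.contDiff.slice le_rfl).of_le one_le_two) hx 0)
      (cf.of_le (by norm_num)) (f x₀)
    refine Eq.trans (integral_congr_ae (Eventually.of_forall fun z => ?_)) h
    simp [weightedLaplace, gradAt_update, divAt_gradAt_update]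
  have e3 : (∫ x in configSpace Ω (M + 1), (f (x 0) - f x₀) *
      weightedLaplace P' (fun x => φ (x 0)) 0 x 0) + ∫ x in configSpace Ω (M + 1),
      P' x 0 * ⟪gradient φ (x 0), gradient f (x 0)⟫ = 0 :=
    (integral_add i2 i1).symm.trans e2
  rw [key2, zero_add] at e3
  rw [e3, mul_zero] at e1
  -- A second integration by parts moves the remaining derivative from `φ` onto `ρ ∇f`.
  have e4 : ∫ z in Ω, divergence (fun z => φ z • (density Ω P z 0 • gradient f z)) z = 0 :=
    setIntegral_divergence_eq_zero hΩ.isOpen ((contDiff_infty.1 hφ 1).contDiffOn.smul cX) hAc hφs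
      fun x hx => by rw [hφA x hx, zero_smul]
  have e5 : ∀ z ∈ Ω, divergence (fun z => φ z • (density Ω P z 0 • gradient f z)) z =
      density Ω P' z 0 * ⟪gradient φ z, gradient f z⟫ +
        φ z * divergence (fun z => density Ω P z 0 • gradient f z) z := by
    intro z hz
    rw [divergence_smul ((contDiff_infty.1 hφ 1).differentiable (by simp) z)
      ((cX.contDiffAt (hΩ.isOpen.mem_nhds hz)).differentiableAt (by simp)),
      real_inner_smul_right, ← hρ z hz 0 le_rfl, add_comm]
  have i5 : IntegrableOn
      (fun z => φ z * divergence (fun z => density Ω P z 0 • gradient f z) z) Ω :=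
    integrableOn_of_eq_zero_off_compact hAc ((cφ.continuousOn.mul
      (continuousOn_divergence hΩ.isOpen cX)).mono hφs) fun z hz => by
        rw [hφA z hz, zero_mul]
  have i6 : IntegrableOn (fun z => density Ω P' z 0 * ⟪gradient φ z, gradient f z⟫) Ω :=
    integrableOn_of_eq_zero_off_compact hAc
      (((density_contDiffOn hA' le_rfl).continuousOn.mul cg).mono hφs) fun z hz => by
        rw [g0 z hz, inner_zero_left, mul_zero]
  rw [setIntegral_congr_fun hΩ.isOpen.measurableSet e5, integral_add i6 i5, ← e1, zero_add] at e4
  exact e4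

end OneBody

/-! ### Spatially constant derivatives and the conclusion -/

section MainTheorem

variable {d N : ℕ} {Ω : Set (Space d)} {m : Environment d} {V V' : Space d → ℝ → ℝ}
  {P P' : Config N d → ℝ → ℝ} {x₀ : Space d}

theorem eq_of_gradient_eq_zero (hΩ : IsOpen Ω) (hc : IsConnected Ω) {f : Space d → ℝ}
    (hf : ContDiffOn ℝ 1 f Ω) (h : ∀ x ∈ Ω, gradient f x = 0) {x y : Space d} (hx : x ∈ Ω)
    (hy : y ∈ Ω) : f x = f y := by
  refine hΩ.is_const_of_fderiv_eq_zero hc.isPreconnected (hf.differentiableOn (by simp))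
    (fun z hz => ?_) hx hy
  simpa [gradient] using h z hz

/-- If all time derivatives of the potential difference are spatially constant at the initial time,
then the potential difference is spatially constant at all times. -/
theorem diffusionEquivalent_of_gradient_eq_zero (hΩ : IsSmoothBoundedDomain Ω)
    (h : IsAnalyticallyAccessible m Ω V P) (h' : IsAnalyticallyAccessible m Ω V' P')
    (hg : ∀ k, ∀ x ∈ Ω, gradient (potentialDiff V V' k) x = 0) (ρ : Space d → ℝ → ℝ) :
    DiffusionEquivalent Ω ρ V V' := by
  obtain ⟨x₀, hx₀⟩ := hΩ.isConnected.nonempty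
  refine ⟨fun t => V x₀ t - V' x₀ t, fun x hx t ht _ => sub_eq_zero.1 ?_⟩
  refine eq_zero_of_analyticOn_of_timeDeriv_eq_zero
    (u := fun s => V x s - V' x s - (V x₀ s - V' x₀ s))
    (((h.potential_analytic x hx).sub (h'.potential_analytic x hx)).sub
      ((h.potential_analytic x₀ hx₀).sub (h'.potential_analytic x₀ hx₀))) (fun k => ?_) ht
  rw [timeDeriv_relative_potential h h' hx hx₀ k le_rfl]
  exact sub_eq_zero.2 (eq_of_gradient_eq_zero hΩ.isOpen hΩ.isConnected
    ((potentialDiff_contDiffOn h h' k).of_le (by norm_num)) (hg k) hx hx₀)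

end MainTheorem

end Smoluchowski

theorem theorem4p3 {d N : ℕ} (hd : 1 ≤ d) (hN : 1 ≤ N)
    (Ω : Set (Smoluchowski.Space d)) (hΩ : Smoluchowski.IsSmoothBoundedDomain Ω)
    (m : Smoluchowski.Environment d) (hm : m.IsAdmissible Ω)
    (V V' : Smoluchowski.Space d → ℝ → ℝ) (P P' : Smoluchowski.Config N d → ℝ → ℝ)
    (hP : Smoluchowski.IsAnalyticallyAccessibleSystem m Ω V P)
    (hP' : Smoluchowski.IsAnalyticallyAccessibleSystem m Ω V' P')
    (hinit : ∀ x ∈ Smoluchowski.configSpace Ω N, P x 0 = P' x 0)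
    (hpos : ∀ x ∈ Smoluchowski.configSpace Ω N, 0 < P x 0)
    (hV : ¬ Smoluchowski.DiffusionEquivalent Ω (Smoluchowski.density Ω P) V V') :
    ∃ l : ℕ,
      IsLeast {k : ℕ | ∃ x ∈ Ω, gradient (Smoluchowski.potentialDiff V V' k) x ≠ 0} l ∧
      ((∃ G : Smoluchowski.Space d → Smoluchowski.Space d,
          ContinuousOn G (closure Ω) ∧
          (∀ x ∈ Ω, G x =
            (Smoluchowski.density Ω P x 0 * Smoluchowski.potentialDiff V V' l x) •
              gradient (Smoluchowski.potentialDiff V V' l) x) ∧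
          Smoluchowski.surfaceFlux Ω G = 0) →
        ∃ x ∈ Ω, ∃ t : ℝ, 0 ≤ t ∧
          Smoluchowski.density Ω P x t ≠ Smoluchowski.density Ω P' x t) := by
  open Smoluchowski in
  obtain ⟨n, rfl⟩ : ∃ n, d = n + 1 := ⟨d - 1, by omega⟩
  obtain ⟨M, rfl⟩ : ∃ M, N = M + 1 := ⟨N - 1, by omega⟩
  have hA := hP.accessible
  have hA' := hP'.accessible
  have hex : ∃ k, ∃ x ∈ Ω, gradient (potentialDiff V V' k) x ≠ 0 := by
    by_contra! h
    exact hV (diffusionEquivalent_of_gradient_eq_zero hΩ hA hA' h _)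
  classical
  refine ⟨Nat.find hex, ⟨Nat.find_spec hex, fun k hk => Nat.find_min' hex hk⟩, ?_⟩
  rintro ⟨G, hGc, hG, hflux⟩
  obtain ⟨x₁, hx₁, hne⟩ := Nat.find_spec hex
  set l := Nat.find hex with hl
  by_contra! hρ
  -- By minimality of `l` the lower derivatives have zero gradient, hence are constant on the
  -- connected set `Ω`. The point `x₁` with non-zero gradient at order `l` also serves as reference
  -- point.
  have hconst : ∀ j < l, ∀ x ∈ Ω, potentialDiff V V' j x = potentialDiff V V' j x₁ := by
    intro j hj x hx
    have hmin := Nat.find_min hex hj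
    push Not at hmin
    exact eq_of_gradient_eq_zero hΩ.isOpen hΩ.isConnected
      ((potentialDiff_contDiffOn hA hA' j).of_le (by norm_num)) hmin hx hx₁
  have cf := potentialDiff_contDiffOn hA hA' l
  set f := potentialDiff V V' l
  have gf := gradient_contDiffOn (m := 1) hΩ.isOpen cf (by norm_num)
  have cX : ContDiffOn ℝ 1 (fun z => density Ω P z 0 • gradient f z) Ω :=
    ((density_contDiffOn hA le_rfl).of_le (by norm_num)).smul gf
  have hG' : ∀ x ∈ Ω, G x = f x • (density Ω P x 0 • gradient f x) := fun x hx => by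
    rw [hG x hx, smul_smul, mul_comm]
  have cG : ContDiffOn ℝ 1 G Ω := ((cf.of_le (by norm_num)).smul cX).congr hG'
  -- In the product `f • (ρ₀ ∇f)` the second factor is divergence-free, so only `∇f · ρ₀ ∇f`
  -- remains.
  have hdiv : ∀ x ∈ Ω, divergence G x = density Ω P x 0 * ‖gradient f x‖ ^ 2 := by
    intro x hx
    rw [divergence_congr (Filter.eventually_of_mem (hΩ.isOpen.mem_nhds hx) hG'),
      divergence_smul ((cf.contDiffAt (hΩ.isOpen.mem_nhds hx)).differentiableAt (by simp))
        ((cX.contDiffAt (hΩ.isOpen.mem_nhds hx)).differentiableAt (by simp)),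
      divergence_density_smul_gradient_potentialDiff_eq_zero hΩ hm hP hP' hinit hx₁ hconst hρ hx,
      real_inner_smul_right, real_inner_self_eq_norm_sq, mul_zero, zero_add]
  have hρpos : ∀ x ∈ Ω, 0 < density Ω P x 0 := fun x hx => density_pos hΩ hP le_rfl hpos hx
  have h0 := hΩ.divergence_eq_zero_of_surfaceFlux_eq_zero hGc cG
    (fun x hx => by rw [hdiv x hx]; exact mul_nonneg (hρpos x hx).le (sq_nonneg _)) hflux hx₁
  rw [hdiv x₁ hx₁] at h0
  have h1 := (mul_eq_zero.1 h0).resolve_left (hρpos x₁ hx₁).ne'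
  exact hne (norm_eq_zero.1 (pow_eq_zero_iff two_ne_zero |>.1 h1))
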